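/- Let $X$ be a complex manifold (Hausdorff, second countable, of dimension $n$) with complex structure operator $J$, and let $2\le r\le\infty$. For a real function $v$ put $\langle d^cv,\xi\rangle=-\langle dv,J\xi\rangle$, so that $dd^c=2i\partial\overline\partial$. Write $j^k(\alpha)|_M=0$ if, in local holomorphic coordinates on $X$, all partial derivatives of order $\le k$ (with respect to all real variables) of the components of the form $\alpha$ vanish at every point of $M$. Let $M\subset X$ be a real hypersurface of class $\mathcal C^r$ which is closed as a subset of $X$ and Levi-flat, that is, $\langle dd^c\rho,\xi\wedge J\xi\rangle=0$ for all $\xi\in T^{\mathbb C}M=TM\cap J(TM)$ and all local $\mathcal C^r$ defining functions $\rho$ of $M$. (No orientability needs to be assumed: each of the conditions below forces $M$ to be orientable.) The Levi foliation of $M$ is the foliation with tangent bundle $T^{\mathbb C}M$; it is defined by a one-form $\eta$ on $M$ if $\ker\eta=T^{\mathbb C}M$ at every point of $M$. For an open neighbourhood $U$ of $M$ in $X$ consider the following conditions. * (i)$_U$ There is a real function $v\in\mathcal C^r(U)$ with $M=\{x\in U: v(x)=0\}$, $dv\neq0$ on $M$, and $j^{r-2}(dd^cv)|_M=0$. * (ii)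 The Levi foliation of $M$ is defined by a closed one-form on $M$ of class $\mathcal C^{r-1}$. * (iii)$_U$ There is a complex function $f=u+iv\in\mathcal C^r(U)$ such that $M=\{x\in U: v(x)=0\}$, $dv\neq0$ on $M$, and $j^{r-1}(\overline\partial f)|_M=0$. Then: 1. (i)$_U$ holds for some open neighbourhood $U$ of $M$ if and only if (ii) holds. If $M$ is simply connected, these are further equivalent to (iii)$_U$ for some open neighbourhood $U$ of $M$. 2. Suppose that $M=\{x\in X:\rho(x)=0\}$ for some real function $\rho\in\mathcal C^r(X)$ with $d\rho\ne0$ on $M$. Then (i)$_X$ and (ii) are equivalent and, if $M$ is simply connected, they are further equivalent to (iii)$_X$. Here $r-1=r-2=\infty$ if $r=\infty$. -/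

import Mathlib

open scoped Manifold ContDiff

noncomputable section

namespace LeviFlat

/-- The model space `ℂⁿ`. -/
abbrev Cn (n : ℕ) : Type := EuclideanSpace ℂ (Fin n)

/-- The model space `ℝᵐ`. -/
abbrev Rn (m : ℕ) : Type := EuclideanSpace ℝ (Fin m)

/-- Order of smoothness `r ∈ {0, 1, 2, …, ∞}` as used by Mathlib's `ContDiff` (never analytic). -/
abbrev ord (r : ℕ∞) : WithTop ℕ∞ := (r : WithTop ℕ∞)

/-- The `m`-jet of `g` vanishes at `z`: all partial derivatives of order `≤ m` are zero at `z`
(for `m = ∞`, all partial derivatives). -/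
def JetVanishesAt {V W : Type*} [NormedAddCommGroup V] [NormedSpace ℝ V]
    [NormedAddCommGroup W] [NormedSpace ℝ W] (m : ℕ∞) (g : V → W) (z : V) : Prop :=
  ∀ k : ℕ, (k : ℕ∞) ≤ m → iteratedFDeriv ℝ k g z = 0

/-- A one-form on (an open subset of) a real normed space, viewed as an alternating form of
degree one. -/
def oneForm {V : Type*} [NormedAddCommGroup V] [NormedSpace ℝ V] (α : V → V →L[ℝ] ℝ) :
    V → V [⋀^Fin 1]→L[ℝ] ℝ :=
  fun z => ContinuousAlternatingMap.ofSubsingleton ℝ V ℝ (0 : Fin 1) (α z)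

section Flat

variable {n : ℕ}

/-- The operator `J` on `ℂⁿ` (multiplication by `i`), as a real linear map. -/
def J (n : ℕ) : Cn n →L[ℝ] Cn n :=
  (Complex.I • ContinuousLinearMap.id ℂ (Cn n)).restrictScalars ℝ

/-- `dᶜw` on `ℂⁿ`: `⟨dᶜw, ξ⟩ = -⟨dw, Jξ⟩`. -/
def dc (w : Cn n → ℝ) (z : Cn n) : Cn n →L[ℝ] ℝ :=
  -(fderiv ℝ w z).comp (J n)

/-- The real two-form `ddᶜw` on `ℂⁿ`. -/
def ddc (w : Cn n → ℝ) : Cn n → Cn n [⋀^Fin 2]→L[ℝ] ℝ :=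
  extDeriv (oneForm (dc w))

/-- `∂̄w` on `ℂⁿ`: the conjugate-linear part `ξ ↦ (dw(ξ) + i dw(Jξ)) / 2` of `dw`. -/
def dbar (w : Cn n → ℂ) (z : Cn n) : Cn n →L[ℝ] ℂ :=
  (1 / 2 : ℝ) • (fderiv ℝ w z + Complex.I • (fderiv ℝ w z).comp (J n))

end Flat

section Manifold

variable {n : ℕ} {X : Type*} [TopologicalSpace X] [ChartedSpace (Cn n) X]

/-- The expression of a function on `X` in the preferred holomorphic chart at `p`. -/
def inChart {W : Type*} (p : X) (v : X → W) : Cn n → W :=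
  v ∘ (chartAt (Cn n) p).symm

/-- The coordinates of `p` in the preferred holomorphic chart at `p`. -/
def coord (p : X) : Cn n := chartAt (Cn n) p p

variable (n) in
/-- The differential of a real function at `p`, in Mathlib's identification of the tangent space
at `p` with `ℂⁿ` through the preferred chart at `p`. -/
def differential (v : X → ℝ) (p : X) : Cn n →L[ℝ] ℝ :=
  mfderiv 𝓘(ℝ, Cn n) 𝓘(ℝ, ℝ) v p

variable (n) in
/-- `v` is a real `C^r` function on the open set `U ⊆ X`, `M ∩ U` is its zero set in `U`,
and `dv ≠ 0` at the points of `M ∩ U`. -/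
structure IsLocalDefiningFunction (r : ℕ∞) (M U : Set X) (v : X → ℝ) : Prop where
  isOpen : IsOpen U
  contMDiffOn : ContMDiffOn 𝓘(ℝ, Cn n) 𝓘(ℝ, ℝ) (ord r) v U
  zero_set : M ∩ U = {x ∈ U | v x = 0}
  differential_ne_zero : ∀ x ∈ M ∩ U, differential n v x ≠ 0

variable (n) in
/-- `v` is a `C^r` defining function of `M` on the open neighbourhood `U` of `M`:
`M = {x ∈ U : v x = 0}` and `dv ≠ 0` on `M`. -/
structure IsDefiningFunction (r : ℕ∞) (M U : Set X) (v : X → ℝ) : Prop where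
  isLocal : IsLocalDefiningFunction n r M U v
  subset : M ⊆ U

variable (n) in
/-- `M` is a (locally closed, embedded) real hypersurface of class `C^r` in `X`. -/
def IsRealHypersurface (r : ℕ∞) (M : Set X) : Prop :=
  ∀ p ∈ M, ∃ (U : Set X) (ρ : X → ℝ), p ∈ U ∧ IsLocalDefiningFunction n r M U ρ

variable (n) in
/-- The tangent space of the real hypersurface `M` at `p`, in `T_pX = ℂⁿ`: the vectors killed
by the differential at `p` of the local defining functions of `M` near `p`. -/
def tangentSpace (r : ℕ∞) (M : Set X) (p : X) : Set (Cn n) :=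
  {ξ | ∀ (U : Set X) (ρ : X → ℝ), p ∈ U → IsLocalDefiningFunction n r M U ρ →
    differential n ρ p ξ = 0}

variable (n) in
/-- The complex tangent space `T_p^ℂ M = T_pM ∩ J(T_pM)`. -/
def complexTangentSpace (r : ℕ∞) (M : Set X) (p : X) : Set (Cn n) :=
  tangentSpace n r M p ∩ J n '' tangentSpace n r M p

variable (n) in
/-- `M` is Levi-flat: the Levi form `ξ ↦ ⟨ddᶜρ, ξ ∧ Jξ⟩` on `T^ℂ M` vanishes identically,
for the local defining functions `ρ` of `M`. -/
def IsLeviFlat (r : ℕ∞) (M : Set X) : Prop :=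
  ∀ (U : Set X) (ρ : X → ℝ), IsLocalDefiningFunction n r M U ρ →
    ∀ p ∈ M ∩ U, ∀ ξ ∈ complexTangentSpace n r M p,
      ddc (inChart p ρ) (coord p) ![ξ, J n ξ] = 0

variable (n) in
/-- `j^m(ddᶜv)|_M = 0`, with respect to all variables of the ambient manifold `X`. -/
def DdcJetVanishesOn (m : ℕ∞) (M : Set X) (v : X → ℝ) : Prop :=
  ∀ p ∈ M, JetVanishesAt m (ddc (inChart (n := n) p v)) (coord p)

variable (n) in
/-- `j^m(∂̄f)|_M = 0`, with respect to all variables of the ambient manifold `X`. -/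
def DbarJetVanishesOn (m : ℕ∞) (M : Set X) (f : X → ℂ) : Prop :=
  ∀ p ∈ M, JetVanishesAt m (dbar (inChart (n := n) p f)) (coord p)

variable (n) in
/-- `φ` is a local `C^r` parametrization of the hypersurface `M` (of real dimension `2n - 1`)
on the open set `V ⊆ ℝ^{2n-1}`: a `C^r` immersion of `V` with values in `M`. -/
structure IsLocalParametrization (r : ℕ∞) (M : Set X) (V : Set (Rn (2 * n - 1)))
    (φ : Rn (2 * n - 1) → X) : Prop where
  isOpen : IsOpen V
  contMDiffOn : ContMDiffOn 𝓘(ℝ, Rn (2 * n - 1)) 𝓘(ℝ, Cn n) (ord r) φ V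
  mapsTo : ∀ s ∈ V, φ s ∈ M
  injective : ∀ s ∈ V, Function.Injective
    (mfderiv 𝓘(ℝ, Rn (2 * n - 1)) 𝓘(ℝ, Cn n) φ s)

/-- The pullback `φ^*η` of a one-form by a map `φ` from `ℝᵐ`. -/
def pullback {m : ℕ} (φ : Rn m → X) (η : X → Cn n →L[ℝ] ℝ) (s : Rn m) : Rn m →L[ℝ] ℝ :=
  (η (φ s)).comp (mfderiv 𝓘(ℝ, Rn m) 𝓘(ℝ, Cn n) φ s : Rn m →L[ℝ] Cn n)

/-- `η` is a closed one-form of class `C^{r-1}` on the `C^r` hypersurface `M` (`r ≥ 2`): it is so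
in every local `C^r` parametrization of `M`. Here `η p` is a linear functional on `T_pX`, of which
only the restriction to `T_pM`, for `p ∈ M`, is relevant. -/
def IsClosedOneFormOn (r : ℕ∞) (M : Set X) (η : X → Cn n →L[ℝ] ℝ) : Prop :=
  ∀ (V : Set (Rn (2 * n - 1))) (φ : Rn (2 * n - 1) → X), IsLocalParametrization n r M V φ →
    ContDiffOn ℝ (ord (r - 1)) (pullback φ η) V ∧
      ∀ s ∈ V, extDeriv (oneForm (pullback φ η)) s = 0

/-- The one-form `η` on `M` defines the Levi foliation, the foliation of `M` with tangent bundle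
`T^ℂ M`: the kernel of `η` in `T_pM` is `T_p^ℂ M` for every `p ∈ M`. -/
def DefinesLeviFoliation (r : ℕ∞) (M : Set X) (η : X → Cn n →L[ℝ] ℝ) : Prop :=
  ∀ p ∈ M, {ξ ∈ tangentSpace n r M p | η p ξ = 0} = complexTangentSpace n r M p

variable (n) in
/-- `M` has a defining function `v` of class `C^r` on its neighbourhood `U` with
`j^{r-2}(ddᶜv)|_M = 0`. -/
def HasPluriharmonicDefiningFunction (r : ℕ∞) (M U : Set X) : Prop :=
  ∃ v : X → ℝ, IsDefiningFunction n r M U v ∧ DdcJetVanishesOn n (r - 2) M v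

variable (n) in
/-- The Levi foliation of `M` is defined by a closed one-form of class `C^{r-1}` on `M`. -/
def LeviFoliationDefinedByClosedForm (r : ℕ∞) (M : Set X) : Prop :=
  ∃ η : X → Cn n →L[ℝ] ℝ, IsClosedOneFormOn r M η ∧ DefinesLeviFoliation r M η

variable (n) in
/-- There is a complex function `f = u + iv` of class `C^r` on the neighbourhood `U` of `M` with
`M = {v = 0}`, `dv ≠ 0` on `M`, and `j^{r-1}(∂̄f)|_M = 0`. -/
def HasHolomorphicFlattening (r : ℕ∞) (M U : Set X) : Prop :=
  ∃ f : X → ℂ, ContMDiffOn 𝓘(ℝ, Cn n) 𝓘(ℝ, ℂ) (ord r) f U ∧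
    IsDefiningFunction n r M U (fun x => (f x).im) ∧ DbarJetVanishesOn n (r - 1) M f

end Manifold

end LeviFlat

end

open LeviFlat

/-!
If `f = u + iv` satisfies `∂̄f = 0` to order `r - 1` along `M`, then `dᶜv = 2 Re ∂̄f - du`, and so
`ddᶜv` vanishes to order `r - 2` along `M`. If `v` is a defining function for which `ddᶜv` vanishes
at the points of `M`, then the form `dᶜv` restricts to a closed form on `M`, and its kernel is
`TM ∩ J(TM)` (`HasPluriharmonicDefiningFunction.leviFoliationDefinedByClosedForm`).

Conversely, let the Levi foliation be defined by a closed one-form `η` on `M`. Locally `η = dw` on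
`M`, with `w` of class `C^r`, and `w` is constant on the leaves, which are complex submanifolds.
There is then a local flattening of `M`: a function `f` of class `C^r` near a point of `M` with
`f = w` on `M` and `∂̄f = 0` to order `r - 1` along `M` (`exists_isLocalFlattening`). To preserve
the class `C^r`, the extension is made on the parametrization `h (κ, t)` of `M` by a complex leaf
variable `κ` and the real parameter `t = w`: for weights `cⱼ`, rapidly decreasing, with the moments
`∑ⱼ cⱼ 2^{jk} = i^k` (`exists_moments_eq_I_pow`), the function
`H(κ, t + is) = ∑ⱼ cⱼ h(κ, t + 2ʲ s)` has the same class as `h`, extends it, and is holomorphic to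
order `r - 1` along `{s = 0}` (`exists_almostHolomorphic_extension`). It is a local diffeomorphism,
and `f` is the last coordinate of its inverse (`exists_almostHolomorphic_extension_of_ker`).

Two flattenings with the same `η` differ along `M` by a locally constant real function up to order
`r`: the derivatives of the difference tangent to `M` vanish, and the Cauchy-Riemann equations then
determine the transverse ones (`jetVanishesAt_fderiv_of_tangent`). In particular their imaginary
parts have equal `r`-jets along `M`, and a partition of unity glues these to a function `v` with
the same `r`-jets (`exists_glue`); `ddᶜv` involves two derivatives of `v` and therefore still
vanishes to order `r - 2`. If `M` is simply connected, the constants can be removed, since a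
covering space of `M` has sections (`exists_sub_locallyConstant`), and the flattenings themselves
can be glued.

The function so obtained has no zeros off `M` in a neighbourhood of `M`. If `M` has a global
defining function `ρ`, one may multiply the flattenings by `±1`, with signs locally constant along
`M`, so that their imaginary parts have the sign of `ρ` (`IsFlatteningFamily.exists_sign_eq`).
These are glued with `ρ` (respectively `iρ`) off `M`; the partition of unity takes convex
combinations, hence preserves the sign, and there are no zeros off `M` in all of `X`.
-/

noncomputable section

namespace LeviFlat

open Filter Topology

/-! ### A rapidly decreasing measure on the powers of two with moments `i ^ k` -/

/-- The products `∏_{l < j} 4 · 2 ^ l / 2 ^ j` decrease like `2 ^ (-j² / 2)` up to exponential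
factors, hence faster than every power of `2 ^ j`. -/
lemma summable_interpolationBound (k : ℕ) :
    Summable fun j : ℕ => (∏ l ∈ Finset.range j, (4 * 2 ^ l / 2 ^ j : ℝ)) * ((2 : ℝ) ^ j) ^ k := by
  refine summable_of_ratio_test_tendsto_lt_one (l := 0) one_pos
    (Eventually.of_forall fun j => by positivity) ?_
  have h : Tendsto (fun j : ℕ => (2 * 2 ^ k) * (1 / 2 : ℝ) ^ j) atTop (𝓝 ((2 * 2 ^ k) * 0)) :=
    (tendsto_pow_atTop_nhds_zero_of_lt_one (by norm_num) (by norm_num)).const_mul _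
  rw [mul_zero] at h
  refine h.congr fun j => ?_
  have hp : (∏ l ∈ Finset.range (j + 1), (4 * 2 ^ l / 2 ^ (j + 1) : ℝ)) =
      (∏ l ∈ Finset.range j, (4 * 2 ^ l / 2 ^ j : ℝ)) * (1 / 2) ^ j * 2 := by
    rw [Finset.prod_range_succ]
    congr 1
    · rw [show (1 / 2 : ℝ) ^ j = ∏ _l ∈ Finset.range j, (1 / 2 : ℝ) by simp,
        ← Finset.prod_mul_distrib]
      refine Finset.prod_congr rfl fun l _ => ?_
      rw [pow_succ]; field_simp
    · rw [pow_succ]; field_simp; norm_num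
  have hne : (∏ l ∈ Finset.range j, (4 * 2 ^ l / 2 ^ j : ℝ)) ≠ 0 :=
    Finset.prod_ne_zero_iff.2 fun l _ => by positivity
  rw [Real.norm_of_nonneg (by positivity), Real.norm_of_nonneg (by positivity), hp]
  rw [pow_succ 2 j, mul_pow]
  field_simp

/-- The coefficients of Lagrange interpolation at `i` on the nodes `1, 2, …, 2 ^ N` are bounded,
uniformly in `N`, by a rapidly decreasing sequence. -/
lemma norm_prod_interpolation_le (N j : ℕ) (hj : j ≤ N) :
    ‖∏ l ∈ (Finset.range (N + 1)).erase j, ((2 : ℂ) ^ j - 2 ^ l)⁻¹ * (Complex.I - 2 ^ l)‖ ≤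
      Real.exp 8 * ∏ l ∈ Finset.range j, (4 * 2 ^ l / 2 ^ j : ℝ) := by
  -- The factor of index `l` is at most `4 · 2 ^ l / 2 ^ j` for `l < j`, and at most
  -- `1 + 4 · 2 ^ j / 2 ^ l ≤ exp (4 · 2 ^ j / 2 ^ l)` for `l > j`; the exponents of the latter
  -- sum to at most `8`.
  set u : ℕ → ℝ := fun l => if l < j then 4 * 2 ^ l / 2 ^ j else Real.exp (4 * (2 ^ j / 2 ^ l))
    with hu
  have hu0 : ∀ l, 0 < u l := fun l => by
    simp only [hu]; split_ifs <;> positivity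
  have hI : ∀ l : ℕ, ‖Complex.I - 2 ^ l‖ ≤ 1 + 2 ^ l := fun l =>
    (norm_sub_le _ _).trans (by simp)
  have hd : ∀ l : ℕ, ‖(2 : ℂ) ^ j - 2 ^ l‖ = |(2 : ℝ) ^ j - 2 ^ l| := fun l => by
    rw [show (2 : ℂ) ^ j - 2 ^ l = ((2 ^ j - 2 ^ l : ℝ) : ℂ) by push_cast; rfl, Complex.norm_real,
      Real.norm_eq_abs]
  have h1 : ∀ l ∈ (Finset.range (N + 1)).erase j,
      ‖((2 : ℂ) ^ j - 2 ^ l)⁻¹ * (Complex.I - 2 ^ l)‖ ≤ u l := by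
    intro l hl
    have hlj : l ≠ j := (Finset.mem_erase.1 hl).1
    rw [norm_mul, norm_inv, hd, inv_mul_eq_div]
    simp only [hu]
    split_ifs with hlt
    · have h2 : (2 : ℝ) * 2 ^ l ≤ 2 ^ j := by
        rw [← pow_succ']; exact pow_le_pow_right₀ (by norm_num) hlt
      have h3 : (1 : ℝ) ≤ 2 ^ l := one_le_pow₀ (by norm_num)
      rw [abs_of_pos (by linarith), div_le_div_iff₀ (by linarith) (by positivity)]
      nlinarith [hI l]
    · have hlt' : j < l := lt_of_le_of_ne (not_lt.1 hlt) hlj.symm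
      have h2 : (2 : ℝ) * 2 ^ j ≤ 2 ^ l := by
        rw [← pow_succ']; exact pow_le_pow_right₀ (by norm_num) hlt'
      have h3 : (1 : ℝ) ≤ 2 ^ j := one_le_pow₀ (by norm_num)
      rw [abs_of_neg (by linarith)]
      refine le_trans ?_ (Real.add_one_le_exp _)
      rw [div_le_iff₀ (by linarith)]
      have h4 : (2 : ℝ) ^ j / 2 ^ l * 2 ^ l = 2 ^ j := by field_simp
      have h5 : (2 : ℝ) ^ j / 2 ^ l ≤ 1 / 2 := by
        rw [div_le_iff₀ (by positivity)]; linarith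
      have h6 : (2 : ℝ) ^ j / 2 ^ l * 2 ^ j ≤ 1 / 2 * 2 ^ j := by gcongr
      nlinarith [hI l]
  rw [norm_prod]
  refine (Finset.prod_le_prod (fun _ _ => norm_nonneg _) h1).trans ?_
  have huj : 1 ≤ u j := by
    simp only [hu, lt_irrefl, if_false]; exact Real.one_le_exp (by positivity)
  have h2 : ∏ l ∈ (Finset.range (N + 1)).erase j, u l ≤ ∏ l ∈ Finset.range (N + 1), u l := by
    rw [← Finset.mul_prod_erase _ _ (Finset.mem_range.2 (Nat.lt_succ_of_le hj))]
    exact le_mul_of_one_le_left (Finset.prod_nonneg fun l _ => (hu0 l).le) huj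
  refine h2.trans ?_
  obtain ⟨m, rfl⟩ : ∃ m, N = j + m := ⟨N - j, by omega⟩
  rw [add_assoc, Finset.prod_range_add, mul_comm]
  refine mul_le_mul ?_ (le_of_eq ?_) (Finset.prod_nonneg fun l _ => (hu0 l).le) (by positivity)
  · have : ∀ x ∈ Finset.range (m + 1), u (j + x) = Real.exp (4 * (1 / 2) ^ x) := by
      intro x _
      simp only [hu, not_lt_of_ge (Nat.le_add_right j x), if_false, pow_add]
      congr 2
      rw [div_pow, one_pow]; field_simp
    rw [Finset.prod_congr rfl this, ← Real.exp_sum, ← Finset.mul_sum]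
    refine Real.exp_le_exp.2 ?_
    have := (summable_geometric_two).sum_le_tsum (Finset.range (m + 1))
      (fun i _ => by positivity)
    rw [tsum_geometric_two] at this
    linarith
  · refine Finset.prod_congr rfl fun l hl => ?_
    simp [hu, Finset.mem_range.1 hl]

/-- A rapidly decreasing discrete measure on the nodes `2 ^ j` with moments `i ^ k`: every
polynomial has at `i` the value which the measure assigns to it. It is a limit of the Lagrange
interpolation formulas at `i` on finitely many of the nodes. -/
theorem exists_moments_eq_I_pow : ∃ c : ℕ → ℂ,
    (∀ k : ℕ, Summable fun j => ‖c j‖ * ((2 : ℝ) ^ j) ^ k) ∧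
      ∀ k : ℕ, ∑' j, c j * ((2 : ℂ) ^ j) ^ k = Complex.I ^ k := by
  classical
  set b : ℕ → ℝ := fun j => Real.exp 8 * ∏ l ∈ Finset.range j, (4 * 2 ^ l / 2 ^ j : ℝ) with hb
  set a : ℕ → ℕ → ℂ := fun N j => if j ∈ Finset.range (N + 1) then
    ∏ l ∈ (Finset.range (N + 1)).erase j, ((2 : ℂ) ^ j - 2 ^ l)⁻¹ * (Complex.I - 2 ^ l) else 0
    with ha
  have hb0 : ∀ j, 0 ≤ b j := fun j => by positivity
  have hbs : ∀ k : ℕ, Summable fun j => b j * ((2 : ℝ) ^ j) ^ k := fun k => by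
    simpa only [hb, mul_assoc] using (summable_interpolationBound k).mul_left (Real.exp 8)
  have hab : ∀ N j, ‖a N j‖ ≤ b j := by
    intro N j
    simp only [ha]
    split_ifs with h
    · exact norm_prod_interpolation_le N j (Nat.lt_succ_iff.1 (Finset.mem_range.1 h))
    · simpa using hb0 j
  have hinj : Function.Injective fun j : ℕ => (2 : ℂ) ^ j := by
    intro i j hij
    have : ((2 ^ i : ℕ) : ℂ) = ((2 ^ j : ℕ) : ℂ) := by simpa using hij
    exact Nat.pow_right_injective le_rfl (Nat.cast_injective this)
  have hsum : ∀ k N : ℕ, k ≤ N → ∑' j, a N j * ((2 : ℂ) ^ j) ^ k = Complex.I ^ k := by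
    intro k N hkN
    rw [tsum_eq_sum (s := Finset.range (N + 1)) 
      (fun j hj => by simp only [ha, if_neg hj, zero_mul])]
    have h := Lagrange.eq_interpolate (s := Finset.range (N + 1)) (v := fun j : ℕ => (2 : ℂ) ^ j)
      (f := Polynomial.X ^ k) hinj.injOn (by
        rw [Polynomial.degree_X_pow, Finset.card_range]; exact_mod_cast Nat.lt_succ_of_le hkN)
    have h' := congrArg (Polynomial.eval Complex.I) h
    rw [Lagrange.interpolate_apply, Polynomial.eval_finsetSum] at h'
    simp only [Polynomial.eval_pow, Polynomial.eval_X, Polynomial.eval_mul, Polynomial.eval_C] at h'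
    rw [h']
    refine Finset.sum_congr rfl fun j hj => ?_
    rw [mul_comm]
    congr 1
    simp only [ha, hj, if_true, Lagrange.basis, Lagrange.basisDivisor, Polynomial.eval_prod,
      Polynomial.eval_mul, Polynomial.eval_C, Polynomial.eval_sub, Polynomial.eval_X]
  -- A limit point, in a product of discs, of the coefficients for growing `N`; the moments pass to
  -- the limit by dominated convergence.
  obtain ⟨c, hcS, hc⟩ := (isCompact_univ_pi fun j => isCompact_closedBall (0 : ℂ) (b j)
    ).ultrafilter_le_nhds ((hyperfilter ℕ).map a) (by
      rw [Ultrafilter.coe_map, le_principal_iff, mem_map]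
      exact Eventually.of_forall fun N => by simpa using hab N)
  have hcb : ∀ j, ‖c j‖ ≤ b j := fun j => by simpa using hcS j (Set.mem_univ j)
  have hlim : ∀ j, Tendsto (fun N => a N j) (hyperfilter ℕ) (𝓝 (c j)) := fun j =>
    tendsto_pi_nhds.1 (show Tendsto a (hyperfilter ℕ) (𝓝 c) from hc) j
  refine ⟨c, fun k => (hbs k).of_nonneg_of_le (fun j => by positivity) fun j => by
    gcongr; exact hcb j, fun k => ?_⟩
  refine tendsto_nhds_unique (tendsto_tsum_of_dominated_convergence
    (𝓕 := (hyperfilter ℕ : Filter ℕ)) (f := fun N j => a N j * ((2 : ℂ) ^ j) ^ k) (hbs k)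
    (fun j => (hlim j).mul_const _) (Eventually.of_forall fun N j => ?_)) ?_
  · rw [norm_mul, norm_pow, norm_pow, Complex.norm_ofNat]
    gcongr; exact hab N j
  · refine tendsto_const_nhds.congr' ?_
    have : ∀ᶠ N in (hyperfilter ℕ : Filter ℕ), k ≤ N :=
      (hyperfilter_le_cofinite.trans (Nat.cofinite_eq_atTop ▸ le_rfl)) (eventually_ge_atTop k)
    filter_upwards [this] with N hN using (hsum k N hN).symm

/-! ### Calculus of vanishing jets -/

section Jets

variable {V W W' G : Type*} [NormedAddCommGroup V] [NormedSpace ℝ V]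
  [NormedAddCommGroup W] [NormedSpace ℝ W] [NormedAddCommGroup W'] [NormedSpace ℝ W']
  [NormedAddCommGroup G] [NormedSpace ℝ G] {m : ℕ∞} {z : V}

lemma natCast_le_ord {k : ℕ} (h : (k : ℕ∞) ≤ m) : (k : WithTop ℕ∞) ≤ ord m :=
  WithTop.coe_le_coe.2 h

lemma JetVanishesAt.congr {g g' : V → W} (hg : JetVanishesAt m g z) (h : g =ᶠ[𝓝 z] g') :
    JetVanishesAt m g' z := fun k hk => by
  rw [← (h.iteratedFDeriv (𝕜 := ℝ) k).eq_of_nhds]; exact hg k hk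

lemma JetVanishesAt.mono {m' : ℕ∞} {g : V → W} (hg : JetVanishesAt m g z) (h : m' ≤ m) :
    JetVanishesAt m' g z := fun k hk => hg k (hk.trans h)

lemma JetVanishesAt.apply_eq_zero {g : V → W} (hg : JetVanishesAt m g z) : g z = 0 := by
  have h := hg 0 (by simp)
  rw [← iteratedFDeriv_zero_apply (𝕜 := ℝ) (f := g) (x := z) 0, h]; simp

lemma jetVanishesAt_iff_nat {g : V → W} :
    JetVanishesAt m g z ↔ ∀ k : ℕ, (k : ℕ∞) ≤ m → JetVanishesAt k g z :=
  ⟨fun h _ hk => h.mono hk, fun h k hk => h k hk k le_rfl⟩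

lemma jetVanishesAt_const_zero : JetVanishesAt m (fun _ : V => (0 : W)) z := fun k _ => by simp

lemma iteratedFDeriv_succ_eq_zero_iff {g : V → W} (k : ℕ) :
    iteratedFDeriv ℝ (k + 1) g z = 0 ↔ iteratedFDeriv ℝ k (fderiv ℝ g) z = 0 := by
  rw [iteratedFDeriv_succ_eq_comp_right]
  exact (continuousMultilinearCurryRightEquiv' ℝ k V W).symm.map_eq_zero_iff

lemma jetVanishesAt_add_one_iff {g : V → W} :
    JetVanishesAt (m + 1) g z ↔ g z = 0 ∧ JetVanishesAt m (fderiv ℝ g) z := by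
  constructor
  · refine fun h => ⟨h.apply_eq_zero, fun k hk => (iteratedFDeriv_succ_eq_zero_iff k).1 ?_⟩
    exact h (k + 1) (by push_cast; gcongr)
  · rintro ⟨h0, h⟩ k hk
    cases k with
    | zero => ext v; simpa using h0
    | succ k =>
      refine (iteratedFDeriv_succ_eq_zero_iff k).2 (h k ?_)
      push_cast at hk
      exact (ENat.add_le_add_iff_right (by simp)).1 hk

lemma JetVanishesAt.clm_comp {g : V → W} (hg : JetVanishesAt m g z) (L : W →L[ℝ] W')
    (hc : ContDiffAt ℝ (ord m) g z) : JetVanishesAt m (fun x => L (g x)) z := fun k hk => by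
  have := L.iteratedFDeriv_comp_left hc (natCast_le_ord hk)
  rw [hg k hk] at this
  rw [show (fun x => L (g x)) = L ∘ g from rfl, this]
  ext v; simp

lemma JetVanishesAt.add {g g' : V → W} (hg : JetVanishesAt m g z) (hg' : JetVanishesAt m g' z)
    (hc : ContDiffAt ℝ (ord m) g z) (hc' : ContDiffAt ℝ (ord m) g' z) :
    JetVanishesAt m (fun x => g x + g' x) z := fun k hk => by
  rw [show (fun x => g x + g' x) = g + g' from rfl,
    iteratedFDeriv_add_apply (hc.of_le (natCast_le_ord hk)) (hc'.of_le (natCast_le_ord hk)),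
    hg k hk, hg' k hk, add_zero]

lemma JetVanishesAt.sub {g g' : V → W} (hg : JetVanishesAt m g z) (hg' : JetVanishesAt m g' z)
    (hc : ContDiffAt ℝ (ord m) g z) (hc' : ContDiffAt ℝ (ord m) g' z) :
    JetVanishesAt m (fun x => g x - g' x) z := fun k hk => by
  rw [show (fun x => g x - g' x) = g - g' from rfl,
    iteratedFDeriv_sub_apply (hc.of_le (natCast_le_ord hk)) (hc'.of_le (natCast_le_ord hk)),
    hg k hk, hg' k hk, sub_zero]

lemma JetVanishesAt.sum {ι : Type*} {s : Finset ι} {g : ι → V → W}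
    (hg : ∀ i ∈ s, JetVanishesAt m (g i) z) (hc : ∀ i ∈ s, ContDiffAt ℝ (ord m) (g i) z) :
    JetVanishesAt m (fun x => ∑ i ∈ s, g i x) z := fun k hk => by
  rw [iteratedFDeriv_fun_sum_apply fun i hi => (hc i hi).of_le (natCast_le_ord hk)]
  exact Finset.sum_eq_zero fun i hi => hg i hi k hk

lemma exists_open_contDiffOn {k : ℕ} {g : V → W} (hg : ContDiffAt ℝ k g z) :
    ∃ u, IsOpen u ∧ z ∈ u ∧ ContDiffOn ℝ k g u := by
  obtain ⟨u, hu, hz, h⟩ := hg.contDiffWithinAt.contDiffOn' (s := Set.univ) le_rfl (by simp)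
  exact ⟨u, hu, hz, by simpa using h⟩

/-- A product has vanishing jet as soon as one of the factors has. -/
lemma JetVanishesAt.bilinear {g : V → W} {g' : V → W'} (hg : JetVanishesAt m g z)
    (B : W →L[ℝ] W' →L[ℝ] G)
    (hc : ContDiffAt ℝ (ord m) g z) (hc' : ContDiffAt ℝ (ord m) g' z) :
    JetVanishesAt m (fun x => B (g x) (g' x)) z := fun k hk => by
  obtain ⟨u, hu, hzu, h⟩ := exists_open_contDiffOn (hc.of_le (natCast_le_ord hk))
  obtain ⟨u', hu', hzu', h'⟩ := exists_open_contDiffOn (hc'.of_le (natCast_le_ord hk))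
  have hz : z ∈ u ∩ u' := ⟨hzu, hzu'⟩
  have key := B.norm_iteratedFDerivWithin_le_of_bilinear (h.mono Set.inter_subset_left)
    (h'.mono Set.inter_subset_right) (hu.inter hu').uniqueDiffOn hz (n := k) le_rfl
  have h0 : ∀ i ∈ Finset.range (k + 1), iteratedFDerivWithin ℝ i g (u ∩ u') z = 0 := by
    intro i hi
    rw [iteratedFDerivWithin_of_isOpen i (hu.inter hu') hz]
    exact hg i ((Nat.cast_le.2 (Nat.lt_succ_iff.1 (Finset.mem_range.1 hi))).trans hk)
  rw [Finset.sum_eq_zero fun i hi => by simp [h0 i hi], mul_zero,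
    iteratedFDerivWithin_of_isOpen k (hu.inter hu') hz] at key
  exact norm_le_zero_iff.1 key

/-- The vanishing of the jet of `g` at `f z` is inherited by `g ∘ f` at `z`. -/
lemma JetVanishesAt.comp {g : W → G} {f : V → W} (hg : JetVanishesAt m g (f z))
    (hc : ContDiffAt ℝ (ord m) g (f z)) (hf : ContDiffAt ℝ (ord m) f z) :
    JetVanishesAt m (fun x => g (f x)) z := fun k hk => by
  obtain ⟨u, hu, hzu, h⟩ := exists_open_contDiffOn (hc.of_le (natCast_le_ord hk))
  obtain ⟨u', hu', hzu', h'⟩ := exists_open_contDiffOn (hf.of_le (natCast_le_ord hk))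
  have ho : IsOpen (u' ∩ f ⁻¹' u) := h'.continuousOn.isOpen_inter_preimage hu' hu
  have hz : z ∈ u' ∩ f ⁻¹' u := ⟨hzu', hzu⟩
  obtain ⟨D, hD1, hD⟩ : ∃ D : ℝ, 1 ≤ D ∧
      ∀ i ≤ k, ‖iteratedFDerivWithin ℝ i f (u' ∩ f ⁻¹' u) z‖ ≤ D := by
    refine ⟨1 + ∑ i ∈ Finset.range (k + 1), ‖iteratedFDerivWithin ℝ i f (u' ∩ f ⁻¹' u) z‖,
      le_add_of_nonneg_right (Finset.sum_nonneg fun _ _ => norm_nonneg _), fun i hi => ?_⟩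
    refine le_trans ?_ (le_add_of_nonneg_left zero_le_one)
    exact Finset.single_le_sum
      (f := fun i => ‖iteratedFDerivWithin ℝ i f (u' ∩ f ⁻¹' u) z‖)
      (fun _ _ => norm_nonneg _) (Finset.mem_range.2 (Nat.lt_succ_of_le hi))
  have key := norm_iteratedFDerivWithin_comp_le h (h'.mono Set.inter_subset_left) le_rfl
    hu.uniqueDiffOn ho.uniqueDiffOn (fun x hx => hx.2) hz (C := 0) (D := D)
    (fun i hi => by
      rw [iteratedFDerivWithin_of_isOpen i hu hzu, hg i ((Nat.cast_le.2 hi).trans hk)]; simp)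
    (fun i hi1 hi => (hD i hi).trans (le_self_pow₀ hD1 (by omega)))
  rw [mul_zero, zero_mul, iteratedFDerivWithin_of_isOpen k ho hz] at key
  exact norm_le_zero_iff.1 key

lemma ContDiffAt.fderiv_ord {g : V → W} {r : ℕ∞} (hg : ContDiffAt ℝ (ord r) g z) (hr : 1 ≤ r) :
    ContDiffAt ℝ (ord (r - 1)) (fderiv ℝ g) z := by
  refine hg.fderiv_right ?_
  have : r - 1 + 1 = r := tsub_add_cancel_of_le hr
  change ((r - 1 + 1 : ℕ∞) : WithTop ℕ∞) ≤ (r : WithTop ℕ∞)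
  exact WithTop.coe_le_coe.2 this.le

end Jets

/-! ### Superpositions of dilates of a function -/

section Spread

lemma exists_bound_iteratedFDeriv {Y F : Type*} [NormedAddCommGroup Y] [NormedSpace ℝ Y]
    [NormedAddCommGroup F] [NormedSpace ℝ F] {N : WithTop ℕ∞} {q : Y → F} (hq : ContDiff ℝ N q)
    (hs : HasCompactSupport q) {k : ℕ} (hk : (k : WithTop ℕ∞) ≤ N) :
    ∃ D, ∀ y, ‖iteratedFDeriv ℝ k q y‖ ≤ D :=
  (hq.continuous_iteratedFDeriv hk).bounded_above_of_compact_support (hs.iteratedFDeriv k)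

lemma contDiff_dilate {Y Z F : Type*} [NormedAddCommGroup Y] [NormedSpace ℝ Y]
    [NormedAddCommGroup Z] [NormedSpace ℝ Z] [NormedAddCommGroup F] [NormedSpace ℝ F]
    [NormedSpace ℂ F] {A B : Z →L[ℝ] Y} {m : ℕ∞} {q : Y → F} (hq : ContDiff ℝ (ord m) q)
    (a : ℂ) (j : ℕ) : ContDiff ℝ (ord m) fun x => a • q (A x + (2 : ℝ) ^ j • B x) :=
  contDiff_const.smul (hq.comp (A.contDiff.add (contDiff_const.smul B.contDiff)))

/-- The superposition `x ↦ ∑ⱼ cⱼ q(A x + 2ʲ B x)` of dilates of `q`. -/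
def spread {Y Z F : Type*} [NormedAddCommGroup Y] [NormedSpace ℝ Y]
    [NormedAddCommGroup Z] [NormedSpace ℝ Z] [NormedAddCommGroup F] [NormedSpace ℂ F]
    (c : ℕ → ℂ) (A B : Z →L[ℝ] Y) (q : Y → F) (x : Z) : F :=
  ∑' j, c j • q (A x + (2 : ℝ) ^ j • B x)

variable {Y Z F : Type*} [NormedAddCommGroup Y] [NormedSpace ℝ Y]
  [NormedAddCommGroup Z] [NormedSpace ℝ Z]
  [NormedAddCommGroup F] [NormedSpace ℝ F] [NormedSpace ℂ F] [IsScalarTower ℝ ℂ F]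

/-- A sequence of weights on the nodes `2 ^ j` which is absolutely summable against every
polynomial. -/
def RapidlyDecreasing (c : ℕ → ℂ) : Prop :=
  ∀ k : ℕ, Summable fun j => ‖c j‖ * ((2 : ℝ) ^ j) ^ k

lemma iteratedFDeriv_dilate {N : WithTop ℕ∞} {q : Y → F} (hq : ContDiff ℝ N q) {k : ℕ}
    (hk : (k : WithTop ℕ∞) ≤ N) (c : ℂ) (A B : Z →L[ℝ] Y) (j : ℕ) (x : Z) :
    iteratedFDeriv ℝ k (fun x => c • q (A x + (2 : ℝ) ^ j • B x)) x =
      c • (iteratedFDeriv ℝ k q (A x + (2 : ℝ) ^ j • B x)).compContinuousLinearMap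
        fun _ => A + (2 : ℝ) ^ j • B := by
  have h := (A + (2 : ℝ) ^ j • B).iteratedFDeriv_comp_right hq x hk
  have := iteratedFDeriv_const_smul_apply (𝕜 := ℝ) (i := k) (x := x) (a := c)
    (f := q ∘ (A + (2 : ℝ) ^ j • B))
    ((hq.comp (A + (2 : ℝ) ^ j • B).contDiff).contDiffAt.of_le hk)
  rw [h] at this
  exact this

lemma norm_iteratedFDeriv_dilate_le {N : WithTop ℕ∞} {q : Y → F} (hq : ContDiff ℝ N q) {k : ℕ}
    (hk : (k : WithTop ℕ∞) ≤ N) {D : ℝ} (hD : ∀ y, ‖iteratedFDeriv ℝ k q y‖ ≤ D)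
    (c : ℂ) (A B : Z →L[ℝ] Y) (j : ℕ) (x : Z) :
    ‖iteratedFDeriv ℝ k (fun x => c • q (A x + (2 : ℝ) ^ j • B x)) x‖ ≤
      D * (‖A‖ + ‖B‖) ^ k * (‖c‖ * ((2 : ℝ) ^ j) ^ k) := by
  set L : Z →L[ℝ] Y := A + (2 : ℝ) ^ j • B with hL
  have h2j : (1 : ℝ) ≤ 2 ^ j := one_le_pow₀ (by norm_num)
  have hLn : ‖L‖ ≤ (‖A‖ + ‖B‖) * 2 ^ j := by
    refine (norm_add_le _ _).trans ?_
    rw [norm_smul, Real.norm_of_nonneg (by positivity)]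
    nlinarith [norm_nonneg A, norm_nonneg B]
  have hD0 : 0 ≤ D := (norm_nonneg _).trans (hD 0)
  rw [iteratedFDeriv_dilate hq hk, norm_smul]
  calc ‖c‖ * ‖(iteratedFDeriv ℝ k q (L x)).compContinuousLinearMap fun _ => L‖
      ≤ ‖c‖ * (D * ((‖A‖ + ‖B‖) * 2 ^ j) ^ k) := by
        gcongr
        refine (ContinuousMultilinearMap.norm_compContinuousLinearMap_le _ _).trans ?_
        rw [Finset.prod_const, Finset.card_univ, Fintype.card_fin]
        gcongr
        exact hD _
    _ = _ := by rw [mul_pow]; ring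

variable {c : ℕ → ℂ} {A B : Z →L[ℝ] Y} {m : ℕ∞} {q : Y → F}

lemma spread_summable_and_bound (hc : RapidlyDecreasing c) (hq : ContDiff ℝ (ord m) q)
    (hs : HasCompactSupport q) : ∃ v : ℕ → ℕ → ℝ,
      (∀ k : ℕ, (k : ℕ∞) ≤ m → Summable (v k)) ∧ ∀ (k j : ℕ) (x : Z), (k : ℕ∞) ≤ m →
        ‖iteratedFDeriv ℝ k (fun x => c j • q (A x + (2 : ℝ) ^ j • B x)) x‖ ≤ v k j := by
  have : ∀ k : ℕ, ∃ D, (k : ℕ∞) ≤ m → ∀ y, ‖iteratedFDeriv ℝ k q y‖ ≤ D := fun k => by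
    by_cases hk : (k : ℕ∞) ≤ m
    · obtain ⟨D, hD⟩ := exists_bound_iteratedFDeriv hq hs (natCast_le_ord hk)
      exact ⟨D, fun _ => hD⟩
    · exact ⟨0, fun h => absurd h hk⟩
  choose D hD using this
  exact ⟨fun k j => D k * (‖A‖ + ‖B‖) ^ k * (‖c j‖ * ((2 : ℝ) ^ j) ^ k),
    fun k _ => (hc k).mul_left _,
    fun k j x hk => norm_iteratedFDeriv_dilate_le hq (natCast_le_ord hk) (hD k hk) _ _ _ _ _⟩

variable [CompleteSpace F]

lemma contDiff_spread (hc : RapidlyDecreasing c) (hq : ContDiff ℝ (ord m) q)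
    (hs : HasCompactSupport q) : ContDiff ℝ (ord m) (spread c A B q) := by
  obtain ⟨v, hv, hb⟩ := spread_summable_and_bound (A := A) (B := B) hc hq hs
  exact contDiff_tsum (fun j => contDiff_dilate hq _ j) hv hb

/-- Differentiation of `spread` under the summation sign. -/
lemma hasSum_iteratedFDeriv_spread (hc : RapidlyDecreasing c) (hq : ContDiff ℝ (ord m) q)
    (hs : HasCompactSupport q) {k : ℕ} (hk : (k : ℕ∞) ≤ m) (x : Z) (v : Fin k → Z) :
    HasSum (fun j => c j • iteratedFDeriv ℝ k q (A x + (2 : ℝ) ^ j • B x)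
      (fun i => A (v i) + (2 : ℝ) ^ j • B (v i))) (iteratedFDeriv ℝ k (spread c A B q) x v) := by
  obtain ⟨w, hw, hb⟩ := spread_summable_and_bound (A := A) (B := B) hc hq hs
  have hsum : Summable fun j =>
      iteratedFDeriv ℝ k (fun x => c j • q (A x + (2 : ℝ) ^ j • B x)) x :=
    (hw k hk).of_norm_bounded fun j => hb k j x hk
  have h := hsum.hasSum
  rw [← iteratedFDeriv_tsum_apply (fun j => contDiff_dilate hq _ j) hw hb hk] at h
  have h' := h.mapL (ContinuousMultilinearMap.apply ℝ (fun _ : Fin k => Z) F v)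
  simp only [iteratedFDeriv_dilate hq (natCast_le_ord hk)] at h'
  exact h'

/-- If all moments of `c` vanish, then `spread c A B q` is flat along `{B = 0}`. -/
lemma jetVanishesAt_spread_of_moments (hc : RapidlyDecreasing c)
    (h0 : ∀ k : ℕ, ∑' j, c j * ((2 : ℂ) ^ j) ^ k = 0) (hq : ContDiff ℝ (ord m) q)
    (hs : HasCompactSupport q) {x : Z} (hx : B x = 0) :
    JetVanishesAt m (spread c A B q) x := by
  intro k hk
  ext v
  have h := hasSum_iteratedFDeriv_spread (A := A) (B := B) hc hq hs hk x v
  refine h.unique ?_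
  simp only [hx, smul_zero, add_zero]
  -- Expanded by multilinearity, the `j`-th term is a polynomial in `2 ^ j` times `c j`.
  set T := iteratedFDeriv ℝ k q (A x)
  have hmom : ∀ l : ℕ, HasSum (fun j => c j * ((2 : ℂ) ^ j) ^ l) 0 := fun l => by
    have hsm : Summable fun j => c j * ((2 : ℂ) ^ j) ^ l := by
      refine Summable.of_norm ?_
      simpa using hc l
    simpa only [h0 l] using hsm.hasSum
  have hexp : ∀ j : ℕ, c j • T (fun i => A (v i) + (2 : ℝ) ^ j • B (v i)) =
      ∑ s : Finset (Fin k), (c j * ((2 : ℂ) ^ j) ^ (sᶜ).card) •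
        T (s.piecewise (fun i => A (v i)) (fun i => B (v i))) := by
    intro j
    have h1 := T.toMultilinearMap.map_add_univ (fun i => A (v i))
      (fun i => (2 : ℝ) ^ j • B (v i))
    change T (fun i => A (v i) + (2 : ℝ) ^ j • B (v i)) = _ at h1
    rw [h1, Finset.smul_sum]
    refine Finset.sum_congr rfl fun s _ => ?_
    have h2 := T.toMultilinearMap.map_piecewise_smul (fun _ => (2 : ℝ) ^ j)
      (s.piecewise (fun i => A (v i)) (fun i => B (v i))) sᶜ
    have h3 : (sᶜ).piecewise
        (fun i => (2 : ℝ) ^ j • s.piecewise (fun i => A (v i)) (fun i => B (v i)) i)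
        (s.piecewise (fun i => A (v i)) (fun i => B (v i))) =
        s.piecewise (fun i => A (v i)) (fun i => (2 : ℝ) ^ j • B (v i)) := by
      ext i
      by_cases hi : i ∈ s <;> simp [hi]
    rw [h3] at h2
    rw [h2, Finset.prod_const, mul_smul]
    congr 1
    rw [← algebraMap_smul ℂ (((2 : ℝ) ^ j) ^ (sᶜ).card)]
    simp
  simp only [hexp]
  rw [show (0 : Z [×k]→L[ℝ] F) v = ∑ s : Finset (Fin k), (0 : ℂ) •
    T (s.piecewise (fun i => A (v i)) (fun i => B (v i))) by simp]
  exact hasSum_sum fun s _ => (hmom _).smul_const _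

/-- `spread c A B q` is flat at a point of `{B = 0}` if `q` is flat at its image. -/
lemma jetVanishesAt_spread_of_jetVanishesAt (hc : RapidlyDecreasing c)
    (hq : ContDiff ℝ (ord m) q) (hs : HasCompactSupport q) {x : Z} (hx : B x = 0)
    (h : JetVanishesAt m q (A x)) : JetVanishesAt m (spread c A B q) x := by
  intro k hk
  ext v
  refine (hasSum_iteratedFDeriv_spread (A := A) (B := B) hc hq hs hk x v).unique ?_
  simp [hx, h k hk]

lemma hasSum_fderiv_spread (hc : RapidlyDecreasing c) (hq : ContDiff ℝ (ord m) q)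
    (hs : HasCompactSupport q) (hm : 1 ≤ m) (x v : Z) :
    HasSum (fun j => c j • fderiv ℝ q (A x + (2 : ℝ) ^ j • B x) (A v + (2 : ℝ) ^ j • B v))
      (fderiv ℝ (spread c A B q) x v) := by
  simpa using hasSum_iteratedFDeriv_spread (A := A) (B := B) hc hq hs (k := 1)
    (by exact_mod_cast hm) x ![v]

/-- The hypothesis `∑' j, c j = 1` includes the summability of `c`, as a sum which does not converge
has the value zero. -/
lemma spread_apply_of_moment_zero {Y Z F : Type*} [NormedAddCommGroup Y] [NormedSpace ℝ Y]
    [NormedAddCommGroup Z] [NormedSpace ℝ Z] [NormedAddCommGroup F] [NormedSpace ℂ F]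
    {c : ℕ → ℂ} {A B : Z →L[ℝ] Y} {q : Y → F} (h1 : ∑' j, c j = 1) {x : Z} (hx : B x = 0) :
    spread c A B q x = q (A x) := by
  have h : Summable c := by
    by_contra h
    rw [tsum_eq_zero_of_not_summable h] at h1
    exact zero_ne_one h1
  simp only [spread, hx, smul_zero, add_zero]
  rw [h.tsum_smul_const, h1, one_smul]

end Spread

/-! ### Almost holomorphic extension in one complex variable -/

section AlmostHolomorphic

/-- A family of linear maps has vanishing jet if it has after evaluation on every vector. -/
lemma jetVanishesAt_of_forall_apply {V W G : Type*} [NormedAddCommGroup V] [NormedSpace ℝ V]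
    [NormedAddCommGroup W] [NormedSpace ℝ W] [NormedAddCommGroup G] [NormedSpace ℝ G]
    {m : ℕ∞} {z : V} {C : V → W →L[ℝ] G} (hC : ContDiffAt ℝ (ord m) C z)
    (h : ∀ v, JetVanishesAt m (fun x => C x v) z) : JetVanishesAt m C z := by
  intro k hk
  ext w v
  have h1 := (ContinuousLinearMap.apply ℝ G v).iteratedFDeriv_comp_left hC (natCast_le_ord hk)
  have h2 := h v k hk
  change iteratedFDeriv ℝ k ((ContinuousLinearMap.apply ℝ G v) ∘ C) z = 0 at h2
  rw [h1] at h2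
  exact congrArg (fun T => T w) h2

variable {K F : Type*} [NormedAddCommGroup K] [NormedSpace ℂ K] [NormedSpace ℝ K]
  [NormedAddCommGroup F] [NormedSpace ℂ F] [NormedSpace ℝ F]
  [IsScalarTower ℝ ℂ F] [CompleteSpace F]

/-- A compactly supported `C^r` function `h` of `(κ, t) ∈ K × ℝ` extends to a `C^r` function `H`
of `(κ, τ) ∈ K × ℂ` which, at the real points near which `h` is holomorphic in `κ`, is holomorphic
up to an error with vanishing `(r - 1)`-jet. The extension is `H(κ, t + i s) = ∑ⱼ cⱼ h(κ, t + 2ʲ s)`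
for weights `cⱼ` whose moments are the powers of `i`. -/
theorem exists_almostHolomorphic_extension {r : ℕ∞} (hr : 1 ≤ r) {h : K × ℝ → F}
    (hh : ContDiff ℝ (ord r) h) (hs : HasCompactSupport h) :
    ∃ H : K × ℂ → F, ContDiff ℝ (ord r) H ∧ (∀ (κ : K) (t : ℝ), H (κ, (t : ℂ)) = h (κ, t)) ∧
      ∀ (κ : K) (t : ℝ), (∀ᶠ y in 𝓝 (κ, t), ∀ κ' : K,
        fderiv ℝ h y (Complex.I • κ', 0) = Complex.I • fderiv ℝ h y (κ', 0)) →
        ∀ v : K × ℂ, JetVanishesAt (r - 1)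
          (fun x => fderiv ℝ H x (Complex.I • v) - Complex.I • fderiv ℝ H x v) (κ, (t : ℂ)) := by
  obtain ⟨c, hc, hmom⟩ := exists_moments_eq_I_pow
  have hcs : ∀ k : ℕ, Summable fun j => c j * ((2 : ℂ) ^ j) ^ k := fun k =>
    Summable.of_norm (by simpa using hc k)
  let A : K × ℂ →L[ℝ] K × ℝ :=
    (ContinuousLinearMap.id ℝ K).prodMap Complex.reCLM
  let B : K × ℂ →L[ℝ] K × ℝ :=
    (0 : K →L[ℝ] K).prodMap Complex.imCLM
  have hA : ∀ x, A x = (x.1, x.2.re) := fun _ => rfl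
  have hB : ∀ x, B x = (0, x.2.im) := fun _ => rfl
  have hc' : RapidlyDecreasing fun j => c j * ((2 : ℂ) ^ j - Complex.I) := by
    intro k
    refine ((hc (k + 1)).add (hc k)).of_nonneg_of_le (fun j => by positivity) fun j => ?_
    rw [norm_mul]
    have : ‖(2 : ℂ) ^ j - Complex.I‖ ≤ 2 ^ j + 1 := (norm_sub_le _ _).trans (by simp)
    calc ‖c j‖ * ‖(2 : ℂ) ^ j - Complex.I‖ * ((2 : ℝ) ^ j) ^ k
        ≤ ‖c j‖ * (2 ^ j + 1) * ((2 : ℝ) ^ j) ^ k := by gcongr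
      _ = _ := by ring
  have hmom' : ∀ k : ℕ, ∑' j, c j * ((2 : ℂ) ^ j - Complex.I) * ((2 : ℂ) ^ j) ^ k = 0 := by
    intro k
    have h1 : ∀ j, c j * ((2 : ℂ) ^ j - Complex.I) * ((2 : ℂ) ^ j) ^ k =
        c j * ((2 : ℂ) ^ j) ^ (k + 1) - Complex.I * (c j * ((2 : ℂ) ^ j) ^ k) := fun j => by ring
    simp only [h1]
    rw [(hcs (k + 1)).tsum_sub ((hcs k).mul_left _), tsum_mul_left, hmom, hmom]
    ring
  have hr1 : r - 1 + 1 = r := tsub_add_cancel_of_le hr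
  have hdh : ContDiff ℝ (ord (r - 1)) (fderiv ℝ h) :=
    contDiff_iff_contDiffAt.2 fun x => hh.contDiffAt.fderiv_ord hr
  have hds : HasCompactSupport (fderiv ℝ h) := hs.fderiv ℝ
  refine ⟨spread c A B h, contDiff_spread hc hh hs, fun κ t => ?_, fun κ t hκ v => ?_⟩
  · rw [spread_apply_of_moment_zero (by simpa using hmom 0) (by simp [hB]), hA]; simp
  -- There are two error terms: `β` measures the failure of `h` to be holomorphic in `κ`; the other
  -- one comes from the dilations, with weights `cⱼ (2ʲ - i)` all of whose moments vanish.
  obtain ⟨κ', τ⟩ := v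
  set β : K × ℝ → F := fun y =>
    fderiv ℝ h y (Complex.I • κ', 0) - Complex.I • fderiv ℝ h y (κ', 0) with hβ
  set q : K × ℝ → F := fun y => fderiv ℝ h y (0, 1) with hq
  have hqc : ContDiff ℝ (ord (r - 1)) q := hdh.clm_apply contDiff_const
  have hβc : ContDiff ℝ (ord (r - 1)) β :=
    (hdh.clm_apply contDiff_const).sub
      (contDiff_const.smul (hdh.clm_apply contDiff_const))
  have hqs : HasCompactSupport q := hds.mono' fun y hy => by
    refine subset_tsupport _ fun h0 => hy ?_
    simp [hq, h0]
  have hβs : HasCompactSupport β := hds.mono' fun y hy => by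
    refine subset_tsupport _ fun h0 => hy ?_
    simp [hβ, h0]
  have key : ∀ x, fderiv ℝ (spread c A B h) x (Complex.I • (κ', τ)) -
      Complex.I • fderiv ℝ (spread c A B h) x (κ', τ) =
      spread c A B β x + (starRingEnd ℂ τ) •
        spread (fun j => c j * ((2 : ℂ) ^ j - Complex.I)) A B q x := by
    intro x
    have e1 := (hasSum_fderiv_spread (A := A) (B := B) hc hh hs hr x (Complex.I • (κ', τ))).sub
      ((hasSum_fderiv_spread (A := A) (B := B) hc hh hs hr x (κ', τ)).const_smul Complex.I)
    have e2 : HasSum (fun j => c j • β (A x + (2 : ℝ) ^ j • B x)) (spread c A B β x) := by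
      simpa using hasSum_iteratedFDeriv_spread (A := A) (B := B) hc hβc hβs (k := 0)
        (by simp) x ![]
    have e3 : HasSum (fun j => (c j * ((2 : ℂ) ^ j - Complex.I)) • q (A x + (2 : ℝ) ^ j • B x))
        (spread (fun j => c j * ((2 : ℂ) ^ j - Complex.I)) A B q x) := by
      simpa using hasSum_iteratedFDeriv_spread (A := A) (B := B) hc' hqc hqs (k := 0)
        (by simp) x ![]
    refine e1.unique ?_
    convert e2.add (e3.const_smul (starRingEnd ℂ τ)) using 1
    funext j
    set y := A x + (2 : ℝ) ^ j • B x
    have v1 : A (Complex.I • (κ', τ)) + (2 : ℝ) ^ j • B (Complex.I • (κ', τ)) =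
        (Complex.I • κ', (0 : ℝ)) + (τ.re * 2 ^ j - τ.im) • ((0 : K), (1 : ℝ)) := by
      ext <;> simp [hA, hB]; ring
    have v2 : A (κ', τ) + (2 : ℝ) ^ j • B (κ', τ) =
        (κ', (0 : ℝ)) + (τ.re + τ.im * 2 ^ j) • ((0 : K), (1 : ℝ)) := by
      ext <;> simp [hA, hB]; ring
    rw [v1, v2, map_add, map_add, map_smul, map_smul, hβ, hq,
      ← algebraMap_smul ℂ (τ.re * 2 ^ j - τ.im), ← algebraMap_smul ℂ (τ.re + τ.im * 2 ^ j)]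
    simp only [Complex.coe_algebraMap]
    push_cast
    have hτ : starRingEnd ℂ τ = τ.re - τ.im * Complex.I := by
      apply Complex.ext <;> simp
    rw [hτ]
    match_scalars
    · ring
    · ring_nf; rw [Complex.I_sq]; ring
    · ring
  have hflat : JetVanishesAt (r - 1) (fun x => spread c A B β x + (starRingEnd ℂ τ) •
      spread (fun j => c j * ((2 : ℂ) ^ j - Complex.I)) A B q x) (κ, (t : ℂ)) := by
    have hB0 : B (κ, (t : ℂ)) = 0 := by simp [hB]
    have hA0 : A (κ, (t : ℂ)) = (κ, t) := by simp [hA]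
    have hβ0 : β =ᶠ[𝓝 (κ, t)] fun _ => 0 := by
      filter_upwards [hκ] with y hy
      simp [hβ, hy κ']
    refine JetVanishesAt.add
      (jetVanishesAt_spread_of_jetVanishesAt hc hβc hβs hB0
        (hA0 ▸ (jetVanishesAt_const_zero.congr hβ0.symm)))
      ((jetVanishesAt_spread_of_moments hc' hmom' hqc hqs hB0).clm_comp
        ((starRingEnd ℂ τ) • ContinuousLinearMap.id ℝ F) (contDiff_spread hc' hqc hqs).contDiffAt)
      (contDiff_spread hc hβc hβs).contDiffAt
      (contDiff_const.smul (contDiff_spread hc' hqc hqs)).contDiffAt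
  exact hflat.congr (Eventually.of_forall fun x => (key x).symm)

end AlmostHolomorphic

/-! ### The inverse function theorem in class `C^r` -/

section LocalInverse

lemma ord_ne_zero {r : ℕ∞} (hr : 1 ≤ r) : ord r ≠ 0 := fun h => by
  have : r = 0 := WithTop.coe_eq_zero.1 h
  simp [this] at hr

/-- The inverse function theorem in class `C^r`: near a point where its derivative is invertible, a
`C^r` map is a homeomorphism onto an open set, with `C^r` inverse and everywhere invertible
derivative. -/
theorem exists_openPartialHomeomorph {E G : Type*} [NormedAddCommGroup E] [NormedSpace ℝ E]
    [CompleteSpace E] [NormedAddCommGroup G] [NormedSpace ℝ G] {r : ℕ∞} (hr : 1 ≤ r) {O : Set E}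
    (hO : IsOpen O) {z₀ : E} (hz₀ : z₀ ∈ O) {F : E → G} (hF : ContDiffOn ℝ (ord r) F O)
    {L : E ≃L[ℝ] G} (hL : fderiv ℝ F z₀ = L) :
    ∃ Φ : OpenPartialHomeomorph E G, z₀ ∈ Φ.source ∧ Φ.source ⊆ O ∧ (∀ z, Φ z = F z) ∧
      ContDiffOn ℝ (ord r) Φ.symm Φ.target ∧
      ∀ z ∈ Φ.source, ∃ L' : E ≃L[ℝ] G, HasFDerivAt F (L' : E →L[ℝ] G) z := by
  have hr0 := ord_ne_zero hr
  have hat : ∀ z ∈ O, ContDiffAt ℝ (ord r) F z := fun z hz => hF.contDiffAt (hO.mem_nhds hz)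
  have hcont : ContinuousOn (fderiv ℝ F) O := fun z hz =>
    ((hat z hz).fderiv_ord hr).continuousAt.continuousWithinAt
  have hO' : IsOpen (O ∩ fderiv ℝ F ⁻¹' Set.range ((↑) : (E ≃L[ℝ] G) → E →L[ℝ] G)) :=
    hcont.isOpen_inter_preimage hO ContinuousLinearEquiv.isOpen
  have hd : HasFDerivAt F (L : E →L[ℝ] G) z₀ :=
    hL ▸ ((hat z₀ hz₀).differentiableAt hr0).hasFDerivAt
  let Φ₀ := (hat z₀ hz₀).toOpenPartialHomeomorph F hd hr0
  let Φ := Φ₀.restrOpen _ hO'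
  have hsrc : Φ.source = Φ₀.source ∩
      (O ∩ fderiv ℝ F ⁻¹' Set.range ((↑) : (E ≃L[ℝ] G) → E →L[ℝ] G)) := rfl
  have hinv : ∀ z ∈ Φ.source, ∃ L' : E ≃L[ℝ] G, HasFDerivAt F (L' : E →L[ℝ] G) z := by
    intro z hz
    rw [hsrc] at hz
    obtain ⟨L', hL'⟩ := hz.2.2
    exact ⟨L', hL' ▸ ((hat z hz.2.1).differentiableAt hr0).hasFDerivAt⟩
  refine ⟨Φ, ?_, fun z hz => ?_, fun z => rfl, fun y hy => ?_, hinv⟩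
  · rw [hsrc]
    exact ⟨(hat z₀ hz₀).mem_toOpenPartialHomeomorph_source hd hr0, hz₀, L, hL.symm⟩
  · rw [hsrc] at hz; exact hz.2.1
  · obtain ⟨L', hL'⟩ := hinv _ (Φ.map_target hy)
    have hs : Φ.symm y ∈ O := by
      have := Φ.map_target hy
      rw [hsrc] at this; exact this.2.1
    exact (Φ.contDiffAt_symm hy hL' (hat _ hs)).contDiffWithinAt

end LocalInverse

/-! ### Almost holomorphic extension from a Levi-flat hypersurface -/

section LocalExtension

variable {E : Type*} [NormedAddCommGroup E] [NormedSpace ℂ E] [NormedSpace ℝ E]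
  [IsScalarTower ℝ ℂ E]

/-- The kernel of a real linear map, as a complex subspace, when it is invariant under
multiplication by `i`. -/
def kerComplex (T : E →L[ℝ] ℂ) (h : ∀ ξ, T ξ = 0 → T (Complex.I • ξ) = 0) : Submodule ℂ E where
  carrier := {ξ | T ξ = 0}
  zero_mem' := map_zero T
  add_mem' {a b} ha hb := by
    simp only [Set.mem_ofPred_eq] at *
    rw [map_add, ha, hb, add_zero]
  smul_mem' c ξ hξ := by
    simp only [Set.mem_ofPred_eq] at *
    have : c • ξ = c.re • ξ + c.im • (Complex.I • ξ) := by
      rw [← algebraMap_smul ℂ c.re, ← algebraMap_smul ℂ c.im, smul_smul, ← add_smul]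
      simp [Complex.re_add_im]
    rw [this, map_add, map_smul, map_smul, hξ, h ξ hξ]; simp

/-- A compactly supported `C^r` function on a finite-dimensional space which agrees near a given
point with a function given on a neighbourhood. -/
lemma exists_contDiff_compactSupport_eventuallyEq {V W : Type*} [NormedAddCommGroup V]
    [NormedSpace ℝ V] [FiniteDimensional ℝ V] [NormedAddCommGroup W] [NormedSpace ℝ W] {r : ℕ∞}
    {Ω : Set V} (hΩ : IsOpen Ω) {y₀ : V} (hy₀ : y₀ ∈ Ω) {h : V → W}
    (hh : ContDiffOn ℝ (ord r) h Ω) :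
    ∃ h' : V → W, ContDiff ℝ (ord r) h' ∧ HasCompactSupport h' ∧ h' =ᶠ[𝓝 y₀] h := by
  obtain ⟨ε, hε, hb⟩ := Metric.isOpen_iff.1 hΩ y₀ hy₀
  let χ : ContDiffBump y₀ := ⟨ε / 4, ε / 2, by positivity, by linarith⟩
  have hsupp : tsupport χ ⊆ Ω := by
    rw [χ.tsupport_eq]
    exact (Metric.closedBall_subset_ball (by simp only [χ]; linarith)).trans hb
  refine ⟨fun y => χ y • h y, contDiff_iff_contDiffAt.2 fun y => ?_, ?_, ?_⟩
  · by_cases hy : y ∈ tsupport χ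
    · exact χ.contDiff.contDiffAt.smul (hh.contDiffAt (hΩ.mem_nhds (hsupp hy)))
    · have : (fun y => χ y • h y) =ᶠ[𝓝 y] fun _ => 0 := by
        filter_upwards [(isClosed_tsupport χ).isOpen_compl.mem_nhds hy] with x hx
        rw [image_eq_zero_of_notMem_tsupport hx, zero_smul]
      exact contDiffAt_const.congr_of_eventuallyEq this
  · exact χ.hasCompactSupport.smul_right
  · filter_upwards [χ.eventuallyEq_one] with y hy
    simp [hy]

variable [FiniteDimensional ℂ E]

/-- Let `F` be a `C^r` function whose derivative has complex kernel at the points of the real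
hypersurface `{Im F = 0}`. Then the restriction of `F` to the hypersurface extends to a `C^r`
function which is holomorphic to order `r - 1` along it. Indeed the level sets of `F` in the
hypersurface are complex submanifolds; in a parametrization `h (κ, t)` of the hypersurface which is
holomorphic in the leaf variable `κ` and has `F (h (κ, t)) = t`, one extends `h` almost
holomorphically to complex `t` and inverts the resulting map. -/
theorem exists_almostHolomorphic_extension_of_ker {r : ℕ∞} (hr : 1 ≤ r) {O : Set E} (hO : IsOpen O)
    {z₀ : E} (hz₀ : z₀ ∈ O) {F : E → ℂ} (hF : ContDiffOn ℝ (ord r) F O) (hFz₀ : (F z₀).im = 0)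
    (hsurj : Function.Surjective (fderiv ℝ F z₀))
    (hker : ∀ z ∈ O, (F z).im = 0 → ∀ ξ, fderiv ℝ F z ξ = 0 → fderiv ℝ F z (Complex.I • ξ) = 0) :
    ∃ O' ⊆ O, IsOpen O' ∧ z₀ ∈ O' ∧ ∃ f : E → ℂ, ContDiffOn ℝ (ord r) f O' ∧
      (∀ z ∈ O', (F z).im = 0 → f z = F z) ∧
      ∀ z ∈ O', (F z).im = 0 → ∀ v, JetVanishesAt (r - 1)
        (fun x => fderiv ℝ f x (Complex.I • v) - Complex.I • fderiv ℝ f x v) z := by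
  have hr0 := ord_ne_zero hr
  have : FiniteDimensional ℝ E := FiniteDimensional.trans ℝ ℂ E
  have : CompleteSpace E := FiniteDimensional.complete ℝ E
  set T := fderiv ℝ F z₀ with hT
  set K := kerComplex T (hker z₀ hz₀ hFz₀) with hK
  have hKmem : ∀ ξ, ξ ∈ K ↔ T ξ = 0 := fun ξ => Iff.rfl
  have : FiniteDimensional ℝ K := FiniteDimensional.trans ℝ ℂ K
  obtain ⟨P₀, hP₀⟩ := K.exists_isCompl.elim fun q hq =>
    (⟨Submodule.projectionOnto K q hq, fun x => Submodule.projectionOnto_apply_left hq x⟩ :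
      ∃ P : E →ₗ[ℂ] K, ∀ x : K, P x = x)
  let P : E →L[ℂ] K := LinearMap.toContinuousLinearMap P₀
  have hP : ∀ x : K, P x = x := hP₀
  let PR : E →L[ℝ] K := P.restrictScalars ℝ
  have hPR : ∀ x, PR x = P x := fun _ => rfl
  -- `(P, F)` is a local coordinate system in which the leaves are the sets where `F` is constant.
  have hbij : Function.Bijective (PR.prod T) := by
    constructor
    · refine (injective_iff_map_eq_zero _).2 fun ξ hξ => ?_
      have h1 : P ξ = 0 := congrArg Prod.fst hξ
      have h2 : T ξ = 0 := congrArg Prod.snd hξ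
      have := hP ⟨ξ, (hKmem ξ).2 h2⟩
      rw [h1] at this
      exact (congrArg Subtype.val this).symm
    · rintro ⟨κ, τ⟩
      obtain ⟨ξ, hξ⟩ := hsurj τ
      have h1 : T ((κ - P ξ : K) : E) = 0 := (hKmem _).1 (κ - P ξ : K).2
      refine ⟨ξ + (κ - P ξ : K), Prod.ext ?_ ?_⟩
      · change P (ξ + (κ - P ξ : K)) = κ
        rw [map_add, hP]; abel
      · change T (ξ + (κ - P ξ : K)) = τ
        rw [map_add, h1, hξ, add_zero]
  let L : E ≃L[ℝ] K × ℂ :=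
    (LinearEquiv.ofBijective (PR.prod T : E →ₗ[ℝ] K × ℂ) hbij).toContinuousLinearEquiv
  have hLT : ∀ ξ, L ξ = (P ξ, T ξ) := fun _ => rfl
  let Fm : E → K × ℂ := fun z => (P z, F z)
  have hdF : ∀ z ∈ O, HasFDerivAt F (fderiv ℝ F z) z := fun z hz =>
    ((hF.contDiffAt (hO.mem_nhds hz)).differentiableAt hr0).hasFDerivAt
  have hdFm : ∀ z ∈ O, HasFDerivAt Fm (PR.prod (fderiv ℝ F z)) z := fun z hz =>
    PR.hasFDerivAt.prodMk (hdF z hz)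
  obtain ⟨Φ, hΦz, hΦO, hΦ, hΦs, hΦd⟩ := exists_openPartialHomeomorph hr hO hz₀ (F := Fm) (L := L)
    (PR.contDiff.contDiffOn.prodMk hF) (hdFm z₀ hz₀).fderiv
  let ι : K × ℝ →L[ℝ] K × ℂ := (ContinuousLinearMap.id ℝ K).prodMap Complex.ofRealCLM
  have hι : ∀ y, ι y = (y.1, (y.2 : ℂ)) := fun _ => rfl
  have hιF : ∀ z, (F z).im = 0 → ι (P z, (F z).re) = Fm z := fun z hz =>
    Prod.ext rfl (Complex.ext rfl (by simp [hι, Fm, hz]))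
  let hR : K × ℝ → E := fun y => Φ.symm (ι y)
  let y₀ : K × ℝ := (P z₀, (F z₀).re)
  have hιy₀ : ι y₀ = Fm z₀ := hιF z₀ hFz₀
  have hΩ : IsOpen (ι ⁻¹' Φ.target) := Φ.open_target.preimage ι.continuous
  have hy₀Ω : y₀ ∈ ι ⁻¹' Φ.target := by
    rw [Set.mem_preimage, hιy₀, ← hΦ]; exact Φ.map_source hΦz
  obtain ⟨h, hh, hs, heq⟩ := exists_contDiff_compactSupport_eventuallyEq hΩ hy₀Ω (h := hR)
    (hΦs.comp ι.contDiff.contDiffOn fun _ hy => hy)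
  -- The derivative of the parametrization `hR` of the hypersurface inverts `(P, dF)`.
  have hRd : ∀ y ∈ ι ⁻¹' Φ.target, ∃ L' : E ≃L[ℝ] K × ℂ,
      (∀ ξ, L' ξ = (P ξ, fderiv ℝ F (hR y) ξ)) ∧
        ∀ v, fderiv ℝ hR y v = L'.symm (ι v) := by
    intro y hy
    have hw : hR y ∈ Φ.source := Φ.map_target hy
    obtain ⟨L', hL'⟩ := hΦd _ hw
    refine ⟨L', fun ξ => ?_, fun v => ?_⟩
    · have := hL'.unique (hdFm _ (hΦO hw))
      exact congrArg (fun S => S ξ) this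
    · have h1 : HasFDerivAt Φ (L' : E →L[ℝ] K × ℂ) (Φ.symm (ι y)) :=
        hL'.congr_of_eventuallyEq (Eventually.of_forall hΦ)
      have h2 : HasFDerivAt hR _ y := (Φ.hasFDerivAt_symm hy h1).comp y ι.hasFDerivAt
      rw [h2.fderiv]; rfl
  have hCR : ∀ y ∈ ι ⁻¹' Φ.target, ∀ κ' : K,
      fderiv ℝ hR y (Complex.I • κ', 0) = Complex.I • fderiv ℝ hR y (κ', 0) := by
    intro y hy κ'
    obtain ⟨L', hL', hd⟩ := hRd y hy
    have hFim : (F (hR y)).im = 0 := by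
      have : Fm (hR y) = ι y := by rw [← hΦ]; exact Φ.right_inv hy
      have h2 : F (hR y) = (y.2 : ℂ) := congrArg Prod.snd this
      rw [h2, Complex.ofReal_im]
    set ξ := L'.symm (ι (κ', 0)) with hξ
    have h1 : L' ξ = (κ', 0) := by
      rw [hξ, L'.apply_symm_apply, hι]; simp
    rw [hL'] at h1
    have h2 : P ξ = κ' := congrArg Prod.fst h1
    have h3 := hker _ (hΦO (Φ.map_target hy)) hFim ξ (congrArg Prod.snd h1)
    rw [hd, hd, ← hξ, L'.symm_apply_eq, hL']
    refine Prod.ext ?_ ?_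
    · change Complex.I • κ' = P (Complex.I • ξ)
      rw [map_smul, h2]
    · change (ι (Complex.I • κ', 0)).2 = fderiv ℝ F (hR y) (Complex.I • ξ)
      rw [h3]; simp [hι]
  have hCRh : ∀ᶠ y in 𝓝 y₀, ∀ κ' : K,
      fderiv ℝ h y (Complex.I • κ', 0) = Complex.I • fderiv ℝ h y (κ', 0) := by
    filter_upwards [heq.eventuallyEq_nhds, hΩ.mem_nhds hy₀Ω] with y hy hyΩ κ'
    rw [hy.fderiv_eq]; exact hCR y hyΩ κ'
  -- `H` is complex linear to first order along the real points, so that its derivative is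
  -- determined by that of `h`, and is invertible.
  obtain ⟨H, hH, hHh, hHflat⟩ := exists_almostHolomorphic_extension hr hh hs
  have hHι : ∀ y, H (ι y) = h y := fun y => hHh y.1 y.2
  have hdH : ∀ x, HasFDerivAt H (fderiv ℝ H x) x := fun x =>
    (hH.differentiable hr0 x).hasFDerivAt
  set D := fderiv ℝ H (Fm z₀) with hD
  have hDI : ∀ v, D (Complex.I • v) = Complex.I • D v := fun v => by
    have h1 := (hHflat y₀.1 y₀.2 hCRh v).apply_eq_zero
    have h2 : ((y₀.1, (y₀.2 : ℂ)) : K × ℂ) = Fm z₀ := hιy₀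
    rw [h2] at h1
    exact sub_eq_zero.1 h1
  obtain ⟨L₀, hL₀, hd₀⟩ := hRd y₀ hy₀Ω
  have hDι : ∀ v, D (ι v) = L₀.symm (ι v) := fun v => by
    have h1 : HasFDerivAt h (D.comp ι) y₀ := by
      have h2 : HasFDerivAt (fun y => H (ι y)) (D.comp ι) y₀ := by
        refine HasFDerivAt.comp y₀ ?_ ι.hasFDerivAt
        rw [hιy₀]; exact hdH _
      simpa only [hHι] using h2
    rw [← hd₀ v, ← heq.fderiv_eq, h1.fderiv]; rfl
  -- For `v = (κ', τ)` with `D v = 0`, the projection `P` gives `κ' = 0`; then `τ • e = 0`, where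
  -- `e` is the derivative of `h` in the direction of the real parameter.
  have hDinj : Function.Injective D := by
    refine (injective_iff_map_eq_zero _).2 ?_
    rintro ⟨κ', τ⟩ hv
    have hdec : ((κ', τ) : K × ℂ) = ι (κ', τ.re) + Complex.I • ι (0, τ.im) := by
      refine Prod.ext (by simp [hι]) ?_
      simp only [hι, Prod.snd_add, Prod.smul_snd, smul_eq_mul]
      rw [mul_comm, Complex.re_add_im]
    have hPs : ∀ v, P (L₀.symm (ι v)) = v.1 := fun v => by
      have := hL₀ (L₀.symm (ι v))
      rw [L₀.apply_symm_apply] at this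
      exact (congrArg Prod.fst this).symm
    rw [hdec, map_add, hDI, hDι, hDι] at hv
    have hκ : κ' = 0 := by
      have := congrArg P hv
      simpa [hPs] using this
    subst hκ
    set e := L₀.symm (ι (0, 1)) with he
    have hte : ∀ t : ℝ, L₀.symm (ι (0, t)) = t • e := fun t => by
      rw [he, ← map_smul, ← map_smul]; simp
    have he0 : e ≠ 0 := by
      intro h0
      rw [he, map_eq_zero_iff _ L₀.symm.injective] at h0
      simpa [hι] using congrArg Prod.snd h0
    rw [hte, hte, ← algebraMap_smul ℂ τ.re, ← algebraMap_smul ℂ τ.im, smul_smul, ← add_smul,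
      smul_eq_zero] at hv
    have hτ : τ = 0 := by
      rw [← Complex.re_add_im τ, mul_comm]
      exact hv.resolve_right he0
    rw [hτ]; rfl
  have hfin : Module.finrank ℝ (K × ℂ) = Module.finrank ℝ E := L.toLinearEquiv.finrank_eq.symm
  let LD : (K × ℂ) ≃L[ℝ] E := (LinearEquiv.ofBijective (D : K × ℂ →ₗ[ℝ] E)
    ⟨hDinj, (LinearMap.injective_iff_surjective_of_finrank_eq_finrank hfin).1 hDinj⟩
    ).toContinuousLinearEquiv
  have hCK : CompleteSpace K := FiniteDimensional.complete ℝ K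
  obtain ⟨Ψ, hΨz, -, hΨ, hΨs, hΨd⟩ := exists_openPartialHomeomorph hr isOpen_univ
    (Set.mem_univ (Fm z₀)) (F := H) (L := LD) hH.contDiffOn (ContinuousLinearMap.ext fun _ => rfl)
  have hHz₀ : H (Fm z₀) = z₀ := by
    rw [← hιy₀, hHι, heq.eq_of_nhds]
    change Φ.symm (ι y₀) = z₀
    rw [hιy₀, ← hΦ, Φ.left_inv hΦz]
  have hcF : ContinuousAt F z₀ := (hdF z₀ hz₀).continuousAt
  have hcFm : Tendsto Fm (𝓝 z₀) (𝓝 (Fm z₀)) := (hdFm z₀ hz₀).continuousAt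
  have hcy : Tendsto (fun z => (P z, (F z).re)) (𝓝 z₀) (𝓝 y₀) :=
    P.continuous.continuousAt.prodMk (Complex.continuous_re.continuousAt.comp hcF)
  have hev : ∀ᶠ z in 𝓝 z₀, z ∈ Φ.source ∧ z ∈ Ψ.target ∧ Fm z ∈ Ψ.source ∧
      h (P z, (F z).re) = hR (P z, (F z).re) ∧ ∀ᶠ y in 𝓝 (P z, (F z).re), ∀ κ' : K,
        fderiv ℝ h y (Complex.I • κ', 0) = Complex.I • fderiv ℝ h y (κ', 0) := by
    have hΨt : z₀ ∈ Ψ.target := by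
      have := Ψ.map_source hΨz
      rwa [hΨ, hHz₀] at this
    filter_upwards [Φ.open_source.mem_nhds hΦz, Ψ.open_target.mem_nhds hΨt,
      hcFm (Ψ.open_source.mem_nhds hΨz), hcy.eventually heq,
      hcy.eventually hCRh.eventually_nhds] with z h1 h2 h3 h4 h5
    exact ⟨h1, h2, h3, h4, h5⟩
  obtain ⟨O', hO'sub, hO', hz₀O'⟩ := mem_nhds_iff.1 hev
  have hsymm : ∀ z ∈ O', (F z).im = 0 → Ψ.symm z = Fm z := by
    intro z hz hzim
    obtain ⟨h1, h2, h3, h4, -⟩ := hO'sub hz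
    have h5 : Ψ (Fm z) = z := by
      rw [hΨ, ← hιF z hzim, hHι, h4]
      change Φ.symm (ι _) = z
      rw [hιF z hzim, ← hΦ, Φ.left_inv h1]
    have h6 := Ψ.left_inv h3
    rwa [h5] at h6
  have hΨc : ContDiffOn ℝ (ord r) Ψ.symm O' := hΨs.mono fun z hz => (hO'sub hz).2.1
  refine ⟨O', fun z hz => hΦO (hO'sub hz).1, hO', hz₀O', fun z => (Ψ.symm z).2,
    contDiff_snd.comp_contDiffOn hΨc, fun z hz hzim =>
      congrArg Prod.snd (hsymm z hz hzim), ?_⟩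
  intro z hz hzim v
  -- The antilinear part of `D(Ψ⁻¹)` is obtained from that of `DH`, which is `C` below, by
  -- composition with functions of class `C^{r-1}`.
  let JI : K × ℂ →L[ℝ] K × ℂ :=
    (Complex.I • ContinuousLinearMap.id ℂ (K × ℂ)).restrictScalars ℝ
  let C : K × ℂ → K × ℂ →L[ℝ] E := fun x =>
    (fderiv ℝ H x).comp JI - Complex.I • fderiv ℝ H x
  have hdHc : ContDiff ℝ (ord (r - 1)) (fderiv ℝ H) :=
    contDiff_iff_contDiffAt.2 fun x => hH.contDiffAt.fderiv_ord hr
  have hC : ContDiff ℝ (ord (r - 1)) C :=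
    (hdHc.clm_comp contDiff_const).sub (hdHc.const_smul Complex.I)
  have hgz := hsymm z hz hzim
  have hgzc : ContDiffAt ℝ (ord r) Ψ.symm z := hΨc.contDiffAt (hO'.mem_nhds hz)
  have hle : ord (r - 1) ≤ ord r := WithTop.coe_le_coe.2 tsub_le_self
  have hgz' : ContDiffAt ℝ (ord (r - 1)) Ψ.symm z := hgzc.of_le hle
  have hdg : ContDiffAt ℝ (ord (r - 1)) (fderiv ℝ Ψ.symm) z := hgzc.fderiv_ord hr
  have hCflat : JetVanishesAt (r - 1) C (Ψ.symm z) := by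
    refine jetVanishesAt_of_forall_apply hC.contDiffAt fun w => ?_
    have := hHflat (P z) (F z).re (hO'sub hz).2.2.2.2 w
    rw [hgz, ← hιF z hzim]
    exact this
  have hCg := hCflat.comp hC.contDiffAt hgz'
  have hCgc : ContDiffAt ℝ (ord (r - 1)) (fun x => C (Ψ.symm x)) z :=
    hC.contDiffAt.comp z hgz'
  have hdgv : ContDiffAt ℝ (ord (r - 1)) (fun x => fderiv ℝ Ψ.symm x v) z :=
    hdg.clm_apply contDiffAt_const
  have h1 := hCg.bilinear (ContinuousLinearMap.id ℝ (K × ℂ →L[ℝ] E)) hCgc hdgv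
  have h1c : ContDiffAt ℝ (ord (r - 1)) (fun x => C (Ψ.symm x) (fderiv ℝ Ψ.symm x v)) z :=
    hCgc.clm_apply hdgv
  have h2 := h1.bilinear (ContinuousLinearMap.id ℝ (E →L[ℝ] K × ℂ)).flip h1c hdg
  have h2c : ContDiffAt ℝ (ord (r - 1))
    (fun x => fderiv ℝ Ψ.symm x (C (Ψ.symm x) (fderiv ℝ Ψ.symm x v))) z := hdg.clm_apply h1c
  have h3 := h2.clm_comp (-(ContinuousLinearMap.snd ℝ K ℂ)) h2c
  refine h3.congr ?_
  filter_upwards [hO'.mem_nhds hz] with x hx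
  have hxt := (hO'sub hx).2.1
  obtain ⟨L', hL'⟩ := hΨd _ (Ψ.map_target hxt)
  have hdΨ : HasFDerivAt Ψ.symm (L'.symm : E →L[ℝ] K × ℂ) x :=
    Ψ.hasFDerivAt_symm hxt (hL'.congr_of_eventuallyEq (Eventually.of_forall hΨ))
  have hdf : fderiv ℝ (fun z => (Ψ.symm z).2) x =
      (ContinuousLinearMap.snd ℝ K ℂ).comp (L'.symm : E →L[ℝ] K × ℂ) :=
    ((ContinuousLinearMap.snd ℝ K ℂ).hasFDerivAt.comp x hdΨ).fderiv
  have hw : C (Ψ.symm x) (L'.symm v) = L' (Complex.I • L'.symm v) - Complex.I • v := by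
    change fderiv ℝ H (Ψ.symm x) (Complex.I • L'.symm v) -
      Complex.I • fderiv ℝ H (Ψ.symm x) (L'.symm v) = _
    rw [hL'.fderiv]
    change L' _ - Complex.I • L' (L'.symm v) = _
    rw [L'.apply_symm_apply]
  change -(fderiv ℝ Ψ.symm x (C (Ψ.symm x) (fderiv ℝ Ψ.symm x v))).2 = _
  rw [hdΨ.fderiv, hdf]
  change -(L'.symm (C (Ψ.symm x) (L'.symm v))).2 =
    (L'.symm (Complex.I • v)).2 - Complex.I • (L'.symm v).2
  rw [hw, map_sub, L'.symm_apply_apply]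
  simp

end LocalExtension

/-! ### Hypersurfaces in a vector space -/

section Hypersurface

variable {E : Type*} [NormedAddCommGroup E] [NormedSpace ℝ E] [FiniteDimensional ℝ E]

/-- A function with nonzero differential is the last coordinate of a local `C^r` diffeomorphism
whose other coordinates are linear. -/
theorem exists_straightening {N : Type*} [NormedAddCommGroup N] [NormedSpace ℝ N]
    [FiniteDimensional ℝ N] (hN : Module.finrank ℝ N + 1 = Module.finrank ℝ E)
    {r : ℕ∞} (hr : 1 ≤ r) {O : Set E} (hO : IsOpen O) {z₀ : E} (hz₀ : z₀ ∈ O) {ρ : E → ℝ}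
    (hρ : ContDiffOn ℝ (ord r) ρ O) (hd : fderiv ℝ ρ z₀ ≠ 0) :
    ∃ (Q : E →L[ℝ] N) (Φ : OpenPartialHomeomorph E (N × ℝ)), z₀ ∈ Φ.source ∧ Φ.source ⊆ O ∧
      (∀ z, Φ z = (Q z, ρ z)) ∧ ContDiffOn ℝ (ord r) Φ.symm Φ.target ∧
      ∀ z ∈ Φ.source, ∃ L : E ≃L[ℝ] N × ℝ, (∀ ξ, L ξ = (Q ξ, fderiv ℝ ρ z ξ)) ∧
        HasFDerivAt Φ (L : E →L[ℝ] N × ℝ) z := by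
  have : CompleteSpace E := FiniteDimensional.complete ℝ E
  set ℓ := fderiv ℝ ρ z₀ with hℓ
  have hsurj : Function.Surjective (ℓ : E →ₗ[ℝ] ℝ) :=
    LinearMap.surjective (fun h => hd (ContinuousLinearMap.coe_injective h))
  have hker : Module.finrank ℝ (LinearMap.ker (ℓ : E →ₗ[ℝ] ℝ)) = Module.finrank ℝ N := by
    have h1 := LinearMap.finrank_range_add_finrank_ker (ℓ : E →ₗ[ℝ] ℝ)
    rw [LinearMap.range_eq_top.2 hsurj, finrank_top, Module.finrank_self] at h1
    omega
  let e := LinearEquiv.ofFinrankEq _ _ hker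
  obtain ⟨q, hq⟩ := (LinearMap.ker (ℓ : E →ₗ[ℝ] ℝ)).exists_isCompl
  let Q : E →L[ℝ] N := LinearMap.toContinuousLinearMap
    (e.toLinearMap ∘ₗ Submodule.projectionOnto _ q hq)
  have hQ : ∀ x, Q x = e (Submodule.projectionOnto _ q hq x) := fun _ => rfl
  have hinj : Function.Injective (Q.prod ℓ : E →ₗ[ℝ] N × ℝ) := by
    refine (injective_iff_map_eq_zero _).2 fun ξ hξ => ?_
    have h1 : Q ξ = 0 := congrArg Prod.fst hξ
    have h2 : ℓ ξ = 0 := congrArg Prod.snd hξ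
    rw [hQ, e.map_eq_zero_iff] at h1
    have h3 := Submodule.projectionOnto_apply_left hq ⟨ξ, h2⟩
    change Submodule.projectionOnto _ q hq ξ = _ at h3
    rw [h1] at h3
    exact (congrArg Subtype.val h3).symm
  have hfin : Module.finrank ℝ E = Module.finrank ℝ (N × ℝ) := by
    rw [Module.finrank_prod, Module.finrank_self, hN]
  let L : E ≃L[ℝ] N × ℝ := (LinearEquiv.ofBijective _
    ⟨hinj, (LinearMap.injective_iff_surjective_of_finrank_eq_finrank hfin).1 hinj⟩
    ).toContinuousLinearEquiv
  have hdρ : ∀ z ∈ O, HasFDerivAt ρ (fderiv ℝ ρ z) z := fun z hz =>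
    ((hρ.contDiffAt (hO.mem_nhds hz)).differentiableAt (ord_ne_zero hr)).hasFDerivAt
  have hdF : ∀ z ∈ O, HasFDerivAt (fun z => (Q z, ρ z)) (Q.prod (fderiv ℝ ρ z)) z := fun z hz =>
    Q.hasFDerivAt.prodMk (hdρ z hz)
  obtain ⟨Φ, h1, h2, h3, h4, h5⟩ := exists_openPartialHomeomorph hr hO hz₀
    (F := fun z => (Q z, ρ z)) (L := L) (Q.contDiff.contDiffOn.prodMk hρ) (hdF z₀ hz₀).fderiv
  refine ⟨Q, Φ, h1, h2, h3, h4, fun z hz => ?_⟩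
  obtain ⟨L', hL'⟩ := h5 z hz
  refine ⟨L', fun ξ => ?_, hL'.congr_of_eventuallyEq (Eventually.of_forall h3)⟩
  exact congrArg (fun S => S ξ) (hL'.unique (hdF z (h2 hz)))

lemma one_le_finrank_of_ne_zero {ℓ : E →L[ℝ] ℝ} (hℓ : ℓ ≠ 0) : 1 ≤ Module.finrank ℝ E := by
  by_contra h
  have h0 : Module.finrank ℝ E = 0 := by omega
  have := Module.finrank_zero_iff.1 h0
  exact hℓ (ContinuousLinearMap.ext fun x => by rw [Subsingleton.elim x 0]; simp)

lemma exists_finrank_add_one {ℓ : E →L[ℝ] ℝ} (hℓ : ℓ ≠ 0) :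
    Module.finrank ℝ (Fin (Module.finrank ℝ E - 1) → ℝ) + 1 = Module.finrank ℝ E := by
  have := one_le_finrank_of_ne_zero hℓ
  simp only [Module.finrank_fintype_fun_eq_card, Fintype.card_fin]
  omega

/-- The derivative of a function which vanishes on a hypersurface vanishes on its tangent space. -/
theorem fderiv_eq_zero_of_tangent {W : Type*} [NormedAddCommGroup W] [NormedSpace ℝ W] {r : ℕ∞}
    (hr : 1 ≤ r) {O : Set E} (hO : IsOpen O) {z₀ : E} (hz₀ : z₀ ∈ O) {ρ : E → ℝ}
    (hρ : ContDiffOn ℝ (ord r) ρ O) (hρ0 : ρ z₀ = 0) (hd : fderiv ℝ ρ z₀ ≠ 0) {G : E → W}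
    (hG : DifferentiableAt ℝ G z₀) (h0 : ∀ᶠ z in 𝓝 z₀, ρ z = 0 → G z = 0) {ξ : E}
    (hξ : fderiv ℝ ρ z₀ ξ = 0) : fderiv ℝ G z₀ ξ = 0 := by
  obtain ⟨Q, Φ, h1, -, h3, -, h5⟩ :=
    exists_straightening (exists_finrank_add_one hd) hr hO hz₀ hρ hd
  obtain ⟨L, hL, hLd⟩ := h5 z₀ h1
  have hΦz : Φ z₀ = (Q z₀, 0) := by rw [h3, hρ0]
  have ht : (Q z₀, (0 : ℝ)) ∈ Φ.target := hΦz ▸ Φ.map_source h1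
  have hinv : Φ.symm (Q z₀, 0) = z₀ := by rw [← hΦz, Φ.left_inv h1]
  have hds : HasFDerivAt Φ.symm (L.symm : _ →L[ℝ] E) (Q z₀, (0 : ℝ)) :=
    Φ.hasFDerivAt_symm ht (by rwa [hinv])
  let γ : ℝ → _ × ℝ := fun t => (Q z₀ + t • Q ξ, 0)
  have hγ : HasDerivAt γ (Q ξ, 0) 0 := by
    have : HasDerivAt (fun t : ℝ => Q z₀ + t • Q ξ) (Q ξ) 0 := by
      simpa using ((hasDerivAt_id (0 : ℝ)).smul_const (Q ξ)).const_add (Q z₀)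
    exact this.prodMk (hasDerivAt_const _ _)
  have hγ0 : γ 0 = (Q z₀, 0) := by simp [γ]
  have hγs : HasDerivAt (fun t => Φ.symm (γ t)) ξ 0 := by
    have h := HasFDerivAt.comp_hasDerivAt (0 : ℝ) (by rw [hγ0]; exact hds) hγ
    have e : L.symm (Q ξ, 0) = ξ := by rw [L.symm_apply_eq, hL, hξ]
    change HasDerivAt (fun t => Φ.symm (γ t)) (L.symm (Q ξ, 0)) 0 at h
    rwa [e] at h
  have hz : Φ.symm (γ 0) = z₀ := by rw [hγ0, hinv]
  have hGγ : HasDerivAt (fun t => G (Φ.symm (γ t))) (fderiv ℝ G z₀ ξ) 0 :=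
    HasFDerivAt.comp_hasDerivAt (0 : ℝ) (by rw [hz]; exact hG.hasFDerivAt) hγs
  have hzero : (fun t => G (Φ.symm (γ t))) =ᶠ[𝓝 0] fun _ => 0 := by
    have hcont : Tendsto (fun t => Φ.symm (γ t)) (𝓝 0) (𝓝 z₀) := by
      have := hγs.continuousAt.tendsto
      rwa [hz] at this
    have htar : ∀ᶠ t in 𝓝 (0 : ℝ), γ t ∈ Φ.target :=
      hγ.continuousAt (Φ.open_target.mem_nhds (hγ0 ▸ ht))
    filter_upwards [hcont.eventually h0, htar] with t hA hB
    refine hA ?_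
    have := Φ.right_inv hB
    rw [h3] at this
    exact congrArg Prod.snd this
  exact hGγ.unique ((hasDerivAt_const (0 : ℝ) (0 : W)).congr_of_eventuallyEq hzero)

/-- Two functions with nonzero differentials, one of which vanishes on the zero set of the other,
have locally the same sign, or opposite signs. -/
theorem eventually_sign_eq_or {r : ℕ∞}
    (hr : 1 ≤ r) {O : Set E} (hO : IsOpen O) {z₀ : E} (hz₀ : z₀ ∈ O) {ρ : E → ℝ}
    (hρ : ContDiffOn ℝ (ord r) ρ O) (hρ0 : ρ z₀ = 0) (hd : fderiv ℝ ρ z₀ ≠ 0) {v : E → ℝ}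
    (hv : ContDiffAt ℝ (ord r) v z₀) (h0 : ∀ᶠ z in 𝓝 z₀, ρ z = 0 → v z = 0)
    (hdv : fderiv ℝ v z₀ ≠ 0) :
    (∀ᶠ z in 𝓝 z₀, SignType.sign (v z) = SignType.sign (ρ z)) ∨
      ∀ᶠ z in 𝓝 z₀, SignType.sign (v z) = -SignType.sign (ρ z) := by
  obtain ⟨Q, Φ, h1, -, h3, h4, h5⟩ :=
    exists_straightening (exists_finrank_add_one hd) hr hO hz₀ hρ hd
  obtain ⟨L, hL, hLd⟩ := h5 z₀ h1
  have hΦz : Φ z₀ = (Q z₀, 0) := by rw [h3, hρ0]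
  have ht : (Q z₀, (0 : ℝ)) ∈ Φ.target := hΦz ▸ Φ.map_source h1
  have hinv : Φ.symm (Q z₀, 0) = z₀ := by rw [← hΦz, Φ.left_inv h1]
  have hds : HasFDerivAt Φ.symm (L.symm : _ →L[ℝ] E) (Q z₀, (0 : ℝ)) :=
    Φ.hasFDerivAt_symm ht (by rwa [hinv])
  have hss : HasStrictFDerivAt Φ.symm (L.symm : _ →L[ℝ] E) (Q z₀, (0 : ℝ)) :=
    (h4.contDiffAt (Φ.open_target.mem_nhds ht)).hasStrictFDerivAt' hds (ord_ne_zero hr)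
  have hvs : HasStrictFDerivAt v (fderiv ℝ v z₀) z₀ := hv.hasStrictFDerivAt (ord_ne_zero hr)
  have hcs : HasStrictFDerivAt (fun y => v (Φ.symm y))
      ((fderiv ℝ v z₀).comp (L.symm : _ →L[ℝ] E)) (Q z₀, (0 : ℝ)) :=
    HasStrictFDerivAt.comp _ (by rw [hinv]; exact hvs) hss
  set c : ℝ := fderiv ℝ v z₀ (L.symm (0, 1)) with hc
  have htan : ∀ ξ, fderiv ℝ ρ z₀ ξ = 0 → fderiv ℝ v z₀ ξ = 0 := fun ξ hξ =>
    fderiv_eq_zero_of_tangent hr hO hz₀ hρ hρ0 hd (hv.differentiableAt (ord_ne_zero hr)) h0 hξ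
  have hform : ∀ t : ℝ, fderiv ℝ v z₀ (L.symm (0, t)) = c * t := fun t => by
    have : ((0, t) : (Fin (Module.finrank ℝ E - 1) → ℝ) × ℝ) = t • (0, 1) := by simp
    rw [this, map_smul, map_smul, smul_eq_mul, mul_comm]
  have hc0 : c ≠ 0 := by
    intro hc0
    refine hdv (ContinuousLinearMap.ext fun ξ => ?_)
    have hξ := hL ξ
    set η := L.symm (0, fderiv ℝ ρ z₀ ξ) with hη
    have h6 : fderiv ℝ ρ z₀ (ξ - η) = 0 := by
      have : L η = (0, fderiv ℝ ρ z₀ ξ) := L.apply_symm_apply _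
      rw [hL] at this
      rw [map_sub, sub_eq_zero]
      exact (congrArg Prod.snd this).symm
    have h7 := htan _ h6
    rw [map_sub, hη, hform, hc0, zero_mul, sub_zero] at h7
    simpa using h7
  have hlo := hcs.isLittleO.def (half_pos (abs_pos.2 hc0))
  have hcz : Tendsto (fun z => ((Q z, ρ z), (Q z, (0 : ℝ)))) (𝓝 z₀)
      (𝓝 ((Q z₀, (0 : ℝ)), (Q z₀, (0 : ℝ)))) := by
    have hQ : ContinuousAt Q z₀ := Q.continuous.continuousAt
    have hρc : Tendsto ρ (𝓝 z₀) (𝓝 0) := by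
      have := (hρ.contDiffAt (hO.mem_nhds hz₀)).continuousAt.tendsto
      rwa [hρ0] at this
    exact (hQ.tendsto.prodMk_nhds hρc).prodMk_nhds (hQ.tendsto.prodMk_nhds tendsto_const_nhds)
  have hcz2 : Tendsto (fun z => (Q z, (0 : ℝ))) (𝓝 z₀) (𝓝 (Q z₀, (0 : ℝ))) :=
    (continuous_snd.tendsto _).comp hcz
  have hcz3 : Tendsto (fun z => Φ.symm (Q z, (0 : ℝ))) (𝓝 z₀) (𝓝 z₀) := by
    have := (hds.continuousAt.tendsto).comp hcz2
    rwa [hinv] at this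
  -- `v` is `c ρ` up to an error of smaller order in `ρ`, by strict differentiability.
  have main : ∀ᶠ z in 𝓝 z₀, |v z - c * ρ z| ≤ |c| / 2 * |ρ z| := by
    filter_upwards [hcz.eventually hlo, hcz2 (Φ.open_target.mem_nhds ht), hcz3.eventually h0,
      Φ.open_source.mem_nhds h1] with z hz1 hz2 hz3 hz4
    have e1 : Φ.symm (Q z, ρ z) = z := by rw [← h3, Φ.left_inv hz4]
    have e2 : v (Φ.symm (Q z, 0)) = 0 := by
      refine hz3 ?_
      have := Φ.right_inv hz2
      rw [h3] at this
      exact congrArg Prod.snd this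
    have e3 : ((Q z, ρ z) - (Q z, (0 : ℝ))) = (0, ρ z) := by simp
    simp only [e1, e2, e3] at hz1
    rw [ContinuousLinearMap.comp_apply, ContinuousLinearEquiv.coe_coe, hform, sub_zero,
      Prod.norm_def, norm_zero, Real.norm_eq_abs, max_eq_right (norm_nonneg _),
      Real.norm_eq_abs] at hz1
    exact hz1
  rcases lt_or_gt_of_ne hc0 with hneg | hpos
  · right
    filter_upwards [main] with z hz
    rw [abs_of_neg hneg] at hz
    rcases lt_trichotomy (ρ z) 0 with h | h | h
    · rw [abs_of_neg h] at hz
      have := (abs_le.1 hz).1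
      rw [sign_neg h, sign_pos (by nlinarith)]; rfl
    · rw [h] at hz ⊢
      have : v z = 0 := by simpa using hz
      simp [this]
    · rw [abs_of_pos h] at hz
      have := (abs_le.1 hz).2
      rw [sign_pos h, sign_neg (by nlinarith)]
  · left
    filter_upwards [main] with z hz
    rw [abs_of_pos hpos] at hz
    rcases lt_trichotomy (ρ z) 0 with h | h | h
    · rw [abs_of_neg h] at hz
      have := (abs_le.1 hz).2
      rw [sign_neg h, sign_neg (by nlinarith)]
    · rw [h] at hz ⊢
      have : v z = 0 := by simpa using hz
      simp [this]
    · rw [abs_of_pos h] at hz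
      have := (abs_le.1 hz).1
      rw [sign_pos h, sign_pos (by nlinarith)]

end Hypersurface

/-! ### Almost holomorphic functions which are constant on a hypersurface -/

section Uniqueness

lemma I_smul_I_smul {E : Type*} [NormedAddCommGroup E] [NormedSpace ℂ E] (x : E) :
    Complex.I • Complex.I • x = -x := by
  rw [smul_smul, Complex.I_mul_I, neg_one_smul]

variable {E : Type*} [NormedAddCommGroup E] [NormedSpace ℂ E] [NormedSpace ℝ E]
  [IsScalarTower ℝ ℂ E]

/-- The kernel of a nonzero real functional is not invariant under multiplication by `i`. -/
lemma exists_ker_apply_I_smul_ne_zero {ℓ : E →L[ℝ] ℝ} (hℓ : ℓ ≠ 0) :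
    ∃ b, ℓ b = 0 ∧ ℓ (Complex.I • b) ≠ 0 := by
  obtain ⟨x, hx⟩ : ∃ x, ℓ x ≠ 0 := by
    by_contra! h
    exact hℓ (ContinuousLinearMap.ext h)
  have hs : ∀ (a : ℝ) y, ℓ (a • y) = a * ℓ y := fun a y => by rw [map_smul, smul_eq_mul]
  refine ⟨Complex.I • x - (ℓ (Complex.I • x) / ℓ x) • x, ?_, ?_⟩
  · rw [map_sub, hs, div_mul_cancel₀ _ hx, sub_self]
  · rw [smul_sub, I_smul_I_smul, smul_comm, map_sub, map_neg, hs]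
    intro h
    have h2 : (ℓ x) ^ 2 + (ℓ (Complex.I • x)) ^ 2 = 0 := by
      field_simp at h
      linarith
    have := sq_nonneg (ℓ (Complex.I • x))
    have := sq_pos_of_ne_zero hx
    linarith

/-- A complex linear map which vanishes on a real hyperplane is zero. -/
lemma eq_zero_of_ker_of_I_smul {ℓ : E →L[ℝ] ℝ} (hℓ : ℓ ≠ 0) {T : E →L[ℝ] ℂ}
    (hT : ∀ ξ, ℓ ξ = 0 → T ξ = 0) (hI : ∀ ξ, T (Complex.I • ξ) = Complex.I • T ξ) : T = 0 := by
  obtain ⟨b, hb, hb'⟩ := exists_ker_apply_I_smul_ne_zero hℓ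
  ext v
  have h1 : T (v - (ℓ v / ℓ (Complex.I • b)) • Complex.I • b) = 0 := by
    refine hT _ ?_
    rw [map_sub, map_smul, smul_eq_mul, div_mul_cancel₀ _ hb', sub_self]
  rw [map_sub, map_smul, hI, hT b hb] at h1
  simpa using h1

variable [FiniteDimensional ℂ E]

/-- The case of finite order, by induction: every directional derivative of `g` vanishes on the
hypersurface and again satisfies the Cauchy-Riemann equations there, to one order less. -/
lemma jetVanishesAt_fderiv_nat (m : ℕ) {O : Set E} (hO : IsOpen O) {ρ : E → ℝ} {s : ℕ∞}
    (hs : 1 ≤ s) (hρ : ContDiffOn ℝ (ord s) ρ O) (hd : ∀ z ∈ O, ρ z = 0 → fderiv ℝ ρ z ≠ 0)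
    {g : E → ℂ} (hg : ContDiffOn ℝ (ord (m + 1 : ℕ)) g O)
    (htan : ∀ z ∈ O, ρ z = 0 → ∀ ξ, fderiv ℝ ρ z ξ = 0 → fderiv ℝ g z ξ = 0)
    (hbar : ∀ z ∈ O, ρ z = 0 → ∀ v, JetVanishesAt m
      (fun x => fderiv ℝ g x (Complex.I • v) - Complex.I • fderiv ℝ g x v) z) :
    ∀ z ∈ O, ρ z = 0 → JetVanishesAt m (fderiv ℝ g) z := by
  have : FiniteDimensional ℝ E := FiniteDimensional.trans ℝ ℂ E
  induction m generalizing g with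
  | zero =>
    intro z hz hρz k hk
    have hk0 : k = 0 := by simpa using hk
    subst hk0
    have h0 : fderiv ℝ g z = 0 := eq_zero_of_ker_of_I_smul (hd z hz hρz) (htan z hz hρz)
      fun ξ => sub_eq_zero.1 (hbar z hz hρz ξ).apply_eq_zero
    ext v
    simp [h0]
  | succ m ih =>
    have hat : ∀ z ∈ O, ContDiffAt ℝ (ord (m + 1 + 1 : ℕ)) g z := fun z hz =>
      hg.contDiffAt (hO.mem_nhds hz)
    have hdat : ∀ z ∈ O, ContDiffAt ℝ (ord (m + 1 : ℕ)) (fderiv ℝ g) z := fun z hz => by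
      refine (hat z hz).fderiv_right ?_
      exact_mod_cast le_rfl
    have hdg0 : ∀ z ∈ O, ρ z = 0 → fderiv ℝ g z = 0 := fun z hz hρz =>
      eq_zero_of_ker_of_I_smul (hd z hz hρz) (htan z hz hρz)
        fun ξ => sub_eq_zero.1 (hbar z hz hρz ξ).apply_eq_zero
    have hdd : ∀ z ∈ O, DifferentiableAt ℝ (fderiv ℝ g) z := fun z hz =>
      (hdat z hz).differentiableAt (ord_ne_zero (by exact_mod_cast Nat.succ_pos m))
    intro z hz hρz
    refine jetVanishesAt_of_forall_apply (hdat z hz) fun a => ?_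
    have hga : ∀ x ∈ O, ∀ v, fderiv ℝ (fun x => fderiv ℝ g x a) x v =
        fderiv ℝ (fderiv ℝ g) x v a := fun x hx v => by
      have := ((ContinuousLinearMap.apply ℝ ℂ a).hasFDerivAt.comp x (hdd x hx).hasFDerivAt).fderiv
      exact congrArg (fun S => S v) this
    rw [Nat.cast_succ]
    refine jetVanishesAt_add_one_iff.2 ⟨by rw [hdg0 z hz hρz]; rfl, ?_⟩
    refine ih (g := fun x => fderiv ℝ g x a) (fun x hx =>
      ((hdat x hx).clm_apply contDiffAt_const).contDiffWithinAt) ?_ ?_ z hz hρz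
    · intro x hx hρx ξ hξ
      refine fderiv_eq_zero_of_tangent hs hO hx hρ hρx (hd x hx hρx)
        ((hdd x hx).clm_apply (differentiableAt_const a)) ?_ hξ
      filter_upwards [hO.mem_nhds hx] with y hy hρy
      simp [hdg0 y hy hρy]
    · intro x hx hρx v
      -- By the symmetry of second derivatives, the expression is the derivative in the
      -- direction `a` of the flat function `x ↦ dg(i v) - i dg(v)`.
      set β : E → ℂ := fun x => fderiv ℝ g x (Complex.I • v) - Complex.I • fderiv ℝ g x v with hβ
      have hβat : ∀ y ∈ O, ContDiffAt ℝ (ord (m + 1 : ℕ)) β y := fun y hy =>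
        ((hdat y hy).clm_apply contDiffAt_const).sub
          (((hdat y hy).clm_apply contDiffAt_const).const_smul Complex.I)
      have h1 : JetVanishesAt m (fderiv ℝ β) x := by
        have := hbar x hx hρx v
        exact (jetVanishesAt_add_one_iff.1 this).2
      have hβd : ContDiffAt ℝ (ord m) (fderiv ℝ β) x := by
        refine (hβat x hx).fderiv_right ?_
        exact_mod_cast le_rfl
      refine (h1.clm_comp (ContinuousLinearMap.apply ℝ ℂ a) hβd).congr ?_
      filter_upwards [hO.mem_nhds hx] with y hy
      have hsymm : IsSymmSndFDerivAt ℝ g y := (hat y hy).isSymmSndFDerivAt (by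
        simp only [minSmoothness_of_isRCLikeNormedField]
        exact natCast_le_ord (k := 2) (Nat.cast_le.2 (by omega)))
      have hβy : fderiv ℝ β y a = fderiv ℝ (fderiv ℝ g) y a (Complex.I • v) -
          Complex.I • fderiv ℝ (fderiv ℝ g) y a v := by
        have e1 := ((ContinuousLinearMap.apply ℝ ℂ (Complex.I • v)).hasFDerivAt.comp y
          (hdd y hy).hasFDerivAt)
        have e2 := ((ContinuousLinearMap.apply ℝ ℂ v).hasFDerivAt.comp y
          (hdd y hy).hasFDerivAt).const_smul Complex.I
        exact congrArg (fun S => S a) (e1.sub e2).fderiv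
      change fderiv ℝ β y a = _
      rw [hga y hy, hga y hy, hβy, hsymm.eq, hsymm.eq v a]

/-- A function which is constant on a hypersurface, and holomorphic to order `r - 1` along it, has
vanishing derivatives of all orders between `1` and `r` there: the derivatives along the
hypersurface vanish, and the Cauchy-Riemann equations determine the transverse ones. -/
theorem jetVanishesAt_fderiv_of_tangent {r : ℕ∞} (hr : 1 ≤ r) {O : Set E} (hO : IsOpen O)
    {ρ : E → ℝ} (hρ : ContDiffOn ℝ (ord r) ρ O) (hd : ∀ z ∈ O, ρ z = 0 → fderiv ℝ ρ z ≠ 0)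
    {g : E → ℂ} (hg : ContDiffOn ℝ (ord r) g O)
    (htan : ∀ z ∈ O, ρ z = 0 → ∀ ξ, fderiv ℝ ρ z ξ = 0 → fderiv ℝ g z ξ = 0)
    (hbar : ∀ z ∈ O, ρ z = 0 → ∀ v, JetVanishesAt (r - 1)
      (fun x => fderiv ℝ g x (Complex.I • v) - Complex.I • fderiv ℝ g x v) z) :
    ∀ z ∈ O, ρ z = 0 → JetVanishesAt (r - 1) (fderiv ℝ g) z := by
  intro z hz hρz
  refine jetVanishesAt_iff_nat.2 fun k hk => ?_
  have hk' : ((k + 1 : ℕ) : ℕ∞) ≤ r := by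
    push_cast
    exact (add_le_add_left hk 1).trans (tsub_add_cancel_of_le hr).le
  exact jetVanishesAt_fderiv_nat k hO hr hρ hd (hg.of_le (WithTop.coe_le_coe.2 hk')) htan
    (fun z hz hρz v => (hbar z hz hρz v).mono hk) z hz hρz

end Uniqueness

/-! ### Changes of coordinates -/

section Charts

variable {n : ℕ} {X : Type*} [TopologicalSpace X] [ChartedSpace (Cn n) X]

lemma I_smul_eq_J (v : Cn n) : J n v = Complex.I • v := rfl

/-- The coordinate change from the preferred chart at `p` to the one at `q`. -/
def coordChange (p q : X) : Cn n → Cn n := chartAt (Cn n) q ∘ (chartAt (Cn n) p).symm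

lemma coordChange_apply {p q x : X} (hp : x ∈ (chartAt (Cn n) p).source) :
    coordChange (n := n) p q (chartAt (Cn n) p x) = chartAt (Cn n) q x := by
  simp [coordChange, hp]

/-- Points of a chart domain near `x`, in the coordinates of that chart. -/
lemma eventually_symm_mem {p x : X} (hp : x ∈ (chartAt (Cn n) p).source) {S : Set X}
    (hS : S ∈ 𝓝 x) : ∀ᶠ z in 𝓝 (chartAt (Cn n) p x), (chartAt (Cn n) p).symm z ∈ S := by
  have h := (chartAt (Cn n) p).symm.continuousAt (x := chartAt (Cn n) p x)
    ((chartAt (Cn n) p).map_source hp)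
  have h2 : Tendsto (chartAt (Cn n) p).symm (𝓝 (chartAt (Cn n) p x)) (𝓝 x) := by
    simpa [ContinuousAt, (chartAt (Cn n) p).left_inv hp] using h
  exact h2 hS

lemma inChart_eventuallyEq {W : Type*} {p q x : X} (hp : x ∈ (chartAt (Cn n) p).source)
    (hq : x ∈ (chartAt (Cn n) q).source) (w : X → W) :
    inChart (n := n) p w =ᶠ[𝓝 (chartAt (Cn n) p x)] fun z =>
      inChart (n := n) q w (coordChange p q z) := by
  filter_upwards [eventually_symm_mem hp ((chartAt (Cn n) q).open_source.mem_nhds hq)] with z hz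
  simp [inChart, coordChange, (chartAt (Cn n) q).left_inv hz]

lemma differential_eq {ρ : X → ℝ} {q : X} (h : MDifferentiableAt 𝓘(ℝ, Cn n) 𝓘(ℝ, ℝ) ρ q) :
    differential n ρ q = fderiv ℝ (inChart (n := n) q ρ) (coord q) := by
  rw [differential, h.mfderiv]
  simp [inChart, coord, writtenInExtChartAt, Function.comp_def, mfld_simps]
  rfl

variable [IsManifold 𝓘(ℂ, Cn n) ω X]

lemma contDiffAt_coordChange_complex {p q : X} {x : X} (hp : x ∈ (chartAt (Cn n) p).source)
    (hq : x ∈ (chartAt (Cn n) q).source) :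
    ContDiffAt ℂ ω (coordChange (n := n) p q) (chartAt (Cn n) p x) := by
  have h := (contDiffGroupoid ω 𝓘(ℂ, Cn n)).compatible (chart_mem_atlas (Cn n) p)
    (chart_mem_atlas (Cn n) q)
  have h1 := (mem_groupoid_of_pregroupoid.1 h).1
  simp only [contDiffPregroupoid, modelWithCornersSelf_coe, modelWithCornersSelf_coe_symm,
    Set.preimage_id, Set.range_id, Set.inter_univ, Function.id_comp, Function.comp_id] at h1
  refine ContDiffOn.contDiffAt h1 (IsOpen.mem_nhds ?_ ?_)
  · exact ((chartAt (Cn n) p).symm.trans (chartAt (Cn n) q)).open_source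
  · simp [hp, hq]

lemma contDiffAt_coordChange {p q : X} {x : X} (hp : x ∈ (chartAt (Cn n) p).source)
    (hq : x ∈ (chartAt (Cn n) q).source) (m : WithTop ℕ∞) :
    ContDiffAt ℝ m (coordChange (n := n) p q) (chartAt (Cn n) p x) :=
  ((contDiffAt_coordChange_complex hp hq).restrict_scalars ℝ).of_le le_top

lemma fderiv_coordChange_I_smul {p q : X} {x : X} (hp : x ∈ (chartAt (Cn n) p).source)
    (hq : x ∈ (chartAt (Cn n) q).source) (v : Cn n) :
    fderiv ℝ (coordChange (n := n) p q) (chartAt (Cn n) p x) (Complex.I • v) =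
      Complex.I • fderiv ℝ (coordChange (n := n) p q) (chartAt (Cn n) p x) v := by
  have h := ((contDiffAt_coordChange_complex hp hq).differentiableAt (by simp)).hasFDerivAt
  rw [(h.restrictScalars ℝ).fderiv]
  simp

variable (n X) in
lemma isManifold_real : IsManifold 𝓘(ℝ, Cn n) ∞ X := by
  refine isManifold_of_contDiffOn _ _ _ fun e e' he he' => ?_
  have h := (contDiffGroupoid ω 𝓘(ℂ, Cn n)).compatible he he'
  have h1 := (mem_groupoid_of_pregroupoid.1 h).1
  simp only [contDiffPregroupoid, modelWithCornersSelf_coe, modelWithCornersSelf_coe_symm,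
    Set.preimage_id, Set.range_id, Set.inter_univ, Function.id_comp, Function.comp_id] at h1 ⊢
  exact (h1.restrict_scalars ℝ).of_le le_top

variable {W : Type*} [NormedAddCommGroup W] [NormedSpace ℝ W]

lemma contMDiffAt_iff_inChart {m : ℕ∞} {w : X → W} {p x : X}
    (hp : x ∈ (chartAt (Cn n) p).source) :
    ContMDiffAt 𝓘(ℝ, Cn n) 𝓘(ℝ, W) (ord m) w x ↔
      ContDiffAt ℝ (ord m) (inChart (n := n) p w) (chartAt (Cn n) p x) := by
  have : IsManifold 𝓘(ℝ, Cn n) ∞ X := isManifold_real n X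
  have : IsManifold 𝓘(ℝ, Cn n) (ord m) X := IsManifold.of_le (n := ∞) (by
    exact WithTop.coe_le_coe.2 le_top)
  rw [contMDiffAt_iff_source_of_mem_source (x := p) (by simpa using hp),
    contMDiffWithinAt_iff_contDiffWithinAt]
  simp [inChart, ContDiffAt]

lemma fderiv_inChart_eq_comp {w : X → W} {p q x : X} (hp : x ∈ (chartAt (Cn n) p).source)
    (hq : x ∈ (chartAt (Cn n) q).source)
    (hw : DifferentiableAt ℝ (inChart (n := n) q w) (chartAt (Cn n) q x)) :
    fderiv ℝ (inChart (n := n) p w) (chartAt (Cn n) p x) =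
      (fderiv ℝ (inChart (n := n) q w) (chartAt (Cn n) q x)).comp
        (fderiv ℝ (coordChange p q) (chartAt (Cn n) p x)) := by
  rw [(inChart_eventuallyEq hp hq w).fderiv_eq]
  rw [← coordChange_apply (q := q) hp] at hw ⊢
  exact fderiv_comp _ hw ((contDiffAt_coordChange hp hq 1).differentiableAt one_ne_zero)

lemma fderiv_coordChange_comp {p q x : X} (hp : x ∈ (chartAt (Cn n) p).source)
    (hq : x ∈ (chartAt (Cn n) q).source) (v : Cn n) :
    fderiv ℝ (coordChange q p) (chartAt (Cn n) q x)
      (fderiv ℝ (coordChange p q) (chartAt (Cn n) p x) v) = v := by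
  have h1 : coordChange (n := n) q p ∘ coordChange p q =ᶠ[𝓝 (chartAt (Cn n) p x)] id := by
    filter_upwards [eventually_symm_mem hp ((chartAt (Cn n) q).open_source.mem_nhds hq),
      (chartAt (Cn n) p).open_target.mem_nhds ((chartAt (Cn n) p).map_source hp)] with z hz hz'
    simp [coordChange, (chartAt (Cn n) q).left_inv hz, (chartAt (Cn n) p).right_inv hz']
  have h2 := h1.fderiv_eq (𝕜 := ℝ)
  rw [fderiv_comp _ (by
    rw [coordChange_apply hp]
    exact (contDiffAt_coordChange hq hp 1).differentiableAt one_ne_zero)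
    ((contDiffAt_coordChange hp hq 1).differentiableAt one_ne_zero), coordChange_apply hp,
    fderiv_id] at h2
  exact DFunLike.congr_fun h2 v

end Charts

/-! ### The operator `∂̄` in coordinates -/

section Dbar

variable {n : ℕ}

lemma dbar_apply (w : Cn n → ℂ) (z v : Cn n) : dbar w z v =
    (1 / 2 : ℝ) • (fderiv ℝ w z v + Complex.I • fderiv ℝ w z (Complex.I • v)) := rfl

lemma ContDiffAt.dbar {r : ℕ∞} (hr : 1 ≤ r) {w : Cn n → ℂ} {z : Cn n}
    (hw : ContDiffAt ℝ (ord r) w z) : ContDiffAt ℝ (ord (r - 1)) (dbar w) z := by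
  have h := ContDiffAt.fderiv_ord hw hr
  exact (h.add ((h.clm_comp contDiffAt_const).const_smul Complex.I)).const_smul (1 / 2 : ℝ)

/-- `∂̄` is compatible with holomorphic changes of coordinates. -/
lemma dbar_comp {w : Cn n → ℂ} {τ : Cn n → Cn n} {z : Cn n} (hw : DifferentiableAt ℝ w (τ z))
    (hτ : DifferentiableAt ℝ τ z)
    (hI : ∀ v, fderiv ℝ τ z (Complex.I • v) = Complex.I • fderiv ℝ τ z v) :
    dbar (fun x => w (τ x)) z = (dbar w (τ z)).comp (fderiv ℝ τ z) := by
  ext v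
  rw [ContinuousLinearMap.comp_apply, dbar_apply, dbar_apply, ← hI]
  have := fderiv_comp z hw hτ
  simp only [Function.comp_def] at this
  rw [this]
  rfl

/-- Vanishing of the jet of `∂̄w` in terms of the failure of `dw` to be complex linear. -/
lemma jetVanishesAt_dbar_iff {m : ℕ∞} {w : Cn n → ℂ} {z : Cn n}
    (hw : ContDiffAt ℝ (ord (m + 1)) w z) :
    JetVanishesAt m (dbar w) z ↔ ∀ v, JetVanishesAt m
      (fun x => fderiv ℝ w x (Complex.I • v) - Complex.I • fderiv ℝ w x v) z := by
  have hm : m + 1 - 1 = m := by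
    exact (ENat.addLECancellable_of_ne_top ENat.one_ne_top).add_tsub_cancel_right
  have h1 := ContDiffAt.fderiv_ord hw le_add_self
  have h2 := ContDiffAt.dbar le_add_self hw
  rw [hm] at h1 h2
  constructor
  · intro h v
    refine (h.clm_comp ((-2 * Complex.I) • ContinuousLinearMap.apply ℝ ℂ v) h2).congr
      (Eventually.of_forall fun x => ?_)
    change (-2 * Complex.I) *
      ((1 / 2 : ℝ) • (fderiv ℝ w x v + Complex.I • fderiv ℝ w x (Complex.I • v))) = _
    simp only [smul_eq_mul, Complex.real_smul]
    push_cast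
    linear_combination -(fderiv ℝ w x (Complex.I • v)) * Complex.I_mul_I
  · intro h
    refine jetVanishesAt_of_forall_apply h2 fun v => ?_
    have hc : ContDiffAt ℝ (ord m)
        (fun x => fderiv ℝ w x (Complex.I • v) - Complex.I • fderiv ℝ w x v) z :=
      (h1.clm_apply contDiffAt_const).sub ((h1.clm_apply contDiffAt_const).const_smul Complex.I)
    refine ((h v).clm_comp ((Complex.I / 2) • ContinuousLinearMap.id ℝ ℂ) hc).congr
      (Eventually.of_forall fun x => ?_)
    change _ = (1 / 2 : ℝ) • (fderiv ℝ w x v + Complex.I • fderiv ℝ w x (Complex.I • v))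
    change (Complex.I / 2) * (fderiv ℝ w x (Complex.I • v) - Complex.I • fderiv ℝ w x v) = _
    simp only [smul_eq_mul, Complex.real_smul]
    push_cast
    linear_combination -(1 / 2) * (fderiv ℝ w x v) * Complex.I_mul_I

variable {X : Type*} [TopologicalSpace X] [ChartedSpace (Cn n) X] [IsManifold 𝓘(ℂ, Cn n) ω X]

/-- The condition `j^{r-1}(∂̄f) = 0` at a point does not depend on the chart. -/
lemma JetVanishesAt.dbar_inChart {r : ℕ∞} (hr : 1 ≤ r) {f : X → ℂ} {p q x : X}
    (hp : x ∈ (chartAt (Cn n) p).source) (hq : x ∈ (chartAt (Cn n) q).source)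
    (hf : ContMDiffAt 𝓘(ℝ, Cn n) 𝓘(ℝ, ℂ) (ord r) f x)
    (h : JetVanishesAt (r - 1) (dbar (inChart (n := n) q f)) (chartAt (Cn n) q x)) :
    JetVanishesAt (r - 1) (dbar (inChart (n := n) p f)) (chartAt (Cn n) p x) := by
  have hw := (contMDiffAt_iff_inChart hq).1 hf
  have hτ := contDiffAt_coordChange hp hq ∞
  have hτ' : ContDiffAt ℝ (ord (r - 1)) (coordChange p q) (chartAt (Cn n) p x) :=
    hτ.of_le (WithTop.coe_le_coe.2 le_top)
  rw [← coordChange_apply hp] at h hw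
  have hd := ContDiffAt.dbar hr hw
  have h1 := (h.comp hd hτ').bilinear (ContinuousLinearMap.compL ℝ (Cn n) (Cn n) ℂ)
    (hd.comp _ hτ') (hτ.fderiv_right (m := ord (r - 1)) (by
      exact WithTop.coe_le_coe.2 le_top))
  refine h1.congr ?_
  have hw1 : ContDiffAt ℝ 1 (inChart (n := n) q f) (coordChange p q (chartAt (Cn n) p x)) :=
    hw.of_le (WithTop.coe_le_coe.2 hr)
  have hev := (hw1.eventually (by simp)).filter_mono
    (show map _ (𝓝 (chartAt (Cn n) p x)) ≤ _ from hτ.continuousAt)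
  filter_upwards [hev, (inChart_eventuallyEq hp hq f).eventually_nhds,
    eventually_symm_mem hp ((chartAt (Cn n) q).open_source.mem_nhds hq),
    (chartAt (Cn n) p).open_target.mem_nhds ((chartAt (Cn n) p).map_source hp)] with z h1 h2 h3 h4
  have e : dbar (inChart (n := n) p f) z =
      dbar (fun z => inChart (n := n) q f (coordChange p q z)) z := by
    rw [dbar, dbar, Filter.EventuallyEq.fderiv_eq h2]
  have h5 := (chartAt (Cn n) p).right_inv h4
  have h6 := contDiffAt_coordChange ((chartAt (Cn n) p).map_target h4) h3 1
  have h7 := fderiv_coordChange_I_smul ((chartAt (Cn n) p).map_target h4) h3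
  rw [h5] at h6 h7
  rw [e, dbar_comp ((show ContDiffAt ℝ 1 _ _ from h1).differentiableAt one_ne_zero)
    (h6.differentiableAt one_ne_zero) h7]
  rfl

end Dbar

/-! ### Hypersurfaces in a complex manifold -/

section Hypersurface

variable {n : ℕ} {X : Type*} [TopologicalSpace X] [ChartedSpace (Cn n) X]
  {r : ℕ∞} {M U : Set X} {ρ : X → ℝ}

lemma ContMDiffOn.differential_eq {v : X → ℝ} (hr : 1 ≤ r) (hU : IsOpen U)
    (hv : ContMDiffOn 𝓘(ℝ, Cn n) 𝓘(ℝ, ℝ) (ord r) v U) {x : X} (hx : x ∈ U) :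
    differential n v x = fderiv ℝ (inChart x v) (coord x) :=
  LeviFlat.differential_eq
    ((hv.contMDiffAt (hU.mem_nhds hx)).mdifferentiableAt (ord_ne_zero hr))

variable [IsManifold 𝓘(ℂ, Cn n) ω X]

/-- A defining function expressed in the chart at a point `p` of the hypersurface. -/
lemma IsLocalDefiningFunction.exists_inChart (hr : 1 ≤ r) (h : IsLocalDefiningFunction n r M U ρ)
    {p : X} (hp : p ∈ M ∩ U) : ∃ O : Set (Cn n), IsOpen O ∧ coord p ∈ O ∧
      O ⊆ (chartAt (Cn n) p).target ∧ (∀ z ∈ O, (chartAt (Cn n) p).symm z ∈ U) ∧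
      ContDiffOn ℝ (ord r) (inChart p ρ) O ∧
      (∀ z ∈ O, inChart p ρ z = 0 ↔ (chartAt (Cn n) p).symm z ∈ M) ∧
      ∀ z ∈ O, fderiv ℝ (inChart p ρ) z ≠ 0 := by
  set e := chartAt (Cn n) p
  have hO1 : IsOpen (e.target ∩ e.symm ⁻¹' U) := e.isOpen_inter_preimage_symm h.isOpen
  have hc1 : ContDiffOn ℝ (ord r) (inChart p ρ) (e.target ∩ e.symm ⁻¹' U) := fun z hz => by
    have := (contMDiffAt_iff_inChart (n := n) (p := p) (e.map_target hz.1)).1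
      (h.contMDiffOn.contMDiffAt (h.isOpen.mem_nhds hz.2))
    rw [e.right_inv hz.1] at this
    exact this.contDiffWithinAt
  have hc2 : ContinuousOn (fderiv ℝ (inChart p ρ)) (e.target ∩ e.symm ⁻¹' U) := fun z hz =>
    (ContDiffAt.fderiv_ord (hc1.contDiffAt (hO1.mem_nhds hz)) hr).continuousAt.continuousWithinAt
  refine ⟨(e.target ∩ e.symm ⁻¹' U) ∩ fderiv ℝ (inChart p ρ) ⁻¹' {0}ᶜ,
    hc2.isOpen_inter_preimage hO1 isOpen_compl_singleton, ⟨⟨mem_chart_target _ p, ?_⟩, ?_⟩,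
    fun z hz => hz.1.1, fun z hz => hz.1.2, hc1.mono Set.inter_subset_left, fun z hz => ?_,
    fun z hz => hz.2⟩
  · change e.symm (e p) ∈ U
    rw [e.left_inv (mem_chart_source _ p)]; exact hp.2
  · have := h.differential_ne_zero p hp
    rwa [ContMDiffOn.differential_eq hr h.isOpen h.contMDiffOn hp.2] at this
  · have := Set.ext_iff.1 h.zero_set (e.symm z)
    simp only [Set.mem_inter_iff, Set.mem_ofPred_eq, show e.symm z ∈ U from hz.1.2, and_true,
      true_and] at this
    exact this.symm

/-- The tangent space of a hypersurface is the kernel of the differential of any of its defining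
functions. -/
lemma IsLocalDefiningFunction.mem_tangentSpace_iff (hr : 1 ≤ r)
    (h : IsLocalDefiningFunction n r M U ρ) {p : X} (hp : p ∈ M ∩ U) {ξ : Cn n} :
    ξ ∈ tangentSpace n r M p ↔ differential n ρ p ξ = 0 := by
  refine ⟨fun hξ => hξ U ρ hp.2 h, fun hξ U' ρ' hpU' h' => ?_⟩
  obtain ⟨O, hO, hpO, -, hOU, hc, h0, hd⟩ := h.exists_inChart hr hp
  obtain ⟨O', hO', hpO', -, hOU', hc', h0', hd'⟩ := h'.exists_inChart hr ⟨hp.1, hpU'⟩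
  rw [ContMDiffOn.differential_eq hr h.isOpen h.contMDiffOn hp.2] at hξ
  rw [ContMDiffOn.differential_eq hr h'.isOpen h'.contMDiffOn hpU']
  refine fderiv_eq_zero_of_tangent hr hO hpO hc ((h0 _ hpO).2 ?_) (hd _ hpO)
    ((hc'.contDiffAt (hO'.mem_nhds hpO')).differentiableAt (ord_ne_zero hr)) ?_ hξ
  · simpa [coord] using hp.1
  · filter_upwards [hO.mem_nhds hpO, hO'.mem_nhds hpO'] with z hz hz' hz0
    exact (h0' z hz').2 ((h0 z hz).1 hz0)

end Hypersurface

/-! ### One-forms and the operator `ddᶜ` in coordinates -/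

section OneForms

variable {V : Type*} [NormedAddCommGroup V] [NormedSpace ℝ V]

variable (V) in
/-- The identification of linear functionals with alternating forms of degree one, as a continuous
linear map. -/
def oneFormCLM : (V →L[ℝ] ℝ) →L[ℝ] V [⋀^Fin 1]→L[ℝ] ℝ :=
  (ContinuousAlternatingMap.ofSubsingletonLIE (𝕜 := ℝ) (E := V) (F := ℝ)
    (0 : Fin 1)).toContinuousLinearEquiv

lemma oneForm_add (α β : V → V →L[ℝ] ℝ) :
    oneForm (fun z => α z + β z) = oneForm α + oneForm β := by
  funext z; exact map_add (oneFormCLM V) (α z) (β z)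

lemma oneForm_smul (c : ℝ) (α : V → V →L[ℝ] ℝ) :
    oneForm (fun z => c • α z) = c • oneForm α := by
  funext z; exact map_smul (oneFormCLM V) c (α z)

lemma ContDiffAt.oneForm {m : WithTop ℕ∞} {α : V → V →L[ℝ] ℝ} {z : V} (h : ContDiffAt ℝ m α z) :
    ContDiffAt ℝ m (oneForm α) z := (oneFormCLM V).contDiff.contDiffAt.comp z h

lemma extDeriv_oneForm_fderiv {u : V → ℝ} {z : V} (hu : ContDiffAt ℝ 2 u z) :
    extDeriv (oneForm (fderiv ℝ u)) z = 0 := by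
  have h : (oneForm (fderiv ℝ u)) =
      extDeriv fun x => ContinuousAlternatingMap.constOfIsEmpty ℝ V (Fin 0) (u x) := by
    funext x; exact (extDeriv_constOfIsEmpty u x).symm
  rw [h]
  refine extDeriv_extDeriv_apply (r := 2) ?_ (by simp)
  exact (ContinuousAlternatingMap.constOfIsEmptyLIE ℝ V ℝ (Fin 0)).contDiff.contDiffAt.comp z hu

lemma JetVanishesAt.extDeriv_oneForm {m : ℕ∞} {α : V → V →L[ℝ] ℝ} {z : V}
    (h : JetVanishesAt (m + 1) α z) (hα : ContDiffAt ℝ (ord (m + 1)) α z) :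
    JetVanishesAt m (extDeriv (oneForm α)) z := by
  have h1 := (jetVanishesAt_add_one_iff.1 (h.clm_comp (oneFormCLM V) hα)).2
  refine h1.clm_comp (ContinuousAlternatingMap.alternatizeUncurryFinCLM ℝ V ℝ) ?_
  have := ContDiffAt.fderiv_ord ((oneFormCLM V).contDiff.contDiffAt.comp z hα) le_add_self
  rwa [(ENat.addLECancellable_of_ne_top ENat.one_ne_top).add_tsub_cancel_right] at this

end OneForms

section Ddc

variable {n : ℕ} {r : ℕ∞}

lemma sub_two_add_one (hr : 2 ≤ r) : r - 2 + 1 = r - 1 := by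
  have h : (2 : ℕ∞) = 1 + 1 := by norm_num
  rw [h, ← tsub_tsub]
  refine tsub_add_cancel_of_le ?_
  refine (ENat.addLECancellable_of_ne_top ENat.one_ne_top).le_tsub_of_add_le_right ?_
  rwa [← h]

lemma ContDiffAt.dc (hr : 1 ≤ r) {w : Cn n → ℝ} {z : Cn n} (hw : ContDiffAt ℝ (ord r) w z) :
    ContDiffAt ℝ (ord (r - 1)) (dc w) z :=
  ((ContDiffAt.fderiv_ord hw hr).clm_comp contDiffAt_const).neg

/-- Functions with the same `r`-jet have `ddᶜ` with the same `(r - 2)`-jet. -/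
lemma JetVanishesAt.ddc_of_sub (hr : 2 ≤ r) {w w' : Cn n → ℝ} {z : Cn n}
    (hw : ContDiffAt ℝ (ord r) w z) (hw' : ContDiffAt ℝ (ord r) w' z)
    (h : JetVanishesAt (r - 1) (fderiv ℝ fun x => w x - w' x) z)
    (hv : JetVanishesAt (r - 2) (ddc w') z) : JetVanishesAt (r - 2) (ddc w) z := by
  have hr1 : 1 ≤ r := le_trans (by norm_num) hr
  have h0 := sub_two_add_one hr
  have hd := ContDiffAt.fderiv_ord (hw.sub hw') hr1
  set B := -(ContinuousLinearMap.compL ℝ (Cn n) (Cn n) ℝ).flip (J n) with hB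
  set γ : Cn n → Cn n →L[ℝ] ℝ := fun x => B (fderiv ℝ (fun x => w x - w' x) x) with hγ
  have hγj : JetVanishesAt (r - 1) γ z := h.clm_comp B hd
  have hγc : ContDiffAt ℝ (ord (r - 1)) γ z := B.contDiff.contDiffAt.comp z hd
  have h1 := JetVanishesAt.extDeriv_oneForm (m := r - 2) (h0.symm ▸ hγj) (h0.symm ▸ hγc)
  have hc : ∀ {α : Cn n → Cn n →L[ℝ] ℝ}, ContDiffAt ℝ (ord (r - 1)) α z →
      ContDiffAt ℝ (ord (r - 2)) (extDeriv (oneForm α)) z := fun {α} hα => by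
    have := ContDiffAt.fderiv_ord (ContDiffAt.oneForm hα) (by rw [← h0]; exact le_add_self)
    rw [← h0, (ENat.addLECancellable_of_ne_top ENat.one_ne_top).add_tsub_cancel_right] at this
    exact (ContinuousAlternatingMap.alternatizeUncurryFinCLM ℝ (Cn n) ℝ).contDiff.contDiffAt.comp z
      this
  refine (hv.add h1 (hc (ContDiffAt.dc hr1 hw')) (hc hγc)).congr ?_
  have hle : (1 : WithTop ℕ∞) ≤ ord (r - 1) := WithTop.coe_le_coe.2 (by
    rw [← h0]; exact le_add_self)
  have h2 : (2 : WithTop ℕ∞) ≤ ord r := WithTop.coe_le_coe.2 hr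
  filter_upwards [((hw.of_le h2).eventually (by simp)).eventually_nhds,
    ((hw'.of_le h2).eventually (by simp)).eventually_nhds, (hγc.of_le hle).eventually (by simp),
    ((ContDiffAt.dc hr1 hw').of_le hle).eventually (by simp)] with x hx hx' hγx hdx
  have e : oneForm (dc w) =ᶠ[𝓝 x] oneForm (dc w') + oneForm γ := by
    filter_upwards [hx, hx'] with y hy hy'
    rw [← oneForm_add]
    simp only [oneForm]
    congr 1
    change -_ = -_ + -((fderiv ℝ (fun x => w x - w' x) y).comp (J n))
    rw [fderiv_fun_sub (hy.differentiableAt (by simp)) (hy'.differentiableAt (by simp))]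
    ext v
    simp
    ring
  rw [ddc, ddc, e.extDeriv_eq, extDeriv_add ((ContDiffAt.oneForm hdx).differentiableAt one_ne_zero)
    ((ContDiffAt.oneForm hγx).differentiableAt one_ne_zero)]

/-- The relation `dᶜ(Im f) = 2 Re ∂̄f - d(Re f)`. -/
lemma dc_im_eq {w : Cn n → ℂ} {z : Cn n} (hw : DifferentiableAt ℝ w z) :
    dc (fun x => (w x).im) z =
      (2 : ℝ) • Complex.reCLM.comp (dbar w z) + (-1 : ℝ) • fderiv ℝ (fun x => (w x).re) z := by
  have h1 : fderiv ℝ (fun x => (w x).im) z = Complex.imCLM.comp (fderiv ℝ w z) :=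
    (Complex.imCLM.hasFDerivAt.comp z hw.hasFDerivAt).fderiv
  have h2 : fderiv ℝ (fun x => (w x).re) z = Complex.reCLM.comp (fderiv ℝ w z) :=
    (Complex.reCLM.hasFDerivAt.comp z hw.hasFDerivAt).fderiv
  ext v
  change -(fderiv ℝ (fun x => (w x).im) z (Complex.I • v)) =
    (2 : ℝ) * (dbar w z v).re + (-1) * fderiv ℝ (fun x => (w x).re) z v
  rw [h1, h2, dbar_apply]
  simp
  ring

lemma JetVanishesAt.ddc_im (hr : 2 ≤ r) {w : Cn n → ℂ} {z : Cn n}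
    (hw : ContDiffAt ℝ (ord r) w z) (h : JetVanishesAt (r - 1) (dbar w) z) :
    JetVanishesAt (r - 2) (ddc fun x => (w x).im) z := by
  have hr1 : 1 ≤ r := le_trans (by norm_num) hr
  have hd := ContDiffAt.dbar hr1 hw
  set β : Cn n → Cn n →L[ℝ] ℝ := fun x => (2 : ℝ) • Complex.reCLM.comp (dbar w x) with hβ
  have h0 := sub_two_add_one hr
  set B := (2 : ℝ) • ContinuousLinearMap.compL ℝ (Cn n) ℂ ℝ Complex.reCLM with hB
  have hβj : JetVanishesAt (r - 1) β z := h.clm_comp B hd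
  have hβc : ContDiffAt ℝ (ord (r - 1)) β z := B.contDiff.contDiffAt.comp z hd
  have h1 := JetVanishesAt.extDeriv_oneForm (m := r - 2) (h0.symm ▸ hβj) (h0.symm ▸ hβc)
  refine h1.congr ?_
  have hw2 : ContDiffAt ℝ 2 w z := hw.of_le (WithTop.coe_le_coe.2 hr)
  have hβ1 : ContDiffAt ℝ 1 β z := hβc.of_le (WithTop.coe_le_coe.2 (by
    rw [← h0]; exact le_add_self))
  filter_upwards [(hw2.eventually (by simp)).eventually_nhds, hβ1.eventually (by simp)]
    with x hx hβx
  have e : oneForm (dc fun x => (w x).im) =ᶠ[𝓝 x]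
      oneForm β + (-1 : ℝ) • oneForm (fderiv ℝ fun x => (w x).re) := by
    filter_upwards [hx] with y hy
    rw [← oneForm_smul, ← oneForm_add]
    simp only [oneForm]
    rw [dc_im_eq (hy.differentiableAt (by simp))]
  have hre : ContDiffAt ℝ 2 (fun x => (w x).re) x :=
    Complex.reCLM.contDiff.contDiffAt.comp x hx.self_of_nhds
  have hre' := ContDiffAt.oneForm (hre.fderiv_right (m := 1) (by norm_num))
  rw [ddc, e.extDeriv_eq, extDeriv_add ((ContDiffAt.oneForm hβx).differentiableAt one_ne_zero)
    ((hre'.differentiableAt one_ne_zero).const_smul _), extDeriv_smul, extDeriv_oneForm_fderiv hre]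
  simp

end Ddc

/-! ### The closed form `dᶜv` -/

section ClosedForm

variable {n : ℕ} {X : Type*} [TopologicalSpace X] [ChartedSpace (Cn n) X]
  [IsManifold 𝓘(ℂ, Cn n) ω X] {r : ℕ∞} {M U : Set X}

/-- The condition `j^{r-2}(ddᶜ Im f) = 0` follows from `j^{r-1}(∂̄f) = 0`. -/
lemma DbarJetVanishesOn.ddc_im (hr : 2 ≤ r) {f : X → ℂ} (hU : IsOpen U) (hMU : M ⊆ U)
    (hf : ContMDiffOn 𝓘(ℝ, Cn n) 𝓘(ℝ, ℂ) (ord r) f U) (h : DbarJetVanishesOn n (r - 1) M f) :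
    DdcJetVanishesOn n (r - 2) M fun x => (f x).im := fun p hp =>
  JetVanishesAt.ddc_im hr ((contMDiffAt_iff_inChart (mem_chart_source _ p)).1
    (hf.contMDiffAt (hU.mem_nhds (hMU hp)))) (h p hp)

theorem HasHolomorphicFlattening.hasPluriharmonicDefiningFunction (hr : 2 ≤ r)
    (h : HasHolomorphicFlattening n r M U) : HasPluriharmonicDefiningFunction n r M U := by
  obtain ⟨f, hf, hdef, hj⟩ := h
  exact ⟨_, hdef, hj.ddc_im hr hdef.isLocal.isOpen hdef.subset hf⟩

variable {m : ℕ} {φ : Rn m → X} {s : Rn m} {p : X}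

lemma ContMDiffAt.contDiffAt_chart (hφ : ContMDiffAt 𝓘(ℝ, Rn m) 𝓘(ℝ, Cn n) (ord r) φ s)
    (hp : φ s ∈ (chartAt (Cn n) p).source) :
    ContDiffAt ℝ (ord r) (fun t => chartAt (Cn n) p (φ t)) s := by
  have : IsManifold 𝓘(ℝ, Cn n) ∞ X := isManifold_real n X
  have : IsManifold 𝓘(ℝ, Cn n) (ord r) X := IsManifold.of_le (n := ∞) (by
    exact WithTop.coe_le_coe.2 le_top)
  have h := ((contMDiffAt_iff_target_of_mem_source (y := p) (by simpa using hp)).1 hφ).2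
  rw [contMDiffAt_iff_contDiffAt] at h
  simpa [Function.comp_def] using h

/-- The derivative of a map from a Euclidean space in terms of a chart of the target. -/
lemma mfderiv_eq_comp (hr : 1 ≤ r) (hφ : ContMDiffAt 𝓘(ℝ, Rn m) 𝓘(ℝ, Cn n) (ord r) φ s)
    (hp : φ s ∈ (chartAt (Cn n) p).source) :
    (mfderiv 𝓘(ℝ, Rn m) 𝓘(ℝ, Cn n) φ s : Rn m →L[ℝ] Cn n) =
      (fderiv ℝ (coordChange p (φ s)) (chartAt (Cn n) p (φ s))).comp
        (fderiv ℝ (fun t => chartAt (Cn n) p (φ t)) s) := by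
  have h1 : (mfderiv 𝓘(ℝ, Rn m) 𝓘(ℝ, Cn n) φ s : Rn m →L[ℝ] Cn n) =
      fderiv ℝ (fun t => chartAt (Cn n) (φ s) (φ t)) s := by
    rw [(hφ.mdifferentiableAt (ord_ne_zero hr)).mfderiv]
    simp [writtenInExtChartAt, Function.comp_def, mfld_simps]
    rfl
  have h2 : (fun t => chartAt (Cn n) (φ s) (φ t)) =ᶠ[𝓝 s]
      coordChange p (φ s) ∘ fun t => chartAt (Cn n) p (φ t) := by
    filter_upwards [hφ.continuousAt.preimage_mem_nhds
      ((chartAt (Cn n) p).open_source.mem_nhds hp)] with t ht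
    exact (coordChange_apply ht).symm
  rw [h1, h2.fderiv_eq]
  exact fderiv_comp _ ((contDiffAt_coordChange hp (mem_chart_source _ _) 1).differentiableAt
    one_ne_zero) ((ContMDiffAt.contDiffAt_chart hφ hp).differentiableAt (ord_ne_zero hr))

lemma dc_inChart_comp {v : X → ℝ} {p q x : X} (hp : x ∈ (chartAt (Cn n) p).source)
    (hq : x ∈ (chartAt (Cn n) q).source)
    (hv : DifferentiableAt ℝ (inChart (n := n) q v) (chartAt (Cn n) q x)) :
    dc (inChart p v) (chartAt (Cn n) p x) = (dc (inChart q v) (chartAt (Cn n) q x)).comp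
      (fderiv ℝ (coordChange p q) (chartAt (Cn n) p x)) := by
  ext ξ
  change -(fderiv ℝ (inChart p v) _ (Complex.I • ξ)) = -(fderiv ℝ (inChart q v) _ (Complex.I • _))
  rw [fderiv_inChart_eq_comp hp hq hv, ContinuousLinearMap.comp_apply,
    fderiv_coordChange_I_smul hp hq]
  rfl

/-- The form `dᶜv` of a function with `ddᶜv = 0` along `M` restricts to a closed form on `M`. -/
lemma isClosedOneFormOn_dc (hr : 2 ≤ r) {v : X → ℝ} (hU : IsOpen U) (hMU : M ⊆ U)
    (hv : ContMDiffOn 𝓘(ℝ, Cn n) 𝓘(ℝ, ℝ) (ord r) v U) (h : DdcJetVanishesOn n 0 M v) :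
    IsClosedOneFormOn r M fun x => dc (inChart (n := n) x v) (coord x) := by
  have hr1 : 1 ≤ r := le_trans (by norm_num) hr
  intro V φ hφ
  set η : X → Cn n →L[ℝ] ℝ := fun x => dc (inChart (n := n) x v) (coord x)
  have key : ∀ s ∈ V, ContDiffAt ℝ (ord (r - 1)) (pullback φ η) s ∧
      extDeriv (oneForm (pullback φ η)) s = 0 := by
    intro s hs
    have hφs : ∀ t ∈ V, ContMDiffAt 𝓘(ℝ, Rn (2 * n - 1)) 𝓘(ℝ, Cn n) (ord r) φ t := fun t ht =>
      hφ.contMDiffOn.contMDiffAt (hφ.isOpen.mem_nhds ht)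
    have hvx : ∀ x ∈ M, ∀ q, x ∈ (chartAt (Cn n) q).source →
        ContDiffAt ℝ (ord r) (inChart (n := n) q v) (chartAt (Cn n) q x) := fun x hx q hq =>
      (contMDiffAt_iff_inChart hq).1 (hv.contMDiffAt (hU.mem_nhds (hMU hx)))
    set p := φ s with hp
    have hps := mem_chart_source (Cn n) p
    set g : Rn (2 * n - 1) → Cn n := fun t => chartAt (Cn n) p (φ t) with hg
    have hgs := ContMDiffAt.contDiffAt_chart (hφs s hs) hps
    have hdc := ContDiffAt.dc hr1 (hvx p (hφ.mapsTo s hs) p hps)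
    have e : pullback φ η =ᶠ[𝓝 s] fun t => (dc (inChart p v) (g t)).comp (fderiv ℝ g t) := by
      filter_upwards [(hφs s hs).continuousAt.preimage_mem_nhds
        ((chartAt (Cn n) p).open_source.mem_nhds hps), hφ.isOpen.mem_nhds hs] with t ht htV
      have ht2 := mem_chart_source (Cn n) (φ t)
      rw [pullback, mfderiv_eq_comp hr1 (hφs t htV) ht]
      rw [dc_inChart_comp ht ht2 ((hvx _ (hφ.mapsTo t htV) _ ht2).differentiableAt
        (ord_ne_zero hr1)), ContinuousLinearMap.comp_assoc]
      rfl
    have hgle : ContDiffAt ℝ (ord (r - 1)) g s := hgs.of_le (WithTop.coe_le_coe.2 tsub_le_self)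
    refine ⟨ContDiffAt.congr_of_eventuallyEq ?_ e, ?_⟩
    · exact (hdc.comp s hgle).clm_comp (ContDiffAt.fderiv_ord hgs hr1)
    · have e' : oneForm (pullback φ η) =ᶠ[𝓝 s] fun t =>
          (oneForm (dc (inChart p v)) (g t)).compContinuousLinearMap (fderiv ℝ g t) := by
        filter_upwards [e] with t ht
        simp only [oneForm, ht]
        ext w
        rfl
      have h1 : (1 : ℕ∞) ≤ r - 1 := by rw [← sub_two_add_one hr]; exact le_add_self
      rw [e'.extDeriv_eq, extDeriv_pullback (f := g) (r := ord r)
        ((ContDiffAt.oneForm hdc).differentiableAt (ord_ne_zero h1)) hgs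
        (by simpa using (WithTop.coe_le_coe.2 hr : ((2 : ℕ∞) : WithTop ℕ∞) ≤ r))]
      have := (h p (hφ.mapsTo s hs)).apply_eq_zero
      rw [ddc, coord] at this
      rw [show g s = chartAt (Cn n) p p from rfl, this]
      ext w
      simp
  exact ⟨fun s hs => (key s hs).1.contDiffWithinAt, fun s hs => (key s hs).2⟩

/-- The form is `dᶜv`: its kernel in `TM = ker dv` is `TM ∩ J(TM)`, as `⟨dᶜv, ξ⟩ = -⟨dv, Jξ⟩`. -/
theorem HasPluriharmonicDefiningFunction.leviFoliationDefinedByClosedForm (hr : 2 ≤ r)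
    (h : HasPluriharmonicDefiningFunction n r M U) :
    LeviFoliationDefinedByClosedForm n r M := by
  have hr1 : 1 ≤ r := le_trans (by norm_num) hr
  obtain ⟨v, hdef, hj⟩ := h
  refine ⟨_, isClosedOneFormOn_dc hr hdef.isLocal.isOpen hdef.subset hdef.isLocal.contMDiffOn
    fun p hp => (hj p hp).mono zero_le, fun p hp => ?_⟩
  have hpU : p ∈ M ∩ U := ⟨hp, hdef.subset hp⟩
  ext ξ
  have hmem : ∀ ξ, ξ ∈ tangentSpace n r M p ↔ fderiv ℝ (inChart p v) (coord p) ξ = 0 := fun ξ => by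
    rw [hdef.isLocal.mem_tangentSpace_iff hr1 hpU,
      ContMDiffOn.differential_eq hr1 hdef.isLocal.isOpen hdef.isLocal.contMDiffOn hpU.2]
  change ξ ∈ tangentSpace n r M p ∧ -(fderiv ℝ (inChart p v) (coord p) (J n ξ)) = 0 ↔
    ξ ∈ tangentSpace n r M p ∧ ξ ∈ J n '' tangentSpace n r M p
  refine and_congr_right fun hξ => ?_
  rw [neg_eq_zero, ← hmem]
  constructor
  · refine fun h => ⟨-(J n ξ), ?_, ?_⟩
    · rw [hmem] at h ⊢
      rw [map_neg, h, neg_zero]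
    · rw [map_neg, I_smul_eq_J, I_smul_eq_J, I_smul_I_smul, neg_neg]
  · rintro ⟨ζ, hζ, rfl⟩
    rw [I_smul_eq_J, I_smul_eq_J, I_smul_I_smul]
    rw [hmem] at hζ ⊢
    rw [map_neg, hζ, neg_zero]

end ClosedForm

/-! ### Primitives of closed one-forms -/

section Primitive

variable {V : Type*} [NormedAddCommGroup V] [NormedSpace ℝ V]

/-- A closed one-form has a symmetric derivative. -/
lemma fderiv_apply_comm_of_extDeriv_eq_zero {α : V → V →L[ℝ] ℝ} {s : V}
    (hα : DifferentiableAt ℝ α s) (h : extDeriv (oneForm α) s = 0) (x y : V) :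
    fderiv ℝ α s x y = fderiv ℝ α s y x := by
  have hd : DifferentiableAt ℝ (oneForm α) s :=
    (oneFormCLM V).differentiableAt.comp s hα
  have h1 := extDeriv_apply hd ![x, y]
  rw [h] at h1
  have h2 : ∀ (i : Fin 2) (a b : V), (∀ t, oneForm α t (i.removeNth ![x, y]) = α t b) →
      fderiv ℝ (fun t => oneForm α t (i.removeNth ![x, y])) s a = fderiv ℝ α s a b := by
    intro i a b hb
    simp only [hb]
    rw [fderiv_clm_apply hα (differentiableAt_const b)]
    simp
  rw [Fin.sum_univ_two, h2 0 _ y fun t => rfl, h2 1 _ x fun t => rfl] at h1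
  simp at h1
  linarith

/-- A closed one-form of class `C^{r-1}` on an open convex set has a primitive of class `C^r`. -/
lemma exists_contDiffOn_primitive {r : ℕ∞} (hr : 2 ≤ r) {s : Set V} (hs : IsOpen s)
    (hconv : Convex ℝ s) {α : V → V →L[ℝ] ℝ} (hα : ContDiffOn ℝ (ord (r - 1)) α s)
    (h : ∀ x ∈ s, extDeriv (oneForm α) x = 0) :
    ∃ w : V → ℝ, ContDiffOn ℝ (ord r) w s ∧ ∀ x ∈ s, HasFDerivAt w (α x) x := by
  have h0 : 1 ≤ r - 1 := by rw [← sub_two_add_one hr]; exact le_add_self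
  have hd : DifferentiableOn ℝ α s := hα.differentiableOn (ord_ne_zero h0)
  obtain ⟨w, hw⟩ := hconv.exists_forall_hasFDerivAt_of_fderiv_symmetric hs hd fun a ha =>
    fderiv_apply_comm_of_extDeriv_eq_zero (hd.differentiableAt (hs.mem_nhds ha)) (h a ha)
  refine ⟨w, ?_, hw⟩
  have hr' : ord r = ord (r - 1) + 1 := by
    have : r - 1 + 1 = r := tsub_add_cancel_of_le (le_trans (by norm_num) hr)
    exact congrArg (fun t : ℕ∞ => (t : WithTop ℕ∞)) this.symm
  rw [hr', contDiffOn_succ_iff_fderiv_of_isOpen hs]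
  refine ⟨fun x hx => (hw x hx).differentiableAt.differentiableWithinAt,
    fun h => absurd h (by exact WithTop.coe_ne_top), hα.congr fun x hx => (hw x hx).fderiv⟩

end Primitive

/-! ### Parametrizations of a hypersurface -/

section Parametrization

variable {n : ℕ} {X : Type*} [TopologicalSpace X] [ChartedSpace (Cn n) X]
  [IsManifold 𝓘(ℂ, Cn n) ω X] {r : ℕ∞} {M U : Set X} {ρ : X → ℝ}

/-- A hypersurface is parametrized near a point `p` by the inverse `φ` of a linear projection `Q`,
in the chart at `p`. The last statement says that `Q` inverts the derivative of `φ` on tangent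
vectors; the coordinate change in it comes from the use of the preferred chart at each point for the
tangent space of `X`. -/
lemma IsLocalDefiningFunction.exists_parametrization (hr : 1 ≤ r)
    (h : IsLocalDefiningFunction n r M U ρ) {p : X} (hp : p ∈ M ∩ U) :
    ∃ (O : Set (Cn n)) (Q : Cn n →L[ℝ] Rn (2 * n - 1)) (ε : ℝ) (φ : Rn (2 * n - 1) → X),
      IsOpen O ∧ coord p ∈ O ∧
      O ⊆ (chartAt (Cn n) p).target ∧ (∀ z ∈ O, (chartAt (Cn n) p).symm z ∈ U) ∧
      ContDiffOn ℝ (ord r) (inChart p ρ) O ∧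
      (∀ z ∈ O, inChart p ρ z = 0 ↔ (chartAt (Cn n) p).symm z ∈ M) ∧
      (∀ z ∈ O, fderiv ℝ (inChart p ρ) z ≠ 0) ∧
      0 < ε ∧ IsLocalParametrization n r M (Metric.ball (Q (coord p)) ε) φ ∧
      (∀ z ∈ O, Q z ∈ Metric.ball (Q (coord p)) ε) ∧
      ∀ z ∈ O, inChart p ρ z = 0 → φ (Q z) = (chartAt (Cn n) p).symm z ∧
        ∀ ξ, fderiv ℝ (inChart p ρ) z ξ = 0 →
          (mfderiv 𝓘(ℝ, Rn (2 * n - 1)) 𝓘(ℝ, Cn n) φ (Q z) : Rn (2 * n - 1) →L[ℝ] Cn n) (Q ξ) =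
            fderiv ℝ (coordChange p ((chartAt (Cn n) p).symm z)) z ξ := by
  obtain ⟨O, hO, hpO, hOt, hOU, hc, h0, hd⟩ := h.exists_inChart hr hp
  set e := chartAt (Cn n) p with he
  have hfin : Module.finrank ℝ (Rn (2 * n - 1)) + 1 = Module.finrank ℝ (Cn n) := by
    have h1 := one_le_finrank_of_ne_zero (hd _ hpO)
    have h2 : Module.finrank ℝ (Cn n) = 2 * n := by
      rw [← Module.finrank_mul_finrank ℝ ℂ (Cn n), Complex.finrank_real_complex,
        finrank_euclideanSpace_fin]
    rw [finrank_euclideanSpace_fin]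
    omega
  obtain ⟨Q, Φ, hpΦ, hΦO, hΦ, hΦs, hL⟩ := exists_straightening hfin hr hO hpO hc (hd _ hpO)
  have hρp : inChart p ρ (coord p) = 0 := (h0 _ hpO).2 (by
    rw [coord, e.left_inv (mem_chart_source _ p)]; exact hp.1)
  let ι : Rn (2 * n - 1) → Rn (2 * n - 1) × ℝ := fun s => (s, 0)
  have hι : ContDiff ℝ (ord r) ι := contDiff_id.prodMk contDiff_const
  have hιo : IsOpen (ι ⁻¹' Φ.target) := Φ.open_target.preimage hι.continuous
  have hιp : Q (coord p) ∈ ι ⁻¹' Φ.target := by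
    have := Φ.map_source hpΦ
    rwa [hΦ, hρp] at this
  obtain ⟨ε, hε, hball⟩ := Metric.isOpen_iff.1 hιo _ hιp
  set g : Rn (2 * n - 1) → Cn n := fun s => Φ.symm (ι s) with hg
  have hgs : ∀ s ∈ Metric.ball (Q (coord p)) ε, g s ∈ Φ.source ∧ Q (g s) = s ∧
      inChart p ρ (g s) = 0 := by
    intro s hs
    have h1 := Φ.right_inv (hball hs)
    rw [hΦ] at h1
    exact ⟨Φ.map_target (hball hs), congrArg Prod.fst h1, congrArg Prod.snd h1⟩
  have hgc : ContDiffOn ℝ (ord r) g (Metric.ball (Q (coord p)) ε) :=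
    hΦs.comp hι.contDiffOn hball
  have hgd : ∀ s ∈ Metric.ball (Q (coord p)) ε, DifferentiableAt ℝ g s := fun s hs =>
    (hgc.contDiffAt (Metric.isOpen_ball.mem_nhds hs)).differentiableAt (ord_ne_zero hr)
  set φ : Rn (2 * n - 1) → X := fun s => e.symm (g s) with hφ
  have hφs : ∀ s ∈ Metric.ball (Q (coord p)) ε, φ s ∈ e.source := fun s hs =>
    e.map_target (hOt (hΦO (hgs s hs).1))
  have heφ : ∀ s ∈ Metric.ball (Q (coord p)) ε, e (φ s) = g s := fun s hs =>
    e.right_inv (hOt (hΦO (hgs s hs).1))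
  have : IsManifold 𝓘(ℝ, Cn n) ∞ X := isManifold_real n X
  have : IsManifold 𝓘(ℝ, Cn n) (ord r) X := IsManifold.of_le (n := ∞) (by
    exact WithTop.coe_le_coe.2 le_top)
  have hφc : ContMDiffOn 𝓘(ℝ, Rn (2 * n - 1)) 𝓘(ℝ, Cn n) (ord r) φ
      (Metric.ball (Q (coord p)) ε) :=
    contMDiffOn_chart_symm.comp hgc.contMDiffOn fun s hs => hOt (hΦO (hgs s hs).1)
  have hmf : ∀ s ∈ Metric.ball (Q (coord p)) ε,
      (mfderiv 𝓘(ℝ, Rn (2 * n - 1)) 𝓘(ℝ, Cn n) φ s : Rn (2 * n - 1) →L[ℝ] Cn n) =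
        (fderiv ℝ (coordChange p (φ s)) (g s)).comp (fderiv ℝ g s) := by
    intro s hs
    rw [mfderiv_eq_comp hr (hφc.contMDiffAt (Metric.isOpen_ball.mem_nhds hs)) (hφs s hs), heφ s hs]
    congr 1
    refine Filter.EventuallyEq.fderiv_eq ?_
    filter_upwards [Metric.isOpen_ball.mem_nhds hs] with t ht using heφ t ht
  have hmf' : ∀ s ∈ Metric.ball (Q (coord p)) ε, ∀ x : Rn (2 * n - 1),
      (mfderiv 𝓘(ℝ, Rn (2 * n - 1)) 𝓘(ℝ, Cn n) φ s : Rn (2 * n - 1) →L[ℝ] Cn n) x =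
        fderiv ℝ (coordChange p (φ s)) (g s) (fderiv ℝ g s x) := fun s hs x =>
    congrArg (fun A : Rn (2 * n - 1) →L[ℝ] Cn n => A x) (hmf s hs)
  refine ⟨Φ.source ∩ Q ⁻¹' Metric.ball (Q (coord p)) ε, Q, ε, φ,
    Φ.open_source.inter (Metric.isOpen_ball.preimage Q.continuous),
    ⟨hpΦ, Metric.mem_ball_self hε⟩, fun z hz => hOt (hΦO hz.1), fun z hz => hOU z (hΦO hz.1),
    hc.mono fun z hz => hΦO hz.1, fun z hz => h0 z (hΦO hz.1), fun z hz => hd z (hΦO hz.1), hε,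
    ⟨Metric.isOpen_ball, hφc, fun s hs => ?_, fun s hs => ?_⟩, fun z hz => hz.2,
    fun z hz hz0 => ?_⟩
  · exact (h0 _ (hΦO (hgs s hs).1)).1 (hgs s hs).2.2
  · have h1 : Q ∘ g =ᶠ[𝓝 s] id := by
      filter_upwards [Metric.isOpen_ball.mem_nhds hs] with t ht using (hgs t ht).2.1
    have h2 := h1.fderiv_eq (𝕜 := ℝ)
    rw [fderiv_comp _ Q.differentiableAt (hgd s hs), fderiv_id, Q.fderiv] at h2
    intro x y hxy
    have hxy' := (hmf' s hs x).symm.trans (hxy.trans (hmf' s hs y))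
    rw [← heφ s hs] at hxy'
    have h3 := congrArg (fderiv ℝ (coordChange (φ s) p) (chartAt (Cn n) (φ s) (φ s))) hxy'
    rw [fderiv_coordChange_comp (hφs s hs) (mem_chart_source _ _),
      fderiv_coordChange_comp (hφs s hs) (mem_chart_source _ _)] at h3
    have h4 := congrArg Q h3
    have h5 := DFunLike.congr_fun h2
    exact (h5 x).symm.trans (h4.trans (h5 y))
  · have h1 : g (Q z) = z := by
      have h1 := Φ.left_inv hz.1
      rwa [hΦ, hz0] at h1
    have h2 : φ (Q z) = e.symm z := by rw [hφ]; simp only [h1]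
    refine ⟨h2, fun ξ hξ => ?_⟩
    refine (hmf' _ hz.2 _).trans ?_
    rw [h1, h2]
    congr 1
    obtain ⟨L, hL1, hL2⟩ := hL z hz.1
    have h3 : HasFDerivAt Φ.symm (L.symm : _ →L[ℝ] Cn n) (ι (Q z)) := by
      refine Φ.hasFDerivAt_symm (hball hz.2) ?_
      rw [show Φ.symm (ι (Q z)) = z from h1]
      exact hL2
    have h4 : HasFDerivAt ι (ContinuousLinearMap.inl ℝ _ _) (Q z) :=
      (hasFDerivAt_id _).prodMk (hasFDerivAt_const _ _)
    have h5 := (h3.comp _ h4).fderiv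
    change fderiv ℝ g (Q z) = _ at h5
    rw [h5]
    change L.symm (Q ξ, 0) = ξ
    rw [← hξ, ← hL1, L.symm_apply_apply]

/-- The tangent spaces of a hypersurface in terms of a chart. -/
lemma IsLocalDefiningFunction.fderiv_coordChange_mem_tangentSpace_iff (hr : 1 ≤ r)
    (h : IsLocalDefiningFunction n r M U ρ) {p x : X} (hx : x ∈ M ∩ U)
    (hpx : x ∈ (chartAt (Cn n) p).source) {ξ : Cn n} :
    fderiv ℝ (coordChange p x) (chartAt (Cn n) p x) ξ ∈ tangentSpace n r M x ↔
      fderiv ℝ (inChart p ρ) (chartAt (Cn n) p x) ξ = 0 := by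
  have hx' := mem_chart_source (Cn n) x
  rw [h.mem_tangentSpace_iff hr hx, ContMDiffOn.differential_eq hr h.isOpen h.contMDiffOn hx.2,
    fderiv_inChart_eq_comp hpx hx' (((contMDiffAt_iff_inChart hx').1
      (h.contMDiffOn.contMDiffAt (h.isOpen.mem_nhds hx.2))).differentiableAt (ord_ne_zero hr))]
  rfl

end Parametrization

/-! ### Local flattenings -/

section LocalFlattening

variable {n : ℕ} {X : Type*} [TopologicalSpace X] [ChartedSpace (Cn n) X]

variable (n) in
/-- `f` is a `C^r` function on the open set `W` which satisfies the conditions on a flattening at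
the points of `M ∩ W` and whose real part restricts on `M ∩ W` to a primitive of the one-form `η`
on `M`. -/
structure IsLocalFlattening (r : ℕ∞) (M W : Set X) (η : X → Cn n →L[ℝ] ℝ) (f : X → ℂ) :
    Prop where
  isOpen : IsOpen W
  contMDiffOn : ContMDiffOn 𝓘(ℝ, Cn n) 𝓘(ℝ, ℂ) (ord r) f W
  im_eq_zero : ∀ x ∈ M ∩ W, (f x).im = 0
  fderiv_im_ne_zero : ∀ x ∈ M ∩ W,
    fderiv ℝ (inChart (n := n) x fun y => (f y).im) (coord x) ≠ 0
  fderiv_re : ∀ x ∈ M ∩ W, ∀ ξ ∈ tangentSpace n r M x,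
    fderiv ℝ (inChart (n := n) x fun y => (f y).re) (coord x) ξ = η x ξ
  dbar : ∀ x ∈ M ∩ W, JetVanishesAt (r - 1) (dbar (inChart (n := n) x f)) (coord x)

variable {r : ℕ∞} {M U : Set X} {ρ : X → ℝ}

lemma neg_mem_tangentSpace {p : X} {ξ : Cn n} (h : ξ ∈ tangentSpace n r M p) :
    -ξ ∈ tangentSpace n r M p := fun U ρ hpU hρ => by rw [map_neg, h U ρ hpU hρ, neg_zero]

/-- The complex tangent space is invariant under `J`. -/
lemma J_mem_complexTangentSpace {p : X} {ξ : Cn n} (h : ξ ∈ complexTangentSpace n r M p) :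
    J n ξ ∈ complexTangentSpace n r M p := by
  obtain ⟨h1, ζ, hζ, rfl⟩ := h
  refine ⟨?_, _, h1, rfl⟩
  rw [I_smul_eq_J, I_smul_eq_J, I_smul_I_smul]
  exact neg_mem_tangentSpace hζ

variable [IsManifold 𝓘(ℂ, Cn n) ω X]

/-- Near each of its points a hypersurface whose Levi foliation is defined by a closed one-form has
a flattening: the function `w + iρ`, for a local primitive `w` of the form, transported along a
projection to the hypersurface, has complex linear derivative on the complex tangent spaces, and
therefore has an almost holomorphic extension from the hypersurface. -/
theorem exists_isLocalFlattening (hr : 2 ≤ r) (h : IsLocalDefiningFunction n r M U ρ) {p : X}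
    (hp : p ∈ M ∩ U) {η : X → Cn n →L[ℝ] ℝ} (hη : IsClosedOneFormOn r M η)
    (hη' : DefinesLeviFoliation r M η) :
    ∃ (W : Set X) (f : X → ℂ), p ∈ W ∧ IsLocalFlattening n r M W η f := by
  have hr1 : 1 ≤ r := le_trans (by norm_num) hr
  obtain ⟨O, Q, ε, φ, hO, hpO, hOt, hOU, hc, h0, hd, hε, hφ, hQ, hφQ⟩ :=
    h.exists_parametrization hr1 hp
  set e := chartAt (Cn n) p with he
  set ρ₀ := inChart (n := n) p ρ with hρ₀
  set α := pullback φ η with hα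
  obtain ⟨w, hw, hwα⟩ := exists_contDiffOn_primitive hr Metric.isOpen_ball (convex_ball _ _)
    (hη _ _ hφ).1 (hη _ _ hφ).2
  have hρd : ∀ z ∈ O, DifferentiableAt ℝ ρ₀ z := fun z hz =>
    (hc.contDiffAt (hO.mem_nhds hz)).differentiableAt (ord_ne_zero hr1)
  set F : Cn n → ℂ := fun z => (w (Q z) : ℂ) + Complex.I * (ρ₀ z : ℂ) with hF
  have hFre : ∀ z, (F z).re = w (Q z) := fun z => by simp [hF]
  have hFim : ∀ z, (F z).im = ρ₀ z := fun z => by simp [hF]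
  have hFc : ContDiffOn ℝ (ord r) F O := by
    refine (Complex.ofRealCLM.contDiff.comp_contDiffOn (hw.comp Q.contDiff.contDiffOn hQ)).add ?_
    exact contDiffOn_const.mul (Complex.ofRealCLM.contDiff.comp_contDiffOn hc)
  have hFd : ∀ z ∈ O, ∀ ξ, fderiv ℝ F z ξ = (α (Q z) (Q ξ) : ℂ) +
      Complex.I * (fderiv ℝ ρ₀ z ξ : ℂ) := by
    intro z hz ξ
    have h1 : HasFDerivAt (fun z => (w (Q z) : ℂ))
        (Complex.ofRealCLM.comp ((α (Q z)).comp Q)) z :=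
      Complex.ofRealCLM.hasFDerivAt.comp z ((hwα _ (hQ z hz)).comp z Q.hasFDerivAt)
    have h2 : HasFDerivAt (fun z => (ρ₀ z : ℂ)) (Complex.ofRealCLM.comp (fderiv ℝ ρ₀ z)) z :=
      Complex.ofRealCLM.hasFDerivAt.comp z (hρd z hz).hasFDerivAt
    have h3 : fderiv ℝ F z = _ := (h1.add (h2.const_mul Complex.I)).fderiv
    rw [h3]
    simp
  have hsrc : ∀ z ∈ O, e.symm z ∈ e.source := fun z hz => e.map_target (hOt hz)
  have hez : ∀ z ∈ O, e (e.symm z) = z := fun z hz => e.right_inv (hOt hz)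
  have ht1 : ∀ z ∈ O, ρ₀ z = 0 → ∀ ξ, fderiv ℝ (coordChange p (e.symm z)) z ξ ∈
      tangentSpace n r M (e.symm z) ↔ fderiv ℝ ρ₀ z ξ = 0 := by
    intro z hz hz0 ξ
    have := h.fderiv_coordChange_mem_tangentSpace_iff hr1 (x := e.symm z) (p := p) (ξ := ξ)
      ⟨(h0 z hz).1 hz0, hOU z hz⟩ (hsrc z hz)
    rwa [hez z hz] at this
  have ht2 : ∀ z ∈ O, ∀ ξ, fderiv ℝ (coordChange p (e.symm z)) z (Complex.I • ξ) =
      Complex.I • fderiv ℝ (coordChange p (e.symm z)) z ξ := by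
    intro z hz ξ
    have := fderiv_coordChange_I_smul (hsrc z hz) (mem_chart_source (Cn n) (e.symm z)) ξ
    rwa [hez z hz] at this
  have ht3 : ∀ z ∈ O, ρ₀ z = 0 → ∀ ξ, fderiv ℝ ρ₀ z ξ = 0 →
      α (Q z) (Q ξ) = η (e.symm z) (fderiv ℝ (coordChange p (e.symm z)) z ξ) := by
    intro z hz hz0 ξ hξ
    obtain ⟨h1, h2⟩ := hφQ z hz hz0
    exact (congrArg (η (φ (Q z))) (h2 ξ hξ)).trans (by rw [h1])
  have hFI : ∀ z ∈ O, ρ₀ z = 0 → ∀ ξ, fderiv ℝ F z ξ = 0 → fderiv ℝ F z (Complex.I • ξ) = 0 := by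
    intro z hz hz0 ξ hξ
    rw [hFd z hz] at hξ
    have hξρ : fderiv ℝ ρ₀ z ξ = 0 := by simpa using congrArg Complex.im hξ
    have hξα : α (Q z) (Q ξ) = 0 := by simpa using congrArg Complex.re hξ
    rw [ht3 z hz hz0 ξ hξρ] at hξα
    have h1 : fderiv ℝ (coordChange p (e.symm z)) z ξ ∈
        complexTangentSpace n r M (e.symm z) := by
      rw [← hη' _ ((h0 z hz).1 hz0)]
      exact ⟨(ht1 z hz hz0 ξ).2 hξρ, hξα⟩
    have h2 := J_mem_complexTangentSpace h1
    rw [← hη' _ ((h0 z hz).1 hz0), I_smul_eq_J, ← ht2 z hz] at h2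
    have h3 := (ht1 z hz hz0 _).1 h2.1
    rw [hFd z hz, h3, ht3 z hz hz0 _ h3, h2.2]
    simp
  -- A tangent vector `b` which is transverse to the Levi foliation.
  have hb : ∀ z ∈ O, ρ₀ z = 0 → ∃ b, fderiv ℝ ρ₀ z b = 0 ∧ fderiv ℝ ρ₀ z (Complex.I • b) ≠ 0 ∧
      α (Q z) (Q b) ≠ 0 := by
    intro z hz hz0
    obtain ⟨b, hb1, hb2⟩ := exists_ker_apply_I_smul_ne_zero (hd z hz)
    refine ⟨b, hb1, hb2, fun hb3 => hb2 ?_⟩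
    have h1 := hFI z hz hz0 b (by rw [hFd z hz, hb1, hb3]; simp)
    rw [hFd z hz] at h1
    simpa using congrArg Complex.im h1
  have hp0 : ρ₀ (coord p) = 0 := (h0 _ hpO).2 (by
    rw [coord, e.left_inv (mem_chart_source _ p)]; exact hp.1)
  have hsurj : Function.Surjective (fderiv ℝ F (coord p)) := by
    obtain ⟨b, hb1, hb2, hb3⟩ := hb _ hpO hp0
    intro c
    set t := c.im / fderiv ℝ ρ₀ (coord p) (Complex.I • b)
    refine ⟨t • Complex.I • b +
      ((c.re - t * α (Q (coord p)) (Q (Complex.I • b))) / α (Q (coord p)) (Q b)) • b, ?_⟩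
    have hsm : ∀ (a : ℝ) (y : Cn n), fderiv ℝ F (coord p) (a • y) =
        a • fderiv ℝ F (coord p) y := fun a y => map_smul _ a y
    rw [map_add, hsm, hsm _ b, hFd _ hpO, hFd _ hpO, hb1]
    apply Complex.ext
    · simp [div_mul_cancel₀ _ hb3]
    · simp [t, div_mul_cancel₀ _ hb2]
  obtain ⟨O', hO'O, hO', hpO', f, hf, hfF, hfbar⟩ :=
    exists_almostHolomorphic_extension_of_ker hr1 hO
    hpO hFc ((hFim _).trans hp0) hsurj fun z hz hz0 => hFI z hz ((hFim z).symm.trans hz0)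
  have hWs : ∀ x ∈ e.source ∩ e ⁻¹' O', e.symm (e x) = x := fun x hx => e.left_inv hx.1
  have hM0 : ∀ x ∈ M ∩ (e.source ∩ e ⁻¹' O'), ρ₀ (e x) = 0 := fun x hx =>
    (h0 _ (hO'O hx.2.2)).2 (by rw [hWs x hx.2]; exact hx.1)
  have hfin : ∀ x ∈ e.source ∩ e ⁻¹' O', inChart p (fun y => f (e y)) =ᶠ[𝓝 (e x)] f := by
    intro x hx
    filter_upwards [e.open_target.mem_nhds (e.map_source hx.1)] with z hz
    simp [inChart, ← he, e.right_inv hz]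
  have hfc : ∀ x ∈ e.source ∩ e ⁻¹' O', ContDiffAt ℝ (ord r) f (e x) := fun x hx =>
    hf.contDiffAt (hO'.mem_nhds hx.2)
  have hcm : ∀ x ∈ e.source ∩ e ⁻¹' O',
      ContMDiffAt 𝓘(ℝ, Cn n) 𝓘(ℝ, ℂ) (ord r) (fun y => f (e y)) x := fun x hx =>
    (contMDiffAt_iff_inChart hx.1).2 ((hfc x hx).congr_of_eventuallyEq (hfin x hx))
  have hfd : ∀ x ∈ M ∩ (e.source ∩ e ⁻¹' O'), ∀ ξ, fderiv ℝ ρ₀ (e x) ξ = 0 →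
      fderiv ℝ f (e x) ξ = (α (Q (e x)) (Q ξ) : ℂ) := by
    intro x hx ξ hξ
    have hz := hO'O hx.2.2
    have hfx := (hfc x hx.2).differentiableAt (ord_ne_zero hr1)
    have hFx := (hFc.contDiffAt (hO.mem_nhds hz)).differentiableAt (ord_ne_zero hr1)
    have h1 := fderiv_eq_zero_of_tangent (G := fun z => f z - F z) hr1 hO hz hc (hM0 x hx)
      (hd _ hz) (hfx.sub hFx) (by
        filter_upwards [hO'.mem_nhds hx.2.2] with z hz hz0
        rw [hfF z hz ((hFim z).trans hz0), sub_self]) hξ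
    rw [fderiv_fun_sub hfx hFx, _root_.sub_apply, sub_eq_zero, hFd _ hz, hξ] at h1
    simpa using h1
  have htr : ∀ x ∈ e.source ∩ e ⁻¹' O', ∀ (L : ℂ →L[ℝ] ℝ) (ξ : Cn n),
      fderiv ℝ (inChart x fun y => L (f (e y))) (coord x)
        (fderiv ℝ (coordChange p x) (e x) ξ) = L (fderiv ℝ f (e x) ξ) := by
    intro x hx L ξ
    have hs := mem_chart_source (Cn n) x
    have hLx : ContMDiffAt 𝓘(ℝ, Cn n) 𝓘(ℝ, ℝ) (ord r) (fun y => L (f (e y))) x :=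
      L.contMDiff.contMDiffAt.comp x (hcm x hx)
    have h1 := fderiv_inChart_eq_comp hx.1 hs
      (((contMDiffAt_iff_inChart hs).1 hLx).differentiableAt (ord_ne_zero hr1))
    have h2 := DFunLike.congr_fun h1 ξ
    refine h2.symm.trans ?_
    have h3 : inChart p (fun y => L (f (e y))) =ᶠ[𝓝 (e x)] L ∘ f := by
      filter_upwards [hfin x hx] with z hz using congrArg L hz
    rw [h3.fderiv_eq, fderiv_comp _ L.differentiableAt
      ((hfc x hx).differentiableAt (ord_ne_zero hr1)), L.fderiv]
    rfl
  have hclin : ∀ x ∈ M ∩ (e.source ∩ e ⁻¹' O'), ∀ ξ,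
      fderiv ℝ f (e x) (Complex.I • ξ) = Complex.I • fderiv ℝ f (e x) ξ := fun x hx ξ =>
    sub_eq_zero.1 (hfbar _ hx.2.2 ((hFim _).trans (hM0 x hx)) ξ).apply_eq_zero
  refine ⟨e.source ∩ e ⁻¹' O', fun y => f (e y), ⟨mem_chart_source _ p, hpO'⟩,
    e.isOpen_inter_preimage hO', fun x hx => (hcm x hx).contMDiffWithinAt, fun x hx => ?_,
    fun x hx => ?_, fun x hx ξ hξ => ?_, fun x hx => ?_⟩
  · rw [hfF _ hx.2.2 ((hFim _).trans (hM0 x hx)), hFim, hM0 x hx]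
  · obtain ⟨b, hb1, hb2, hb3⟩ := hb _ (hO'O hx.2.2) (hM0 x hx)
    intro hzero
    have h1 := htr x hx.2 Complex.imCLM (Complex.I • b)
    simp only [Complex.imCLM_apply] at h1
    rw [hzero, hclin x hx, hfd x hx b hb1] at h1
    exact hb3 (by simpa using h1.symm)
  · have hs := mem_chart_source (Cn n) x
    have hinv := fderiv_coordChange_comp hs hx.2.1 ξ
    set ζ := fderiv ℝ (coordChange x p) (chartAt (Cn n) x x) ξ with hζ
    have h1 := htr x hx.2 Complex.reCLM ζ
    have h2 := ht1 _ (hO'O hx.2.2) (hM0 x hx) ζ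
    have h3 := ht3 _ (hO'O hx.2.2) (hM0 x hx) ζ
    rw [hWs x hx.2] at h2 h3
    rw [hinv] at h1 h2 h3
    rw [hfd x hx ζ (h2.1 hξ), h3 (h2.1 hξ)] at h1
    simpa using h1
  · have h1 : JetVanishesAt (r - 1) (dbar f) (e x) := by
      refine (jetVanishesAt_dbar_iff ?_).2 (hfbar _ hx.2.2 ((hFim _).trans (hM0 x hx)))
      rw [tsub_add_cancel_of_le hr1]
      exact hfc x hx.2
    refine JetVanishesAt.dbar_inChart hr1 (mem_chart_source _ x) hx.2.1 (hcm x hx.2) (h1.congr ?_)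
    filter_upwards [(hfin x hx.2).eventually_nhds] with z hz
    rw [dbar, dbar, Filter.EventuallyEq.fderiv_eq hz]

end LocalFlattening

/-! ### Gluing functions with equal jets along a set -/

section Gluing

variable {n : ℕ} {X : Type*} [TopologicalSpace X] [ChartedSpace (Cn n) X]
  [IsManifold 𝓘(ℂ, Cn n) ω X] {r : ℕ∞} {M : Set X}

lemma JetVanishesAt.fderiv_sub_one (hr : 1 ≤ r) {V W : Type*} [NormedAddCommGroup V]
    [NormedSpace ℝ V] [NormedAddCommGroup W] [NormedSpace ℝ W] {g : V → W} {z : V} :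
    JetVanishesAt r g z ↔ g z = 0 ∧ JetVanishesAt (r - 1) (fderiv ℝ g) z := by
  conv_lhs => rw [← tsub_add_cancel_of_le hr]
  exact jetVanishesAt_add_one_iff

/-- Local functions on an open cover with the same `r`-jets along `M` are glued to a global
function by a partition of unity. Its values are convex combinations of those of the given
functions. -/
theorem exists_glue [T2Space X] [SecondCountableTopology X] {E : Type*} [NormedAddCommGroup E]
    [NormedSpace ℝ E] {ι : Type*} {W : ι → Set X} (hW : ∀ i, IsOpen (W i))
    (hcov : ∀ x, ∃ i, x ∈ W i) {g : ι → X → E}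
    (hg : ∀ i, ContMDiffOn 𝓘(ℝ, Cn n) 𝓘(ℝ, E) (ord r) (g i) (W i))
    (hj : ∀ x ∈ M, ∀ i j, x ∈ W i → x ∈ W j →
      JetVanishesAt r (inChart (n := n) x fun y => g i y - g j y) (coord x)) :
    ∃ G : X → E, ContMDiff 𝓘(ℝ, Cn n) 𝓘(ℝ, E) (ord r) G ∧
      (∀ x ∈ M, ∀ i, x ∈ W i →
        JetVanishesAt r (inChart (n := n) x fun y => G y - g i y) (coord x)) ∧
      ∀ x (C : Set E), Convex ℝ C → (∀ i, x ∈ W i → g i x ∈ C) → G x ∈ C := by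
  have : IsManifold 𝓘(ℝ, Cn n) ∞ X := isManifold_real n X
  have : LocallyCompactSpace X := ChartedSpace.locallyCompactSpace (Cn n) X
  obtain ⟨χ, hχ⟩ := SmoothPartitionOfUnity.exists_isSubordinate 𝓘(ℝ, Cn n) isClosed_univ W hW
    fun x _ => Set.mem_iUnion.2 (hcov x)
  refine ⟨fun x => ∑ᶠ i, χ i x • g i x, hχ.contMDiff_finsum_smul hW hg, fun x hx q hq => ?_,
    fun x C hC hgC => χ.finsum_smul_mem_convex (Set.mem_univ x)
      (fun i hi => hgC i (hχ i (subset_tsupport _ hi))) hC⟩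
  have hs := mem_chart_source (Cn n) x
  have hgc : ∀ i, x ∈ W i → ContDiffAt ℝ (ord r) (inChart (n := n) x (g i)) (coord x) :=
    fun i hi => (contMDiffAt_iff_inChart hs).1 ((hg i).contMDiffAt ((hW i).mem_nhds hi))
  have hχc : ∀ i, ContDiffAt ℝ (ord r) (inChart (n := n) x (χ i)) (coord x) := fun i =>
    ((contMDiffAt_iff_inChart hs).1 ((χ i).contMDiff.contMDiffAt (x := x))).of_le
      (WithTop.coe_le_coe.2 le_top)
  have hmem : ∀ i ∈ χ.fintsupport x, x ∈ W i := fun i hi =>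
    hχ i ((χ.mem_fintsupport_iff x i).1 hi)
  have h1 : JetVanishesAt r (fun z => ∑ i ∈ χ.fintsupport x,
      inChart (n := n) x (χ i) z • inChart (n := n) x (fun y => g i y - g q y) z) (coord x) := by
    refine JetVanishesAt.sum (fun i hi => ?_) fun i hi => ?_
    · exact (hj x hx i q (hmem i hi) hq).bilinear (ContinuousLinearMap.lsmul ℝ ℝ).flip
        ((hgc i (hmem i hi)).sub (hgc q hq)) (hχc i)
    · exact (hχc i).smul ((hgc i (hmem i hi)).sub (hgc q hq))
  refine h1.congr ?_
  filter_upwards [eventually_symm_mem hs (χ.eventually_finsupport_subset x)] with z hz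
  set y := (chartAt (Cn n) x).symm z with hy
  have hz' : χ.finsupport y ⊆ χ.fintsupport x := hz
  change ∑ i ∈ χ.fintsupport x, χ i y • (g i y - g q y) = (∑ᶠ i, χ i y • g i y) - g q y
  have hsum : ∑ i ∈ χ.fintsupport x, χ i y = 1 := by
    rw [← χ.sum_eq_one (Set.mem_univ y)]
    refine (finsum_eq_sum_of_support_subset _ fun i hi => ?_).symm
    exact hz' ((χ.mem_finsupport y).2 hi)
  have hsum' : ∑ᶠ i, χ i y • g i y = ∑ i ∈ χ.fintsupport x, χ i y • g i y := by
    refine finsum_eq_sum_of_support_subset _ fun i hi => ?_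
    refine hz' ((χ.mem_finsupport y).2 ?_)
    exact fun h0 => hi (by simp [h0])
  simp only [smul_sub, Finset.sum_sub_distrib]
  rw [← Finset.sum_smul, hsum, one_smul, hsum']

end Gluing

/-! ### Comparison of local flattenings and of defining functions -/

section Compatibility

variable {n : ℕ} {X : Type*} [TopologicalSpace X] [ChartedSpace (Cn n) X]
  [IsManifold 𝓘(ℂ, Cn n) ω X] {r : ℕ∞} {M U : Set X}

/-- Two flattenings whose real parts are primitives of the same one-form differ by a constant along
`M`, up to order `r`. -/
lemma IsLocalFlattening.jetVanishesAt_fderiv_sub (hr : 2 ≤ r) (hM : IsRealHypersurface n r M)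
    {W W' : Set X} {η : X → Cn n →L[ℝ] ℝ} {f f' : X → ℂ} (hf : IsLocalFlattening n r M W η f)
    (hf' : IsLocalFlattening n r M W' η f') {x : X} (hx : x ∈ M) (hxW : x ∈ W) (hxW' : x ∈ W') :
    JetVanishesAt (r - 1) (fderiv ℝ (inChart (n := n) x fun y => f y - f' y)) (coord x) := by
  have hr1 : 1 ≤ r := le_trans (by norm_num) hr
  obtain ⟨U, ρ, hxU, h⟩ := hM x hx
  obtain ⟨O, hO, hxO, hOt, hOU, hc, h0, hd⟩ := h.exists_inChart hr1 ⟨hx, hxU⟩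
  set e := chartAt (Cn n) x with he
  have hO' : IsOpen (O ∩ (e.target ∩ e.symm ⁻¹' (W ∩ W'))) :=
    hO.inter (e.isOpen_inter_preimage_symm (hf.isOpen.inter hf'.isOpen))
  have hex : e.symm (coord x) = x := e.left_inv (mem_chart_source _ x)
  have hxO' : coord x ∈ O ∩ (e.target ∩ e.symm ⁻¹' (W ∩ W')) :=
    ⟨hxO, hOt hxO, by rw [Set.mem_preimage, hex]; exact ⟨hxW, hxW'⟩⟩
  have hsrc : ∀ z ∈ O, e.symm z ∈ e.source := fun z hz => e.map_target (hOt hz)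
  have hez : ∀ z ∈ O, e (e.symm z) = z := fun z hz => e.right_inv (hOt hz)
  have hcm : ∀ z ∈ O ∩ (e.target ∩ e.symm ⁻¹' (W ∩ W')),
      ContMDiffAt 𝓘(ℝ, Cn n) 𝓘(ℝ, ℂ) (ord r) f (e.symm z) ∧
        ContMDiffAt 𝓘(ℝ, Cn n) 𝓘(ℝ, ℂ) (ord r) f' (e.symm z) := fun z hz =>
    ⟨hf.contMDiffOn.contMDiffAt (hf.isOpen.mem_nhds hz.2.2.1),
      hf'.contMDiffOn.contMDiffAt (hf'.isOpen.mem_nhds hz.2.2.2)⟩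
  have hcd : ∀ z ∈ O ∩ (e.target ∩ e.symm ⁻¹' (W ∩ W')),
      ContDiffAt ℝ (ord r) (inChart (n := n) x f) z ∧
        ContDiffAt ℝ (ord r) (inChart (n := n) x f') z := fun z hz => by
    have h1 := (contMDiffAt_iff_inChart (hsrc z hz.1)).1 (hcm z hz).1
    have h2 := (contMDiffAt_iff_inChart (hsrc z hz.1)).1 (hcm z hz).2
    rw [hez z hz.1] at h1 h2
    exact ⟨h1, h2⟩
  refine jetVanishesAt_fderiv_of_tangent hr1 hO' (hc.mono Set.inter_subset_left)
    (fun z hz _ => hd z hz.1)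
    (fun z hz => ((hcd z hz).1.sub (hcd z hz).2).contDiffWithinAt) ?_ ?_ _ hxO'
    ((h0 _ hxO).2 (by rw [hex]; exact hx))
  · intro z hz hz0 ξ hξ
    have hyM : e.symm z ∈ M := (h0 z hz.1).1 hz0
    have hd1 : DifferentiableAt ℝ (inChart (n := n) x fun y => f y - f' y) z :=
      ((hcd z hz).1.sub (hcd z hz).2).differentiableAt (ord_ne_zero hr1)
    apply Complex.ext
    · set y := e.symm z with hy
      have hT := (h.fderiv_coordChange_mem_tangentSpace_iff hr1 (x := y) (p := x) (ξ := ξ)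
        ⟨hyM, hOU z hz.1⟩ (hsrc z hz.1))
      rw [← he, hez z hz.1] at hT
      have hre : ∀ {k : X → ℂ}, ContMDiffAt 𝓘(ℝ, Cn n) 𝓘(ℝ, ℂ) (ord r) k y →
          (fderiv ℝ (inChart (n := n) x k) z ξ).re =
            fderiv ℝ (inChart (n := n) y fun t => (k t).re) (coord y)
              (fderiv ℝ (coordChange x y) z ξ) := by
        intro k hk
        have hs := mem_chart_source (Cn n) y
        have hk' := (contMDiffAt_iff_inChart hs).1 hk
        have hkd := hk'.differentiableAt (ord_ne_zero hr1)
        have e1 := fderiv_inChart_eq_comp (hsrc z hz.1) hs hkd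
        rw [← he, hez z hz.1] at e1
        rw [e1]
        have e2 : fderiv ℝ (inChart (n := n) y fun t => (k t).re) (coord y) =
            Complex.reCLM.comp (fderiv ℝ (inChart (n := n) y k) (coord y)) :=
          (Complex.reCLM.hasFDerivAt.comp _ hkd.hasFDerivAt).fderiv
        rw [e2]
        rfl
      have e3 : fderiv ℝ (fun a => inChart (n := n) x f a - inChart (n := n) x f' a) z =
          fderiv ℝ (inChart (n := n) x f) z - fderiv ℝ (inChart (n := n) x f') z :=
        fderiv_fun_sub ((hcd z hz).1.differentiableAt (ord_ne_zero hr1))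
          ((hcd z hz).2.differentiableAt (ord_ne_zero hr1))
      rw [e3, _root_.sub_apply, Complex.sub_re, hre (hcm z hz).1, hre (hcm z hz).2,
        hf.fderiv_re y ⟨hyM, hz.2.2.1⟩ _ (hT.2 hξ), hf'.fderiv_re y ⟨hyM, hz.2.2.2⟩ _ (hT.2 hξ),
        sub_self]
      rfl
    · have h1 : HasFDerivAt (fun z => (inChart (n := n) x (fun y => f y - f' y) z).im) _ z :=
        Complex.imCLM.hasFDerivAt.comp z hd1.hasFDerivAt
      have h2 := fderiv_eq_zero_of_tangent hr1 hO hz.1 hc hz0 (hd z hz.1) h1.differentiableAt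
        (by
          filter_upwards [hO'.mem_nhds hz] with t ht ht0
          have htM := (h0 t ht.1).1 ht0
          change (f (e.symm t) - f' (e.symm t)).im = 0
          rw [Complex.sub_im, hf.im_eq_zero _ ⟨htM, ht.2.2.1⟩, hf'.im_eq_zero _ ⟨htM, ht.2.2.2⟩,
            sub_zero]) hξ
      rw [h1.fderiv] at h2
      exact h2
  · intro z hz hz0 v
    have hyM : e.symm z ∈ M := (h0 z hz.1).1 hz0
    have hs := mem_chart_source (Cn n) (e.symm z)
    have h1 := JetVanishesAt.dbar_inChart hr1 (hsrc z hz.1) hs (hcm z hz).1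
      (hf.dbar _ ⟨hyM, hz.2.2.1⟩)
    have h2 := JetVanishesAt.dbar_inChart hr1 (hsrc z hz.1) hs (hcm z hz).2
      (hf'.dbar _ ⟨hyM, hz.2.2.2⟩)
    rw [← he, hez z hz.1] at h1 h2
    have hle : r - 1 + 1 = r := tsub_add_cancel_of_le hr1
    have h3 := (jetVanishesAt_dbar_iff (by rw [hle]; exact (hcd z hz).1)).1 h1 v
    have h4 := (jetVanishesAt_dbar_iff (by rw [hle]; exact (hcd z hz).2)).1 h2 v
    have hcv : ∀ {k : Cn n → ℂ}, ContDiffAt ℝ (ord r) k z → ContDiffAt ℝ (ord (r - 1))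
        (fun t => fderiv ℝ k t (Complex.I • v) - Complex.I • fderiv ℝ k t v) z := fun hk => by
      have := ContDiffAt.fderiv_ord hk hr1
      exact (this.clm_apply contDiffAt_const).sub
        ((this.clm_apply contDiffAt_const).const_smul Complex.I)
    refine (h3.sub h4 (hcv (hcd z hz).1) (hcv (hcd z hz).2)).congr ?_
    filter_upwards [hO'.mem_nhds hz] with t ht
    have e3 : fderiv ℝ (fun a => inChart (n := n) x f a - inChart (n := n) x f' a) t =
        fderiv ℝ (inChart (n := n) x f) t - fderiv ℝ (inChart (n := n) x f') t :=
      fderiv_fun_sub ((hcd t ht).1.differentiableAt (ord_ne_zero hr1))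
        ((hcd t ht).2.differentiableAt (ord_ne_zero hr1))
    rw [e3, _root_.sub_apply, _root_.sub_apply, smul_sub]
    simp only [smul_eq_mul]
    ring

/-- A function which vanishes on a hypersurface with nonzero differential has, near each point,
the sign of a defining function or the opposite one. -/
lemma IsLocalDefiningFunction.eventually_sign_eq_or (hr : 1 ≤ r) {ρ v : X → ℝ} {W : Set X}
    (h : IsLocalDefiningFunction n r M U ρ) {x : X} (hx : x ∈ M ∩ U) (hW : IsOpen W) (hxW : x ∈ W)
    (hv : ContMDiffOn 𝓘(ℝ, Cn n) 𝓘(ℝ, ℝ) (ord r) v W) (h0 : ∀ y ∈ M ∩ W, v y = 0)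
    (hd : fderiv ℝ (inChart (n := n) x v) (coord x) ≠ 0) :
    (∀ᶠ y in 𝓝 x, SignType.sign (v y) = SignType.sign (ρ y)) ∨
      ∀ᶠ y in 𝓝 x, SignType.sign (v y) = -SignType.sign (ρ y) := by
  obtain ⟨O, hO, hxO, hOt, hOU, hc, h0', hd'⟩ := h.exists_inChart hr hx
  set e := chartAt (Cn n) x with he
  have hs := mem_chart_source (Cn n) x
  have hex : e.symm (coord x) = x := e.left_inv hs
  have htr : ∀ {P : X → Prop}, (∀ᶠ z in 𝓝 (coord x), P (e.symm z)) → ∀ᶠ y in 𝓝 x, P y := by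
    intro P hP
    filter_upwards [(e.continuousAt hs).preimage_mem_nhds hP, e.open_source.mem_nhds hs]
      with y hy hy'
    have : P (e.symm (e y)) := hy
    rwa [e.left_inv hy'] at this
  refine Or.imp htr htr (LeviFlat.eventually_sign_eq_or hr hO hxO hc
    ((h0' _ hxO).2 (by rw [hex]; exact hx.1)) (hd' _ hxO)
    ((contMDiffAt_iff_inChart hs).1 (hv.contMDiffAt (hW.mem_nhds hxW))) ?_ hd)
  filter_upwards [hO.mem_nhds hxO, eventually_symm_mem hs (hW.mem_nhds hxW)] with z hz hzW hz0
  exact h0 _ ⟨(h0' z hz).1 hz0, hzW⟩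

end Compatibility

/-! ### Monodromy on a simply connected space -/

section Monodromy

/-- On a simply connected and locally path connected space, local functions whose differences are
locally constant come from a global function. It is a section of the covering space
whose sheets are the local functions up to constants. -/
theorem exists_sub_locallyConstant {B A ι : Type*} [TopologicalSpace B] [SimplyConnectedSpace B]
    [LocallyPathConnectedSpace B] [AddCommGroup A] {W : ι → Set B} (hW : ∀ i, IsOpen (W i))
    (hcov : ∀ x, ∃ i, x ∈ W i) {u : ι → B → A}
    (hu : ∀ i j, ∀ x ∈ W i ∩ W j, ∀ᶠ y in 𝓝 x, u i y - u j y = u i x - u j x) :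
    ∃ U : B → A, ∀ i, ∀ x ∈ W i, ∀ᶠ y in 𝓝 x, U y - u i y = U x - u i x := by
  let _ : TopologicalSpace A := ⊥
  have : DiscreteTopology A := ⟨rfl⟩
  choose idx hidx using hcov
  let Z : FiberBundleCore ι B A :=
    { baseSet := W
      isOpen_baseSet := hW
      indexAt := idx
      mem_baseSet_at := hidx
      coordChange := fun i j x v => v + (u i x - u j x)
      coordChange_self := fun i x _ v => by simp
      continuousOn_coordChange := fun i j => by
        rintro ⟨x, v⟩ ⟨hx, -⟩
        refine ContinuousAt.continuousWithinAt ?_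
        refine continuousAt_snd.add (tendsto_const_nhds.congr' ?_)
        exact ((hu i j x hx).mono fun y hy => hy.symm).filter_mono
          (continuousAt_fst (p := (x, v)))
      coordChange_comp := fun i j k x _ v => by abel }
  obtain ⟨b⟩ : Nonempty B := inferInstance
  have hcovering : IsCoveringMap (Bundle.TotalSpace.proj : Z.TotalSpace → B) :=
    FiberBundle.isCoveringMap (F := A) (E := Z.Fiber)
  obtain ⟨s, ⟨-, hs⟩, -⟩ := hcovering.existsUnique_continuousMap_lifts (ContinuousMap.id B) b
    (⟨b, (0 : A)⟩ : Z.TotalSpace) rfl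
  have hs' : ∀ x, (s x).1 = x := fun x => congrFun hs x
  let a : B → A := fun x => (s x).2
  refine ⟨fun x => a x + u (idx x) x, fun i x hx => ?_⟩
  have hc : ContinuousAt (fun y => (Z.localTriv i (s y)).2) x := by
    have h1 : ContinuousAt (Z.localTriv i) (s x) :=
      (Z.localTriv i).toOpenPartialHomeomorph.continuousAt
        ((Z.mem_localTriv_source i _).2 (by rw [hs']; exact hx))
    exact (h1.comp s.continuous.continuousAt).snd
  have heq : ∀ y, (Z.localTriv i (s y)).2 = a y + u (idx y) y - u i y := by
    intro y
    rw [Z.localTriv_apply]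
    change a y + (u (idx (s y).1) (s y).1 - u i (s y).1) = _
    rw [hs', add_sub_assoc]
  have h2 : ∀ᶠ y in 𝓝 x, (Z.localTriv i (s y)).2 = (Z.localTriv i (s x)).2 :=
    hc ((isOpen_discrete {(Z.localTriv i (s x)).2}).mem_nhds rfl)
  filter_upwards [h2] with y hy
  rw [heq, heq] at hy
  exact hy

end Monodromy

/-! ### Local topology of a hypersurface -/

section LocalTopology

variable {n : ℕ} {X : Type*} [TopologicalSpace X] [ChartedSpace (Cn n) X]
  [IsManifold 𝓘(ℂ, Cn n) ω X] {r : ℕ∞} {M : Set X}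

/-- Arbitrarily small pieces of a hypersurface are parametrized by balls. -/
lemma IsRealHypersurface.exists_ball_parametrization (hr : 1 ≤ r) (hM : IsRealHypersurface n r M)
    {x : X} (hx : x ∈ M) {S : Set X} (hS : S ∈ 𝓝 x) :
    ∃ (c : Rn (2 * n - 1)) (ε : ℝ) (φ : Rn (2 * n - 1) → X), 0 < ε ∧
      IsLocalParametrization n r M (Metric.ball c ε) φ ∧ φ '' Metric.ball c ε ⊆ S ∧
      ∀ᶠ y in 𝓝[M] x, y ∈ φ '' Metric.ball c ε := by
  obtain ⟨U, ρ, hxU, h⟩ := hM x hx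
  obtain ⟨O, Q, ε, φ, hO, hxO, hOt, hOU, hc, h0, hd, hε, hφ, hQ, hφQ⟩ :=
    h.exists_parametrization hr ⟨hx, hxU⟩
  set e := chartAt (Cn n) x with he
  have hs := mem_chart_source (Cn n) x
  have hex : e.symm (coord x) = x := e.left_inv hs
  have hφx : φ (Q (coord x)) = x :=
    (hφQ _ hxO ((h0 _ hxO).2 (by rw [hex]; exact hx))).1.trans hex
  have hcont : ContinuousAt φ (Q (coord x)) :=
    (hφ.contMDiffOn.contMDiffAt (Metric.ball_mem_nhds _ hε)).continuousAt
  obtain ⟨δ, hδ, hδS⟩ := Metric.mem_nhds_iff.1 (hcont (by rw [hφx]; exact hS))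
  have hsub : Metric.ball (Q (coord x)) (min ε δ) ⊆ Metric.ball (Q (coord x)) ε :=
    Metric.ball_subset_ball (min_le_left _ _)
  refine ⟨Q (coord x), min ε δ, φ, lt_min hε hδ, ⟨Metric.isOpen_ball, hφ.contMDiffOn.mono hsub,
    fun s hs => hφ.mapsTo s (hsub hs), fun s hs => hφ.injective s (hsub hs)⟩, ?_, ?_⟩
  · rintro _ ⟨s, hs, rfl⟩
    exact hδS (Metric.ball_subset_ball (min_le_right _ _) hs)
  · have h1 : O ∩ Q ⁻¹' Metric.ball (Q (coord x)) (min ε δ) ∈ 𝓝 (coord x) :=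
      inter_mem (hO.mem_nhds hxO)
        (Q.continuous.continuousAt (Metric.ball_mem_nhds _ (lt_min hε hδ)))
    filter_upwards [self_mem_nhdsWithin, nhdsWithin_le_nhds ((e.continuousAt hs) h1),
      nhdsWithin_le_nhds (e.open_source.mem_nhds hs)] with y hyM hy hys
    have hy1 : e.symm (e y) = y := e.left_inv hys
    exact ⟨Q (e y), hy.2, ((hφQ _ hy.1 ((h0 _ hy.1).2 (by rw [hy1]; exact hyM))).1.trans hy1)⟩

lemma IsRealHypersurface.locallyPathConnectedSpace (hr : 1 ≤ r) (hM : IsRealHypersurface n r M) :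
    LocallyPathConnectedSpace M := by
  refine ⟨fun x => ⟨fun t => ⟨fun ht => ?_, fun ⟨s, hs, hst⟩ => mem_of_superset hs.1 hst⟩⟩⟩
  obtain ⟨S, hS, hSt⟩ := (mem_nhds_subtype _ _ _).1 ht
  obtain ⟨c, ε, φ, hε, hφ, hφS, hφM⟩ := hM.exists_ball_parametrization hr x.2 hS
  have hpc : IsPathConnected (φ '' Metric.ball c ε) :=
    ((convex_ball c ε).isPathConnected ⟨c, Metric.mem_ball_self hε⟩).image'
      (hφ.contMDiffOn.continuousOn)
  refine ⟨((↑) : M → X) ⁻¹' (φ '' Metric.ball c ε), ⟨?_, hpc.preimage_coe ?_⟩, ?_⟩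
  · rw [nhds_subtype_eq_comap_nhdsWithin]
    exact preimage_mem_comap hφM
  · rintro _ ⟨s, hs, rfl⟩
    exact hφ.mapsTo s hs
  · exact fun y hy => hSt (hφS hy)

/-- A function whose differential vanishes at the points of a hypersurface is locally constant
on the hypersurface. -/
lemma IsRealHypersurface.eventually_eq_of_fderiv_eq_zero (hr : 1 ≤ r)
    (hM : IsRealHypersurface n r M) {E : Type*} [NormedAddCommGroup E] [NormedSpace ℝ E]
    {W : Set X} (hW : IsOpen W) {k : X → E} (hk : ContMDiffOn 𝓘(ℝ, Cn n) 𝓘(ℝ, E) (ord r) k W)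
    (hd : ∀ y ∈ M ∩ W, fderiv ℝ (inChart (n := n) y k) (coord y) = 0) {x : X} (hx : x ∈ M ∩ W) :
    ∀ᶠ y in 𝓝[M] x, k y = k x := by
  obtain ⟨c, ε, φ, hε, hφ, hφS, hφM⟩ :=
    hM.exists_ball_parametrization hr hx.1 (hW.mem_nhds hx.2)
  have hder : ∀ s ∈ Metric.ball c ε, HasFDerivAt (fun t => k (φ t)) (0 : _ →L[ℝ] E) s := by
    intro s hs
    have hsrc := mem_chart_source (Cn n) (φ s)
    have hφs := hφ.contMDiffOn.contMDiffAt (Metric.isOpen_ball.mem_nhds hs)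
    have hyW : φ s ∈ M ∩ W := ⟨hφ.mapsTo s hs, hφS ⟨s, hs, rfl⟩⟩
    have h1 := ((contMDiffAt_iff_inChart hsrc).1
      (hk.contMDiffAt (hW.mem_nhds hyW.2))).differentiableAt (ord_ne_zero hr)
    have h2 := ((ContMDiffAt.contDiffAt_chart hφs hsrc).differentiableAt
      (ord_ne_zero hr)).hasFDerivAt
    have h3 := (hd _ hyW) ▸ h1.hasFDerivAt
    have h4 := HasFDerivAt.comp s h3 h2
    rw [ContinuousLinearMap.zero_comp] at h4
    refine h4.congr_of_eventuallyEq ?_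
    filter_upwards [hφs.continuousAt.preimage_mem_nhds
      ((chartAt (Cn n) (φ s)).open_source.mem_nhds hsrc)] with t ht
    simp [inChart, (chartAt (Cn n) (φ s)).left_inv ht]
  have hconst : ∀ s ∈ Metric.ball c ε, ∀ t ∈ Metric.ball c ε, k (φ s) = k (φ t) :=
    fun s hs t ht => (convex_ball c ε).is_const_of_fderivWithin_eq_zero (𝕜 := ℝ)
      (f := fun t => k (φ t))
      (fun s hs => (hder s hs).differentiableAt.differentiableWithinAt)
      (fun s hs => by rw [fderivWithin_of_isOpen Metric.isOpen_ball hs, (hder s hs).fderiv]) hs ht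
  obtain ⟨s, hs, hsx⟩ := hφM.self_of_nhdsWithin hx.1
  filter_upwards [hφM] with y ⟨t, ht, hty⟩
  rw [← hsx, ← hty]
  exact hconst t ht s hs

end LocalTopology

/-! ### Families of flattenings -/

section Jets

lemma JetVanishesAt.sub_const {r : ℕ∞} (hr : 1 ≤ r) {V W : Type*} [NormedAddCommGroup V]
    [NormedSpace ℝ V] [NormedAddCommGroup W] [NormedSpace ℝ W] {g : V → W} {z : V}
    (h : JetVanishesAt (r - 1) (fderiv ℝ g) z) : JetVanishesAt r (fun x => g x - g z) z := by
  refine (JetVanishesAt.fderiv_sub_one hr).2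
    ⟨sub_self _, h.congr (Eventually.of_forall fun x => ?_)⟩
  rw [fderiv_sub_const]

variable {n : ℕ} {r : ℕ∞}

/-- Functions with the same `r`-jet have `∂̄` with the same `(r - 1)`-jet. -/
lemma JetVanishesAt.dbar_of_sub (hr : 1 ≤ r) {w w' : Cn n → ℂ} {z : Cn n}
    (hw : ContDiffAt ℝ (ord r) w z) (hw' : ContDiffAt ℝ (ord r) w' z)
    (h : JetVanishesAt (r - 1) (fderiv ℝ fun x => w x - w' x) z)
    (hv : JetVanishesAt (r - 1) (dbar w') z) : JetVanishesAt (r - 1) (dbar w) z := by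
  set B : (Cn n →L[ℝ] ℂ) →L[ℝ] Cn n →L[ℝ] ℂ := (1 / 2 : ℝ) • (ContinuousLinearMap.id ℝ _ +
    (ContinuousLinearMap.compL ℝ (Cn n) ℂ ℂ (Complex.I • ContinuousLinearMap.id ℝ ℂ)).comp
      ((ContinuousLinearMap.compL ℝ (Cn n) (Cn n) ℂ).flip (J n))) with hB
  have hd := ContDiffAt.fderiv_ord (hw.sub hw') hr
  refine (hv.add (h.clm_comp B hd) (ContDiffAt.dbar hr hw')
    (B.contDiff.contDiffAt.comp z hd)).congr ?_
  have h1 : (1 : WithTop ℕ∞) ≤ ord r := WithTop.coe_le_coe.2 hr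
  filter_upwards [(hw.of_le h1).eventually (by simp), (hw'.of_le h1).eventually (by simp)]
    with y hy hy'
  rw [fderiv_fun_sub (hy.differentiableAt one_ne_zero) (hy'.differentiableAt one_ne_zero)]
  ext v
  change dbar w' y v + (1 / 2 : ℝ) • (_ + Complex.I * _) = dbar w y v
  rw [dbar_apply, dbar_apply]
  change _ + (1 / 2 : ℝ) • ((fderiv ℝ w y v - fderiv ℝ w' y v) +
    Complex.I * (fderiv ℝ w y (Complex.I • v) - fderiv ℝ w' y (Complex.I • v))) = _
  simp only [smul_eq_mul, Complex.real_smul]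
  ring

end Jets

section Family

variable {n : ℕ} {X : Type*} [TopologicalSpace X] [ChartedSpace (Cn n) X]

variable (n) in
/-- A family of flattenings `f p` of `M`, on open neighbourhoods `W p` of the points `p` of `M`,
which differ from each other by constants along `M`, up to order `r`. -/
structure IsFlatteningFamily (r : ℕ∞) (M : Set X) (W : M → Set X) (f : M → X → ℂ) : Prop where
  isOpen : ∀ p, IsOpen (W p)
  mem_self : ∀ p : M, (p : X) ∈ W p
  contMDiffOn : ∀ p, ContMDiffOn 𝓘(ℝ, Cn n) 𝓘(ℝ, ℂ) (ord r) (f p) (W p)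
  im_eq_zero : ∀ p, ∀ x ∈ M ∩ W p, (f p x).im = 0
  fderiv_im_ne_zero : ∀ p, ∀ x ∈ M ∩ W p,
    fderiv ℝ (inChart (n := n) x fun y => (f p y).im) (coord x) ≠ 0
  dbar : ∀ p, ∀ x ∈ M ∩ W p, JetVanishesAt (r - 1) (dbar (inChart (n := n) x (f p))) (coord x)
  compat : ∀ p q, ∀ x ∈ M, x ∈ W p → x ∈ W q →
    JetVanishesAt (r - 1) (fderiv ℝ (inChart (n := n) x fun y => f p y - f q y)) (coord x)

variable {r : ℕ∞} {M : Set X} {W : M → Set X} {f : M → X → ℂ}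

namespace IsFlatteningFamily

lemma contMDiffOn_im (hF : IsFlatteningFamily n r M W f) (p : M) :
    ContMDiffOn 𝓘(ℝ, Cn n) 𝓘(ℝ, ℝ) (ord r) (fun y => (f p y).im) (W p) :=
  Complex.imCLM.contMDiff.comp_contMDiffOn (hF.contMDiffOn p)

/-- The domains of a family of flattenings may be shrunk, and real constants added to them. -/
lemma add_const (hF : IsFlatteningFamily n r M W f) {W' : M → Set X} (hW' : ∀ p, IsOpen (W' p))
    (hself : ∀ p : M, (p : X) ∈ W' p) (hsub : ∀ p, W' p ⊆ W p) (c : M → ℝ) :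
    IsFlatteningFamily n r M W' fun p x => f p x + c p := by
  have hd : ∀ (p : M) (x : X), x ∈ W p → fderiv ℝ (inChart (n := n) x fun y => f p y + c p) =
      fderiv ℝ (inChart (n := n) x (f p)) := fun p x _ => by
    funext z
    exact fderiv_add_const (c p : ℂ)
  refine ⟨hW', hself, fun p => ((hF.contMDiffOn p).mono (hsub p)).add contMDiffOn_const,
    fun p x hx => ?_, fun p x hx => ?_, fun p x hx => ?_, fun p q x hx hp hq => ?_⟩
  · simpa using hF.im_eq_zero p x ⟨hx.1, hsub p hx.2⟩
  · simpa using hF.fderiv_im_ne_zero p x ⟨hx.1, hsub p hx.2⟩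
  · have h1 := hF.dbar p x ⟨hx.1, hsub p hx.2⟩
    unfold LeviFlat.dbar at h1 ⊢
    rwa [hd p x (hsub p hx.2)]
  · refine (hF.compat p q x hx (hsub p hp) (hsub q hq)).congr (Eventually.of_forall fun z => ?_)
    have e : (inChart (n := n) x fun y => f p y + c p - (f q y + c q)) =
        fun z => inChart (n := n) x (fun y => f p y - f q y) z + ((c p : ℂ) - c q) := by
      funext z
      simp only [inChart, Function.comp_apply]
      ring
    rw [e, fderiv_add_const]

end IsFlatteningFamily

variable [IsManifold 𝓘(ℂ, Cn n) ω X]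

/-- A hypersurface whose Levi foliation is defined by a closed one-form `η` has a family of
flattenings: their real parts are local primitives of `η` on the hypersurface. -/
theorem exists_isFlatteningFamily (hr : 2 ≤ r) (hM : IsRealHypersurface n r M)
    (h : LeviFoliationDefinedByClosedForm n r M) :
    ∃ (W : M → Set X) (f : M → X → ℂ), IsFlatteningFamily n r M W f := by
  obtain ⟨η, hη, hη'⟩ := h
  have key : ∀ p : M, ∃ (W : Set X) (f : X → ℂ), (p : X) ∈ W ∧ IsLocalFlattening n r M W η f := by
    intro p
    obtain ⟨U, ρ, hpU, hρ⟩ := hM p p.2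
    exact exists_isLocalFlattening hr hρ ⟨p.2, hpU⟩ hη hη'
  choose W f hpW hf using key
  exact ⟨W, f, fun p => (hf p).isOpen, hpW, fun p => (hf p).contMDiffOn, fun p => (hf p).im_eq_zero,
    fun p => (hf p).fderiv_im_ne_zero, fun p => (hf p).dbar,
    fun p q x hx hp hq => (hf p).jetVanishesAt_fderiv_sub hr hM (hf q) hx hp hq⟩

namespace IsFlatteningFamily

lemma contDiffAt_inChart (hF : IsFlatteningFamily n r M W f) (p : M) {x : X} (hx : x ∈ W p) :
    ContDiffAt ℝ (ord r) (inChart (n := n) x (f p)) (coord x) :=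
  (contMDiffAt_iff_inChart (mem_chart_source _ x)).1
    ((hF.contMDiffOn p).contMDiffAt ((hF.isOpen p).mem_nhds hx))

/-- On a simply connected hypersurface the flattenings can be chosen so that they agree on the
hypersurface. -/
theorem exists_eq (hr : 1 ≤ r) (hM : IsRealHypersurface n r M) [SimplyConnectedSpace M]
    (hF : IsFlatteningFamily n r M W f) :
    ∃ (W' : M → Set X) (c : M → ℝ), (∀ p, W' p ⊆ W p) ∧
      IsFlatteningFamily n r M W' (fun p x => f p x + c p) ∧
      ∀ p q, ∀ x ∈ M, x ∈ W' p → x ∈ W' q → f p x + c p = f q x + c q := by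
  have := hM.locallyPathConnectedSpace hr
  have hu : ∀ p q : M, ∀ x ∈ ((↑) : M → X) ⁻¹' W p ∩ ((↑) : M → X) ⁻¹' W q,
      ∀ᶠ y : M in 𝓝 x, (f p y).re - (f q y).re = (f p x).re - (f q x).re := by
    intro p q x hx
    have h1 := hM.eventually_eq_of_fderiv_eq_zero hr ((hF.isOpen p).inter (hF.isOpen q))
      (k := fun y => f p y - f q y)
      (((hF.contMDiffOn p).mono Set.inter_subset_left).sub
        ((hF.contMDiffOn q).mono Set.inter_subset_right))
      (fun y hy => (hF.compat p q y hy.1 hy.2.1 hy.2.2).apply_eq_zero) ⟨x.2, hx⟩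
    rw [eventually_nhds_subtype_iff M x
      fun y : X => (f p y).re - (f q y).re = (f p x).re - (f q x).re]
    filter_upwards [h1] with y hy
    simpa using congrArg Complex.re hy
  obtain ⟨U, hU⟩ := exists_sub_locallyConstant
    (fun p => (hF.isOpen p).preimage continuous_subtype_val) (fun x => ⟨x, hF.mem_self x⟩)
    (u := fun (p : M) (y : M) => (f p y).re) hu
  have hS : ∀ p : M, ∃ S : Set X, IsOpen S ∧ (p : X) ∈ S ∧
      ∀ y : M, (y : X) ∈ S → U y - (f p y).re = U p - (f p p).re := by
    intro p
    obtain ⟨S, hS, hSt⟩ := (mem_nhds_subtype _ _ _).1 (hU p p (hF.mem_self p))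
    obtain ⟨S', hS'S, hS'o, hpS'⟩ := mem_nhds_iff.1 hS
    exact ⟨S', hS'o, hpS', fun y hy => hSt (hS'S hy)⟩
  choose S hSo hpS hS using hS
  refine ⟨fun p => W p ∩ S p, fun p => U p - (f p p).re, fun p => Set.inter_subset_left,
    hF.add_const (fun p => (hF.isOpen p).inter (hSo p)) (fun p => ⟨hF.mem_self p, hpS p⟩)
      (fun p => Set.inter_subset_left) _, fun p q x hx hp hq => ?_⟩
  have h1 := hS p ⟨x, hx⟩ hp.2
  have h2 := hS q ⟨x, hx⟩ hq.2
  apply Complex.ext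
  · simp only [Complex.add_re, Complex.ofReal_re]
    linarith
  · simp [hF.im_eq_zero p x ⟨hx, hp.1⟩, hF.im_eq_zero q x ⟨hx, hq.1⟩]

end IsFlatteningFamily

end Family

/-! ### Signs of the flattenings -/

section Sign

/-- Two functions of one variable with the same sign near a common zero cannot have derivatives of
opposite signs. -/
lemma not_hasDerivAt_neg_of_sign_eq {A B : ℝ → ℝ} {a : ℝ} (hA : HasDerivAt A a 0)
    (hB : HasDerivAt B (-a) 0) (hA0 : A 0 = 0) (hB0 : B 0 = 0) (ha : a ≠ 0)
    (h : ∀ᶠ t in 𝓝 0, SignType.sign (A t) = SignType.sign (B t)) : False := by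
  have h1 := (hasDerivAt_iff_tendsto_slope.1 hA).mul (hasDerivAt_iff_tendsto_slope.1 hB)
  have h2 : 0 ≤ a * -a := by
    refine ge_of_tendsto h1 ?_
    filter_upwards [nhdsWithin_le_nhds h] with t ht
    simp only [slope, vsub_eq_sub, hA0, hB0, sub_zero, smul_eq_mul]
    have h3 : 0 ≤ A t * B t := by
      rcases lt_trichotomy (A t) 0 with h4 | h4 | h4
      · have : B t < 0 := sign_eq_neg_one_iff.1 (by rw [← ht, sign_neg h4])
        exact (mul_pos_of_neg_of_neg h4 this).le
      · simp [h4]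
      · have : 0 < B t := sign_eq_one_iff.1 (by rw [← ht, sign_pos h4])
        exact (mul_pos h4 this).le
    calc (0 : ℝ) ≤ t⁻¹ ^ 2 * (A t * B t) := by positivity
      _ = _ := by ring
  nlinarith [sq_pos_of_ne_zero ha]

variable {n : ℕ} {X : Type*} [TopologicalSpace X] [ChartedSpace (Cn n) X]
  [IsManifold 𝓘(ℂ, Cn n) ω X] {r : ℕ∞} {M : Set X} {W : M → Set X} {f : M → X → ℂ}

/-- If `M` has a global defining function `ρ`, then the flattenings can be chosen with imaginary
parts of the same sign as `ρ`. -/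
theorem IsFlatteningFamily.exists_sign_eq (hr : 1 ≤ r) (hF : IsFlatteningFamily n r M W f)
    {ρ : X → ℝ} (hρ : IsDefiningFunction n r M Set.univ ρ) :
    ∃ (W' : M → Set X) (f' : M → X → ℂ), IsFlatteningFamily n r M W' f' ∧
      ∀ p, ∀ y ∈ W' p, SignType.sign (f' p y).im = SignType.sign (ρ y) := by
  have key : ∀ p : M, ∃ (a : ℝ) (S : Set X), (a = 1 ∨ a = -1) ∧ IsOpen S ∧ (p : X) ∈ S ∧
      ∀ y ∈ S, SignType.sign (a * (f p y).im) = SignType.sign (ρ y) := by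
    intro p
    rcases hρ.isLocal.eventually_sign_eq_or hr ⟨p.2, Set.mem_univ _⟩ (hF.isOpen p) (hF.mem_self p)
      (hF.contMDiffOn_im p) (hF.im_eq_zero p) (hF.fderiv_im_ne_zero p p ⟨p.2, hF.mem_self p⟩)
      with h | h
    · obtain ⟨S, hS, hSo, hpS⟩ := mem_nhds_iff.1 h
      exact ⟨1, S, Or.inl rfl, hSo, hpS, fun y hy => by rw [one_mul]; exact hS hy⟩
    · obtain ⟨S, hS, hSo, hpS⟩ := mem_nhds_iff.1 h
      refine ⟨-1, S, Or.inr rfl, hSo, hpS, fun y hy => ?_⟩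
      have : SignType.sign (f p y).im = -SignType.sign (ρ y) := hS hy
      rw [neg_one_mul, Left.sign_neg, this, neg_neg]
  choose a S ha hSo hpS hS using key
  have ha0 : ∀ p, a p ≠ 0 := fun p => by rcases ha p with h | h <;> rw [h] <;> norm_num
  -- Multiplication by the real number `a p`, as an operator on values.
  let L : M → ℂ →L[ℝ] ℂ := fun p => a p • ContinuousLinearMap.id ℝ ℂ
  have him : ∀ p, ∀ x ∈ W p, ∀ v, fderiv ℝ (inChart (n := n) x fun y => (f p y).im) (coord x) v =
      (fderiv ℝ (inChart (n := n) x (f p)) (coord x) v).im := by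
    intro p x hx v
    have h1 : HasFDerivAt (inChart (n := n) x fun y => (f p y).im) _ (coord x) :=
      Complex.imCLM.hasFDerivAt.comp (coord x)
        ((hF.contDiffAt_inChart p hx).differentiableAt (ord_ne_zero hr)).hasFDerivAt
    rw [h1.fderiv]
    rfl
  have hcoordx : ∀ x : X, (chartAt (Cn n) x).symm (coord x) = x := fun x =>
    (chartAt (Cn n) x).left_inv (mem_chart_source _ x)
  have hinx : ∀ (k : X → ℂ) (x : X), inChart (n := n) x k (coord x) = k x := fun k x =>
    congrArg k (hcoordx x)
  -- At a common point of `M`, the signs of the flattenings agree, since the flattenings have there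
  -- the same nonzero derivative.
  have hsame : ∀ p q, ∀ x ∈ M, x ∈ W p ∩ S p → x ∈ W q ∩ S q → a p = a q := by
    intro p q x hx hp hq
    by_contra hne
    have hneg : a q = -a p := by
      rcases ha p with h | h <;> rcases ha q with h' | h' <;>
        simp [h, h'] at hne ⊢
    have hfd := (hF.compat p q x hx hp.1 hq.1).apply_eq_zero
    have hfd' : fderiv ℝ (inChart (n := n) x (f p)) (coord x) =
        fderiv ℝ (inChart (n := n) x (f q)) (coord x) := by
      have h1 : fderiv ℝ (inChart (n := n) x fun y => f p y - f q y) (coord x) = _ :=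
        fderiv_fun_sub ((hF.contDiffAt_inChart p hp.1).differentiableAt (ord_ne_zero hr))
          ((hF.contDiffAt_inChart q hq.1).differentiableAt (ord_ne_zero hr))
      rw [hfd] at h1
      exact sub_eq_zero.1 h1.symm
    obtain ⟨v, hv⟩ : ∃ v, (fderiv ℝ (inChart (n := n) x (f p)) (coord x) v).im ≠ 0 := by
      by_contra! hall
      exact hF.fderiv_im_ne_zero p x ⟨hx, hp.1⟩
        (ContinuousLinearMap.ext fun v => (him p x hp.1 v).trans (hall v))
    have hline : HasDerivAt (fun t : ℝ => coord (n := n) x + t • v) v 0 := by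
      simpa using ((hasDerivAt_id (0 : ℝ)).smul_const v).const_add (coord (n := n) x)
    have hdl : ∀ s : M, x ∈ W s → HasDerivAt
        (fun t : ℝ => a s * (inChart (n := n) x (f s) (coord x + t • v)).im)
        (a s * (fderiv ℝ (inChart (n := n) x (f s)) (coord x) v).im) 0 := by
      intro s hs
      have h1 := (((hF.contDiffAt_inChart s hs).differentiableAt (ord_ne_zero hr)).hasFDerivAt)
      have h2 : HasFDerivAt (inChart (n := n) x (f s))
          (fderiv ℝ (inChart (n := n) x (f s)) (coord x)) (coord (n := n) x + (0 : ℝ) • v) := by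
        rw [zero_smul, add_zero]; exact h1
      have h3 := h2.comp_hasDerivAt (0 : ℝ) hline
      exact (Complex.imCLM.hasFDerivAt.comp_hasDerivAt (0 : ℝ) h3).const_mul (a s)
    refine not_hasDerivAt_neg_of_sign_eq (hdl p hp.1)
      (B := fun t => a q * (inChart (n := n) x (f q) (coord x + t • v)).im)
      (by
        have h1 := hdl q hq.1
        rwa [← hfd', show a q * _ = -(a p * _) by rw [hneg, neg_mul]] at h1)
      ?_ ?_ (mul_ne_zero (ha0 p) hv) ?_
    · simp [hinx, hF.im_eq_zero p x ⟨hx, hp.1⟩]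
    · simp [hinx, hF.im_eq_zero q x ⟨hx, hq.1⟩]
    · have h1 := eventually_symm_mem (mem_chart_source (Cn n) x)
        (((hSo p).inter (hSo q)).mem_nhds ⟨hp.2, hq.2⟩)
      have h2 : Tendsto (fun t : ℝ => coord (n := n) x + t • v) (𝓝 0) (𝓝 (coord x)) := by
        simpa using hline.continuousAt.tendsto
      filter_upwards [h2.eventually h1] with t ht
      have h3 := (hS p _ ht.1).trans (hS q _ ht.2).symm
      exact h3
  refine ⟨fun p => W p ∩ S p, fun p y => (a p : ℂ) * f p y,
    ⟨fun p => (hF.isOpen p).inter (hSo p), fun p => ⟨hF.mem_self p, hpS p⟩, fun p => ?_,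
      fun p x hx => ?_, fun p x hx => ?_, fun p x hx => ?_, fun p q x hx hp hq => ?_⟩,
    fun p y hy => ?_⟩
  · have h1 := (L p).contMDiff.comp_contMDiffOn ((hF.contMDiffOn p).mono
      (Set.inter_subset_left (t := S p)))
    refine h1.congr fun y _ => ?_
    simp [L]
  · simp [hF.im_eq_zero p x ⟨hx.1, hx.2.1⟩]
  · intro h0
    have h1 : HasFDerivAt (inChart (n := n) x fun y => ((a p : ℂ) * f p y).im)
        (a p • fderiv ℝ (inChart (n := n) x fun y => (f p y).im) (coord x)) (coord x) := by
      have h2 := ((contMDiffAt_iff_inChart (mem_chart_source (Cn n) x)).1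
        ((hF.contMDiffOn_im p).contMDiffAt ((hF.isOpen p).mem_nhds hx.2.1))).differentiableAt
          (ord_ne_zero hr)
      refine (h2.hasFDerivAt.const_mul (a p)).congr_of_eventuallyEq
        (Eventually.of_forall fun z => ?_)
      simp [inChart]
    rw [h1.fderiv] at h0
    exact (smul_ne_zero (ha0 p) (hF.fderiv_im_ne_zero p x ⟨hx.1, hx.2.1⟩)) h0
  · have h1 := hF.dbar p x ⟨hx.1, hx.2.1⟩
    have hc := hF.contDiffAt_inChart p hx.2.1
    refine (h1.clm_comp (a p • ContinuousLinearMap.id ℝ (Cn n →L[ℝ] ℂ))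
      (ContDiffAt.dbar hr hc)).congr ?_
    filter_upwards [(hc.of_le (WithTop.coe_le_coe.2 hr : (1 : WithTop ℕ∞) ≤ ord r)).eventually
      (by simp)] with z hz
    have h2 : fderiv ℝ (inChart (n := n) x fun y => (a p : ℂ) * f p y) z =
        a p • fderiv ℝ (inChart (n := n) x (f p)) z := by
      refine HasFDerivAt.fderiv (((hz.differentiableAt one_ne_zero).hasFDerivAt.const_smul
        (a p)).congr_of_eventuallyEq (Eventually.of_forall fun z => ?_))
      simp [inChart]
    ext v
    change a p • (LeviFlat.dbar (inChart (n := n) x (f p)) z v) = _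
    rw [dbar_apply, dbar_apply, h2, _root_.smul_apply, _root_.smul_apply]
    simp only [Complex.real_smul, smul_eq_mul]
    ring
  · have h1 := hF.compat p q x hx hp.1 hq.1
    have hc := (hF.contDiffAt_inChart p hp.1).sub (hF.contDiffAt_inChart q hq.1)
    refine (h1.clm_comp (a p • ContinuousLinearMap.id ℝ (Cn n →L[ℝ] ℂ))
      (ContDiffAt.fderiv_ord hc hr)).congr ?_
    filter_upwards [(hc.of_le (WithTop.coe_le_coe.2 hr : (1 : WithTop ℕ∞) ≤ ord r)).eventually
      (by simp)] with z hz
    refine (HasFDerivAt.fderiv (((hz.differentiableAt one_ne_zero).hasFDerivAt.const_smul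
        (a p)).congr_of_eventuallyEq (Eventually.of_forall fun z => ?_))).symm
    simp [inChart, hsame p q x hx hp hq]
    ring
  · simpa using hS p y hy.2

end Sign

/-! ### Global defining functions and flattenings -/

section Final

variable {n : ℕ} {X : Type*} [TopologicalSpace X] [ChartedSpace (Cn n) X]
  {r : ℕ∞} {M : Set X} {W : M → Set X} {f : M → X → ℂ}

/-- A function with the sign of a global defining function off `M` has no zeros off `M`. -/
lemma IsDefiningFunction.mem_of_eq_zero {ρ v : X → ℝ} (hρ : IsDefiningFunction n r M Set.univ ρ)
    (h : ∀ x ∉ M, (0 < ρ x → 0 < v x) ∧ (ρ x < 0 → v x < 0)) (x : X) (hx : v x = 0) : x ∈ M := by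
  by_contra hxM
  have h0 : ρ x ≠ 0 := fun h0 => hxM (by
    have : x ∈ M ∩ Set.univ := by rw [hρ.isLocal.zero_set]; exact ⟨Set.mem_univ x, h0⟩
    exact this.1)
  rcases lt_or_gt_of_ne h0 with h1 | h1
  · exact ((h x hxM).2 h1).ne hx
  · exact ((h x hxM).1 h1).ne' hx

variable [IsManifold 𝓘(ℂ, Cn n) ω X]

/-- Gluing of functions `g p` near the points `p` of a closed set `M`, with a function `g₀` on the
complement of `M`. -/
theorem exists_glue_of_isClosed [T2Space X] [SecondCountableTopology X] {E : Type*}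
    [NormedAddCommGroup E] [NormedSpace ℝ E] (hM : IsClosed M) (hW : ∀ p, IsOpen (W p))
    (hself : ∀ p : M, (p : X) ∈ W p) {g : M → X → E} {g₀ : X → E}
    (hg : ∀ p, ContMDiffOn 𝓘(ℝ, Cn n) 𝓘(ℝ, E) (ord r) (g p) (W p))
    (hg₀ : ContMDiff 𝓘(ℝ, Cn n) 𝓘(ℝ, E) (ord r) g₀)
    (hj : ∀ x ∈ M, ∀ p q, x ∈ W p → x ∈ W q →
      JetVanishesAt r (inChart (n := n) x fun y => g p y - g q y) (coord x)) :
    ∃ G : X → E, ContMDiff 𝓘(ℝ, Cn n) 𝓘(ℝ, E) (ord r) G ∧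
      (∀ p : M, JetVanishesAt r (inChart (n := n) (p : X) fun y => G y - g p y) (coord (p : X))) ∧
      ∀ x ∉ M, ∀ C : Set E, Convex ℝ C → g₀ x ∈ C → (∀ p, x ∈ W p → g p x ∈ C) → G x ∈ C := by
  obtain ⟨G, hG, hGj, hGc⟩ := exists_glue (n := n) (r := r) (M := M)
    (W := fun i : Option M => i.elim Mᶜ W) (g := fun i : Option M => i.elim g₀ g) (by
      rintro (_ | p)
      exacts [hM.isOpen_compl, hW p]) (fun x => by
      by_cases hx : x ∈ M
      exacts [⟨some ⟨x, hx⟩, hself ⟨x, hx⟩⟩, ⟨none, hx⟩]) (by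
      rintro (_ | p)
      exacts [hg₀.contMDiffOn, hg p]) (by
      rintro x hx (_ | p) (_ | q) hp hq
      exacts [absurd hx hp, absurd hx hp, absurd hx hq, hj x hx p q hp hq])
  refine ⟨G, hG, fun p => hGj p p.2 (some p) (hself p), fun x hx C hC h0 hp => hGc x C hC ?_⟩
  rintro (_ | p) hxp
  exacts [h0, hp p hxp]

namespace IsFlatteningFamily

lemma jetVanishesAt_im_sub (hr : 1 ≤ r) (hF : IsFlatteningFamily n r M W f) {x : X} (hx : x ∈ M)
    {p q : M} (hp : x ∈ W p) (hq : x ∈ W q) :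
    JetVanishesAt r (inChart (n := n) x fun y => (f p y).im - (f q y).im) (coord x) := by
  have h1 := JetVanishesAt.sub_const hr (hF.compat p q x hx hp hq)
  refine (h1.clm_comp Complex.imCLM (((hF.contDiffAt_inChart p hp).sub
    (hF.contDiffAt_inChart q hq)).sub contDiffAt_const)).congr (Eventually.of_forall fun z => ?_)
  have h2 : (inChart (n := n) x (fun y => f p y - f q y) (coord x)).im = 0 := by
    have h3 : (chartAt (Cn n) x).symm (coord x) = x :=
      (chartAt (Cn n) x).left_inv (mem_chart_source _ x)
    simp [inChart, h3, hF.im_eq_zero p x ⟨hx, hp⟩, hF.im_eq_zero q x ⟨hx, hq⟩]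
  simp [h2]
  simp [inChart]

variable {v : X → ℝ}

lemma eq_zero_and_fderiv_ne_zero_of_jet (hr : 1 ≤ r) (hF : IsFlatteningFamily n r M W f)
    (hv : ContMDiff 𝓘(ℝ, Cn n) 𝓘(ℝ, ℝ) (ord r) v)
    (hj : ∀ p : M, JetVanishesAt r (inChart (n := n) (p : X) fun y => v y - (f p y).im)
      (coord (p : X))) (p : M) :
    v p = 0 ∧ fderiv ℝ (inChart (n := n) (p : X) v) (coord (p : X)) ≠ 0 := by
  have hs := mem_chart_source (Cn n) (p : X)
  have h3 : (chartAt (Cn n) (p : X)).symm (coord (p : X)) = p :=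
    (chartAt (Cn n) (p : X)).left_inv hs
  obtain ⟨h1, h2⟩ := (JetVanishesAt.fderiv_sub_one hr).1 (hj p)
  have hp0 : (f p p).im = 0 := hF.im_eq_zero p p ⟨p.2, hF.mem_self p⟩
  constructor
  · have h4 : v ((chartAt (Cn n) (p : X)).symm (coord (p : X))) -
      (f p ((chartAt (Cn n) (p : X)).symm (coord (p : X)))).im = 0 := h1
    rwa [h3, hp0, sub_zero] at h4
  · have h4 : fderiv ℝ (inChart (n := n) (p : X) fun y => v y - (f p y).im) (coord (p : X)) = _ :=
      fderiv_fun_sub (((contMDiffAt_iff_inChart hs).1 hv.contMDiffAt).differentiableAt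
        (ord_ne_zero hr)) (((contMDiffAt_iff_inChart hs).1 ((hF.contMDiffOn_im p).contMDiffAt
          ((hF.isOpen p).mem_nhds (hF.mem_self p)))).differentiableAt (ord_ne_zero hr))
    rw [h2.apply_eq_zero] at h4
    have h5 := sub_eq_zero.1 h4.symm
    exact fun h6 => hF.fderiv_im_ne_zero p p ⟨p.2, hF.mem_self p⟩ (h5.symm.trans h6)

/-- A function with the same `r`-jets along `M` as the imaginary parts of the flattenings is a
defining function of `M`, on any neighbourhood where it has no other zeros. -/
lemma isDefiningFunction (hr : 1 ≤ r) (hF : IsFlatteningFamily n r M W f)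
    (hv : ContMDiff 𝓘(ℝ, Cn n) 𝓘(ℝ, ℝ) (ord r) v)
    (hj : ∀ p : M, JetVanishesAt r (inChart (n := n) (p : X) fun y => v y - (f p y).im)
      (coord (p : X))) {U : Set X} (hU : IsOpen U) (hMU : M ⊆ U) (h0 : ∀ y ∈ U, v y = 0 → y ∈ M) :
    IsDefiningFunction n r M U v := by
  refine ⟨⟨hU, hv.contMDiffOn, ?_, fun x hx => ?_⟩, hMU⟩
  · ext x
    exact ⟨fun hx => ⟨hx.2, (hF.eq_zero_and_fderiv_ne_zero_of_jet hr hv hj ⟨x, hx.1⟩).1⟩,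
      fun hx => ⟨h0 x hx.1 hx.2, hx.1⟩⟩
  · rw [ContMDiffOn.differential_eq hr hU hv.contMDiffOn hx.2]
    exact (hF.eq_zero_and_fderiv_ne_zero_of_jet hr hv hj ⟨x, hx.1⟩).2

/-- Without control on its zeros away from `M`, such a function is a defining function of `M` on
some neighbourhood: near a point of `M` it has the sign of a local defining function, or the
opposite one. -/
lemma exists_isDefiningFunction (hr : 1 ≤ r) (hM : IsRealHypersurface n r M)
    (hF : IsFlatteningFamily n r M W f)
    (hv : ContMDiff 𝓘(ℝ, Cn n) 𝓘(ℝ, ℝ) (ord r) v)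
    (hj : ∀ p : M, JetVanishesAt r (inChart (n := n) (p : X) fun y => v y - (f p y).im)
      (coord (p : X))) : ∃ U : Set X, IsDefiningFunction n r M U v := by
  refine ⟨interior {y | v y = 0 → y ∈ M}, hF.isDefiningFunction hr hv hj isOpen_interior
    (fun x hx => ?_) fun y hy => interior_subset hy⟩
  obtain ⟨U, ρ, hxU, hρ⟩ := hM x hx
  have key := hρ.eventually_sign_eq_or hr ⟨hx, hxU⟩ isOpen_univ (Set.mem_univ x) hv.contMDiffOn
    (fun y hy => (hF.eq_zero_and_fderiv_ne_zero_of_jet hr hv hj ⟨y, hy.1⟩).1)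
    (hF.eq_zero_and_fderiv_ne_zero_of_jet hr hv hj ⟨x, hx⟩).2
  have h1 : ∀ᶠ y in 𝓝 x, v y = 0 → ρ y = 0 := by
    rcases key with h | h <;> filter_upwards [h] with y hy hy0
    · rw [hy0, sign_zero] at hy
      exact sign_eq_zero_iff.1 hy.symm
    · rw [hy0, sign_zero, ← Left.sign_neg] at hy
      exact neg_eq_zero.1 (sign_eq_zero_iff.1 hy.symm)
  rw [mem_interior_iff_mem_nhds]
  filter_upwards [h1, hρ.isOpen.mem_nhds hxU] with y hy hyU hy0
  have : y ∈ M ∩ U := by rw [hρ.zero_set]; exact ⟨hyU, hy hy0⟩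
  exact this.1

lemma ddcJetVanishesOn (hr : 2 ≤ r) (hF : IsFlatteningFamily n r M W f)
    (hv : ContMDiff 𝓘(ℝ, Cn n) 𝓘(ℝ, ℝ) (ord r) v)
    (hj : ∀ p : M, JetVanishesAt r (inChart (n := n) (p : X) fun y => v y - (f p y).im)
      (coord (p : X))) : DdcJetVanishesOn n (r - 2) M v := by
  have hr1 : 1 ≤ r := le_trans (by norm_num) hr
  intro x hx
  have hs := mem_chart_source (Cn n) x
  have hp := hF.mem_self ⟨x, hx⟩
  refine JetVanishesAt.ddc_of_sub hr ((contMDiffAt_iff_inChart hs).1 hv.contMDiffAt)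
    ((contMDiffAt_iff_inChart hs).1 ((hF.contMDiffOn_im ⟨x, hx⟩).contMDiffAt
      ((hF.isOpen _).mem_nhds hp))) ((JetVanishesAt.fderiv_sub_one hr1).1 (hj ⟨x, hx⟩)).2 ?_
  exact JetVanishesAt.ddc_im hr (hF.contDiffAt_inChart _ hp) (hF.dbar ⟨x, hx⟩ x ⟨hx, hp⟩)

lemma dbarJetVanishesOn (hr : 1 ≤ r) (hF : IsFlatteningFamily n r M W f) {G : X → ℂ}
    (hG : ContMDiff 𝓘(ℝ, Cn n) 𝓘(ℝ, ℂ) (ord r) G)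
    (hj : ∀ p : M, JetVanishesAt r (inChart (n := n) (p : X) fun y => G y - f p y)
      (coord (p : X))) : DbarJetVanishesOn n (r - 1) M G := by
  intro x hx
  have hp := hF.mem_self ⟨x, hx⟩
  exact JetVanishesAt.dbar_of_sub hr
    ((contMDiffAt_iff_inChart (mem_chart_source (Cn n) x)).1 hG.contMDiffAt)
    (hF.contDiffAt_inChart _ hp) ((JetVanishesAt.fderiv_sub_one hr).1 (hj ⟨x, hx⟩)).2
    (hF.dbar ⟨x, hx⟩ x ⟨hx, hp⟩)

lemma jetVanishesAt_im_of_jet (hF : IsFlatteningFamily n r M W f) {G : X → ℂ}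
    (hG : ContMDiff 𝓘(ℝ, Cn n) 𝓘(ℝ, ℂ) (ord r) G)
    (hj : ∀ p : M, JetVanishesAt r (inChart (n := n) (p : X) fun y => G y - f p y)
      (coord (p : X))) (p : M) :
    JetVanishesAt r (inChart (n := n) (p : X) fun y => (G y).im - (f p y).im) (coord (p : X)) := by
  refine ((hj p).clm_comp Complex.imCLM
    (((contMDiffAt_iff_inChart (mem_chart_source (Cn n) (p : X))).1 hG.contMDiffAt).sub
      (hF.contDiffAt_inChart p (hF.mem_self p)))).congr (Eventually.of_forall fun z => ?_)
  simp [inChart]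

variable [T2Space X] [SecondCountableTopology X]

/-- Gluing of the imaginary parts of the flattenings with a function `g₀` on the
complement of `M`. -/
theorem exists_glue_im (hr : 1 ≤ r) (hM : IsClosed M) (hF : IsFlatteningFamily n r M W f)
    {g₀ : X → ℝ} (hg₀ : ContMDiff 𝓘(ℝ, Cn n) 𝓘(ℝ, ℝ) (ord r) g₀) :
    ∃ v : X → ℝ, ContMDiff 𝓘(ℝ, Cn n) 𝓘(ℝ, ℝ) (ord r) v ∧
      (∀ p : M, JetVanishesAt r (inChart (n := n) (p : X) fun y => v y - (f p y).im)
        (coord (p : X))) ∧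
      ∀ x ∉ M, ∀ C : Set ℝ, Convex ℝ C → g₀ x ∈ C → (∀ p, x ∈ W p → (f p x).im ∈ C) → v x ∈ C :=
  exists_glue_of_isClosed hM hF.isOpen hF.mem_self hF.contMDiffOn_im hg₀
    fun _ hx _ _ hp hq => hF.jetVanishesAt_im_sub hr hx hp hq

/-- Gluing of the flattenings themselves, when they agree on `M`. -/
theorem exists_glue_of_eq (hr : 1 ≤ r) (hM : IsClosed M) (hF : IsFlatteningFamily n r M W f)
    (heq : ∀ p q, ∀ x ∈ M, x ∈ W p → x ∈ W q → f p x = f q x)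
    {g₀ : X → ℂ} (hg₀ : ContMDiff 𝓘(ℝ, Cn n) 𝓘(ℝ, ℂ) (ord r) g₀) :
    ∃ G : X → ℂ, ContMDiff 𝓘(ℝ, Cn n) 𝓘(ℝ, ℂ) (ord r) G ∧
      (∀ p : M, JetVanishesAt r (inChart (n := n) (p : X) fun y => G y - f p y)
        (coord (p : X))) ∧
      ∀ x ∉ M, ∀ C : Set ℂ, Convex ℝ C → g₀ x ∈ C → (∀ p, x ∈ W p → f p x ∈ C) → G x ∈ C := by
  refine exists_glue_of_isClosed hM hF.isOpen hF.mem_self hF.contMDiffOn hg₀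
    fun x hx p q hp hq => (JetVanishesAt.fderiv_sub_one hr).2 ⟨?_, hF.compat p q x hx hp hq⟩
  have h3 : (chartAt (Cn n) x).symm (coord x) = x :=
    (chartAt (Cn n) x).left_inv (mem_chart_source _ x)
  simp [inChart, h3, heq p q x hx hp hq]

end IsFlatteningFamily

variable [T2Space X] [SecondCountableTopology X]

theorem exists_hasPluriharmonicDefiningFunction (hr : 2 ≤ r) (hclosed : IsClosed M)
    (hM : IsRealHypersurface n r M) (h : LeviFoliationDefinedByClosedForm n r M) :
    ∃ U : Set X, HasPluriharmonicDefiningFunction n r M U := by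
  have hr1 : 1 ≤ r := le_trans (by norm_num) hr
  obtain ⟨W, f, hF⟩ := exists_isFlatteningFamily hr hM h
  obtain ⟨v, hv, hj, -⟩ := hF.exists_glue_im hr1 hclosed (g₀ := fun _ => 0) contMDiff_const
  obtain ⟨U, hU⟩ := hF.exists_isDefiningFunction hr1 hM hv hj
  exact ⟨U, v, hU, hF.ddcJetVanishesOn hr hv hj⟩

theorem exists_hasHolomorphicFlattening [SimplyConnectedSpace M] (hr : 2 ≤ r)
    (hclosed : IsClosed M) (hM : IsRealHypersurface n r M)
    (h : LeviFoliationDefinedByClosedForm n r M) :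
    ∃ U : Set X, HasHolomorphicFlattening n r M U := by
  have hr1 : 1 ≤ r := le_trans (by norm_num) hr
  obtain ⟨W₀, f₀, hF₀⟩ := exists_isFlatteningFamily hr hM h
  obtain ⟨W, c, -, hF, heq⟩ := hF₀.exists_eq hr1 hM
  obtain ⟨G, hG, hj, -⟩ := hF.exists_glue_of_eq hr1 hclosed heq (g₀ := fun _ => 0) contMDiff_const
  have hv : ContMDiff 𝓘(ℝ, Cn n) 𝓘(ℝ, ℝ) (ord r) fun y => (G y).im :=
    Complex.imCLM.contMDiff.comp hG
  obtain ⟨U, hU⟩ := hF.exists_isDefiningFunction hr1 hM hv (hF.jetVanishesAt_im_of_jet hG hj)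
  exact ⟨U, G, hG.contMDiffOn, hU, hF.dbarJetVanishesOn hr1 hG hj⟩

theorem IsDefiningFunction.hasPluriharmonicDefiningFunction {ρ : X → ℝ}
    (hρ : IsDefiningFunction n r M Set.univ ρ) (hr : 2 ≤ r) (hclosed : IsClosed M)
    (hM : IsRealHypersurface n r M) (h : LeviFoliationDefinedByClosedForm n r M) :
    HasPluriharmonicDefiningFunction n r M Set.univ := by
  have hr1 : 1 ≤ r := le_trans (by norm_num) hr
  obtain ⟨W₀, f₀, hF₀⟩ := exists_isFlatteningFamily hr hM h
  obtain ⟨W, f, hF, hsign⟩ := hF₀.exists_sign_eq hr1 hρ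
  obtain ⟨v, hv, hj, hconv⟩ := hF.exists_glue_im hr1 hclosed
    (contMDiffOn_univ.1 hρ.isLocal.contMDiffOn)
  refine ⟨v, hF.isDefiningFunction hr1 hv hj isOpen_univ (Set.subset_univ _) fun y _ =>
    hρ.mem_of_eq_zero (v := v) (fun x hx => ⟨fun h0 => ?_, fun h0 => ?_⟩) y,
    hF.ddcJetVanishesOn hr hv hj⟩
  -- The values of `v` at a point are convex combinations of numbers of the sign of `ρ` there.
  · refine hconv x hx (Set.Ioi 0) (convex_Ioi 0) h0 fun p hp => ?_
    exact sign_eq_one_iff.1 ((hsign p x hp).trans (sign_pos h0))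
  · refine hconv x hx (Set.Iio 0) (convex_Iio 0) h0 fun p hp => ?_
    exact sign_eq_neg_one_iff.1 ((hsign p x hp).trans (sign_neg h0))

theorem IsDefiningFunction.hasHolomorphicFlattening [SimplyConnectedSpace M] {ρ : X → ℝ}
    (hρ : IsDefiningFunction n r M Set.univ ρ) (hr : 2 ≤ r) (hclosed : IsClosed M)
    (hM : IsRealHypersurface n r M) (h : LeviFoliationDefinedByClosedForm n r M) :
    HasHolomorphicFlattening n r M Set.univ := by
  have hr1 : 1 ≤ r := le_trans (by norm_num) hr
  obtain ⟨W₀, f₀, hF₀⟩ := exists_isFlatteningFamily hr hM h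
  obtain ⟨W₁, f₁, hF₁, hsign⟩ := hF₀.exists_sign_eq hr1 hρ
  obtain ⟨W, c, hsub, hF, heq⟩ := hF₁.exists_eq hr1 hM
  have hg₀ : ContMDiff 𝓘(ℝ, Cn n) 𝓘(ℝ, ℂ) (ord r) fun y => Complex.I * (ρ y : ℂ) :=
    (Complex.I • Complex.ofRealCLM : ℝ →L[ℝ] ℂ).contMDiff.comp
      (contMDiffOn_univ.1 hρ.isLocal.contMDiffOn)
  obtain ⟨G, hG, hj, hconv⟩ := hF.exists_glue_of_eq hr1 hclosed heq hg₀
  have hv : ContMDiff 𝓘(ℝ, Cn n) 𝓘(ℝ, ℝ) (ord r) fun y => (G y).im :=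
    Complex.imCLM.contMDiff.comp hG
  refine ⟨G, hG.contMDiffOn, hF.isDefiningFunction hr1 hv (hF.jetVanishesAt_im_of_jet hG hj)
    isOpen_univ (Set.subset_univ _) fun y _ =>
    hρ.mem_of_eq_zero (v := fun y => (G y).im) (fun x hx => ⟨fun h0 => ?_, fun h0 => ?_⟩) y,
    hF.dbarJetVanishesOn hr1 hG hj⟩
  · refine hconv x hx {c | 0 < c.im} (convex_halfSpace_im_gt 0) (by simpa using h0) fun p hp => ?_
    have := sign_eq_one_iff.1 ((hsign p x (hsub p hp)).trans (sign_pos h0))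
    simpa using this
  · refine hconv x hx {c | c.im < 0} (convex_halfSpace_im_lt 0) (by simpa using h0) fun p hp => ?_
    have := sign_eq_neg_one_iff.1 ((hsign p x (hsub p hp)).trans (sign_neg h0))
    simpa using this

end Final

end LeviFlat

end

/-- The first conjunct is about functions on an open neighbourhood of `M`; the second is about
functions on all of `X`, when `M` has some defining function on all of `X`. -/
theorem proposition3p1 (n : ℕ) (r : ℕ∞) (hr : 2 ≤ r)
    {X : Type*} [TopologicalSpace X] [T2Space X] [SecondCountableTopology X]
    [ChartedSpace (Cn n) X] [IsManifold 𝓘(ℂ, Cn n) ω X]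
    (M : Set X) (hclosed : IsClosed M) (hM : IsRealHypersurface n r M)
    (hflat : IsLeviFlat n r M) :
    (((∃ U : Set X, HasPluriharmonicDefiningFunction n r M U) ↔
        LeviFoliationDefinedByClosedForm n r M) ∧
      (SimplyConnectedSpace M →
        [∃ U : Set X, HasPluriharmonicDefiningFunction n r M U,
          LeviFoliationDefinedByClosedForm n r M,
          ∃ U : Set X, HasHolomorphicFlattening n r M U].TFAE)) ∧
    ((∃ ρ : X → ℝ, IsDefiningFunction n r M Set.univ ρ) →
      (HasPluriharmonicDefiningFunction n r M Set.univ ↔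
        LeviFoliationDefinedByClosedForm n r M) ∧
      (SimplyConnectedSpace M →
        [HasPluriharmonicDefiningFunction n r M Set.univ,
          LeviFoliationDefinedByClosedForm n r M,
          HasHolomorphicFlattening n r M Set.univ].TFAE)) := by
  have h12 : (∃ U : Set X, HasPluriharmonicDefiningFunction n r M U) →
      LeviFoliationDefinedByClosedForm n r M :=
    fun ⟨_, hU⟩ => hU.leviFoliationDefinedByClosedForm hr
  have h21 := exists_hasPluriharmonicDefiningFunction hr hclosed hM
  refine ⟨⟨⟨h12, h21⟩, fun _ => ?_⟩, fun ⟨ρ, hρ⟩ => ?_⟩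
  · tfae_have 1 → 2 := h12
    tfae_have 2 → 3 := exists_hasHolomorphicFlattening hr hclosed hM
    tfae_have 3 → 1 := fun ⟨U, hU⟩ => ⟨U, hU.hasPluriharmonicDefiningFunction hr⟩
    tfae_finish
  · have h12' : HasPluriharmonicDefiningFunction n r M Set.univ →
        LeviFoliationDefinedByClosedForm n r M := fun h => h12 ⟨_, h⟩
    refine ⟨⟨h12', hρ.hasPluriharmonicDefiningFunction hr hclosed hM⟩, fun _ => ?_⟩
    tfae_have 1 → 2 := h12'
    tfae_have 2 → 3 := hρ.hasHolomorphicFlattening hr hclosed hM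
    tfae_have 3 → 1 := fun hU => hU.hasPluriharmonicDefiningFunction hr
    tfae_finish
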